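/- Consider plane sextics $C=\{F=0\}\subset\mathbb{CP}^2$ defined by a real ternary form $F$ of degree $6$ (up to a nonzero real factor), with the real structure $[z_0:z_1:z_2]\mapsto[\bar z_0:\bar z_1:\bar z_2]$. Call $C$ *reduced* if $F$ is square-free over $\mathbb C$, *empty* if $C$ has no real points, and *non-simple* if at least one of its singular points is not of type $\mathbf A_n$ ($n\ge1$), $\mathbf D_n$ ($n\ge4$), $\mathbf E_6$, $\mathbf E_7$ or $\mathbf E_8$. An *equisingular equivariant deformation* is a continuous path $C_t$, $t\in[0,1]$, of reduced real sextics that is topologically trivial: $C_t=h_t(C_0)$ for a continuous family of homeomorphisms $h_t$ of $\mathbb{CP}^2$ with $h_0=\mathrm{id}$, each commuting with complex conjugation. Sextics are in the same *deformation family* if they can be connected by such deformations. Then: 1. There are exactly two deformation families of reduced non-simple empty sextics. 2. Each such sextic splits into three irreducible conics that are pairwise tangent to each other at each of two distinct complex conjugate points $O$, $\bar O$. These are the only singular points of the sextic, and both are of type $\mathbf J_{10}$, i.e. analytically equivalent to $x^3+ax^2y^2+y^6=0$ for some $a\in\mathbb C$ with $4a^3+27\ne0$. One of the conics is real, and the two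 others are either both real or (non-real and) complex conjugate to each other. 3. Two such sextics are in the same deformation family if and only if the numbers of their real conic components ($3$ or $1$) are the same. In particular, both cases occur. -/

import Mathlib

open scoped LinearAlgebra.Projectivization

namespace EmptySextics

/-! ### The complex projective plane with its standard real structure -/

/-- The complex projective plane. -/
abbrev CP2 : Type := ℙ ℂ (Fin 3 → ℂ)

/-- The usual (quotient) topology of the complex projective plane. -/
instance instTopologicalSpaceCP2 : TopologicalSpace CP2 :=
  inferInstanceAs
    (TopologicalSpace (Quotient (projectivizationSetoid ℂ (Fin 3 → ℂ))))

/-- The real structure `[z₀ : z₁ : z₂] ↦ [conj z₀ : conj z₁ : conj z₂]`. -/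
noncomputable def conjPoint : CP2 → CP2 :=
  Projectivization.map (starLinearEquiv ℂ : (Fin 3 → ℂ) ≃ₗ⋆[ℂ] (Fin 3 → ℂ)).toLinearMap
    (starLinearEquiv ℂ : (Fin 3 → ℂ) ≃ₗ⋆[ℂ] (Fin 3 → ℂ)).injective

/-! ### Plane curves, given by ternary forms -/

/-- A real ternary form, regarded as a complex one. -/
noncomputable def complexify (F : MvPolynomial (Fin 3) ℝ) : MvPolynomial (Fin 3) ℂ :=
  MvPolynomial.map Complex.ofRealHom F

/-- The form obtained by conjugating all coefficients; its zero locus is the complex conjugate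
of the original zero locus. -/
noncomputable def conjForm (Q : MvPolynomial (Fin 3) ℂ) : MvPolynomial (Fin 3) ℂ :=
  MvPolynomial.map (starRingEnd ℂ) Q

/-- The gradient of a form at a vector. -/
noncomputable def grad (Q : MvPolynomial (Fin 3) ℂ) (v : Fin 3 → ℂ) : Fin 3 → ℂ :=
  fun i => MvPolynomial.eval v (MvPolynomial.pderiv i Q)

/-- The set of complex points of the curve `Q = 0`. -/
def curve (Q : MvPolynomial (Fin 3) ℂ) : Set CP2 :=
  {p | MvPolynomial.eval p.rep Q = 0}

/-- The singular points of the curve `Q = 0`. -/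
def singularPoints (Q : MvPolynomial (Fin 3) ℂ) : Set CP2 :=
  {p | MvPolynomial.eval p.rep Q = 0 ∧ grad Q p.rep = 0}

/-- `P = 0` and `Q = 0` are both smooth at `p` and have the same tangent line there. -/
def AreTangentAt (P Q : MvPolynomial (Fin 3) ℂ) (p : CP2) : Prop :=
  p ∈ curve P ∧ p ∈ curve Q ∧ grad P p.rep ≠ 0 ∧
    ∃ c : ℂ, c ≠ 0 ∧ grad Q p.rep = c • grad P p.rep

/-- Irreducible (equivalently, smooth) complex conics. -/
def IsConic (Q : MvPolynomial (Fin 3) ℂ) : Prop :=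
  Q.IsHomogeneous 2 ∧ Irreducible Q

/-! ### Types of singular points -/

/-- Formal power series in two variables. -/
abbrev Germ : Type := MvPowerSeries (Fin 2) ℂ

/-- The coordinates `x`, `y` on the germ of the plane. -/
noncomputable abbrev gx : Germ := MvPowerSeries.X 0

/-- The second coordinate. -/
noncomputable abbrev gy : Germ := MvPowerSeries.X 1

/-- Contact equivalence: the germs of curves `f = 0` and `g = 0` differ by a (formal) change of
coordinates.  For isolated singularities this is the same as analytic equivalence. -/
def ContactEquivalent (f g : Germ) : Prop :=
  ∃ (φ : Germ ≃ₐ[ℂ] Germ) (u : Germˣ), φ f = u * g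

/-- The normal forms of the simple singularities **A**, **D**, **E**. -/
def adeNormalForms : Set Germ :=
  {g | (∃ n : ℕ, 1 ≤ n ∧ g = gx ^ 2 + gy ^ (n + 1)) ∨
       (∃ n : ℕ, 4 ≤ n ∧ g = gx ^ 2 * gy + gy ^ (n - 1)) ∨
       g = gx ^ 3 + gy ^ 4 ∨
       g = gx ^ 3 + gx * gy ^ 3 ∨
       g = gx ^ 3 + gy ^ 5}

/-- The normal forms of the singularities of type **J**₁₀. -/
def j10NormalForms : Set Germ :=
  {g | ∃ a : ℂ, 4 * a ^ 3 + 27 ≠ 0 ∧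
    g = gx ^ 3 + MvPowerSeries.C a * gx ^ 2 * gy ^ 2 + gy ^ 6}

/-- The local equation of `Q = 0` at the point represented by `v`, in the affine coordinates
`(x, y) ↦ [v + x a + y b]`. -/
noncomputable def localEquation (Q : MvPolynomial (Fin 3) ℂ) (v a b : Fin 3 → ℂ) : Germ :=
  ((MvPolynomial.aeval
    (fun i => MvPolynomial.C (v i) + MvPolynomial.C (a i) * MvPolynomial.X 0
      + MvPolynomial.C (b i) * MvPolynomial.X 1) Q : MvPolynomial (Fin 2) ℂ) : Germ)

/-- The germ of the curve `Q = 0` at `p` is equivalent to one of the normal forms in `N`.  (The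
affine coordinates are immaterial: a change of them is a change of coordinates combined with the
multiplication of the equation by a unit.) -/
def HasGermType (Q : MvPolynomial (Fin 3) ℂ) (p : CP2) (N : Set Germ) : Prop :=
  ∃ v a b : Fin 3 → ℂ, ∃ h : LinearIndependent ℂ ![v, a, b],
    p = Projectivization.mk ℂ v (h.ne_zero 0) ∧
    ∃ g ∈ N, ContactEquivalent (localEquation Q v a b) g

/-! ### Real sextics and their deformations -/

/-- `F` defines a reduced real plane sextic; the curve is the form up to a real factor. -/
structure IsReducedSextic (F : MvPolynomial (Fin 3) ℝ) : Prop where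
  homogeneous : F.IsHomogeneous 6
  reduced : Squarefree (complexify F)

/-- `F` defines a reduced real plane sextic with empty real part and with at least one singular
point that is not simple. -/
structure IsNonSimpleEmptySextic (F : MvPolynomial (Fin 3) ℝ) : Prop
    extends IsReducedSextic F where
  empty : ∀ v : Fin 3 → ℝ, v ≠ 0 → MvPolynomial.eval v F ≠ 0
  nonsimple : ∃ p ∈ singularPoints (complexify F), ¬ HasGermType (complexify F) p adeNormalForms

/-- An equisingular equivariant deformation of the real sextic `F = 0` to the real sextic `G = 0`:
a continuous path of reduced real sextics which is topologically trivial, i.e. is followed by an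
ambient isotopy of the complex projective plane that commutes with the complex conjugation. -/
def EquisingularDeformation (F G : MvPolynomial (Fin 3) ℝ) : Prop :=
  ∃ Φ : unitInterval → MvPolynomial (Fin 3) ℝ,
    (∀ t, IsReducedSextic (Φ t)) ∧
    (∀ m, Continuous fun t => MvPolynomial.coeff m (Φ t)) ∧
    Φ 0 = F ∧ (∃ c : ℝ, c ≠ 0 ∧ Φ 1 = c • G) ∧
    ∃ H : unitInterval → CP2 ≃ₜ CP2,
      (Continuous fun q : unitInterval × CP2 => H q.1 q.2) ∧
      (∀ p, H 0 p = p) ∧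
      (∀ t p, H t (conjPoint p) = conjPoint (H t p)) ∧
      ∀ t, H t '' curve (complexify F) = curve (complexify (Φ t))

/-- The set of (equations of) reduced non-simple empty sextics. -/
def NonSimpleEmptySextic : Type :=
  {F : MvPolynomial (Fin 3) ℝ // IsNonSimpleEmptySextic F}

/-- The equisingular equivariant deformation families of reduced non-simple empty sextics:
the classes of the equivalence relation generated by the deformations. -/
def DeformationFamily : Type :=
  Quot fun F G : NonSimpleEmptySextic => EquisingularDeformation F.1 G.1

/-- The family of a sextic. -/
def family (F : NonSimpleEmptySextic) : DeformationFamily := Quot.mk _ F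

/-! ### The splitting -/

/-- The sextic `F = 0` splits into the three conics `Q i = 0`, which are pairwise tangent to each
other at each of the two complex conjugate points `O` and `conjPoint O`; these two points are the
only singular points of the sextic, and they are of type **J**₁₀. -/
structure SplitsIntoTangentConics (F : MvPolynomial (Fin 3) ℝ)
    (Q : Fin 3 → MvPolynomial (Fin 3) ℂ) (O : CP2) : Prop where
  eq_prod : complexify F = Q 0 * Q 1 * Q 2
  conic : ∀ i, IsConic (Q i)
  nonreal : conjPoint O ≠ O
  tangent : ∀ i j, i ≠ j →
    AreTangentAt (Q i) (Q j) O ∧ AreTangentAt (Q i) (Q j) (conjPoint O)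
  singular : singularPoints (complexify F) = {O, conjPoint O}
  j10 : HasGermType (complexify F) O j10NormalForms
  j10_conj : HasGermType (complexify F) (conjPoint O) j10NormalForms

/-- All three conic components are real. -/
def AllConicsReal (Q : Fin 3 → MvPolynomial (Fin 3) ℂ) : Prop :=
  ∀ i, conjForm (Q i) = Q i

/-- One conic component is real; the two others are not, and are complex conjugate to each
other. -/
def OneConicReal (Q : Fin 3 → MvPolynomial (Fin 3) ℂ) : Prop :=
  conjForm (Q 0) = Q 0 ∧ conjForm (Q 1) = Q 2 ∧ conjForm (Q 1) ≠ Q 1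

/-- The sextic splits as above into three real conics. -/
def HasThreeRealConics (F : MvPolynomial (Fin 3) ℝ) : Prop :=
  ∃ Q O, SplitsIntoTangentConics F Q O ∧ AllConicsReal Q

end EmptySextics

open EmptySextics

/-!
An empty sextic has no real points, so that each singular point `O` differs from its conjugate `Ō`.
If `O` is not simple, the equation is considered in coordinates adapted to this pair: linear forms
`w`, `u`, `v`, where `O` and `Ō` are the points `[0 : 1 : 0]` and `[0 : 0 : 1]`, and where complex
conjugation interchanges `u` and `v`.

**Local part.** The germ at `O` is reduced (`squarefree_germ`). A reduced germ with nonzero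
quadratic part is of type **A** (`isADE_of_two_jet`); one with nonzero cubic part is of type **D**
unless the cubic part is the cube of a linear form (`isADE_or_cube_of_three_jet`), and in the latter
case it is of type **E** unless all its terms have weight at least `6` for the weights `(2, 1)`
(`isADE_or_mem_Fil_of_cube`). These statements rest on a normal form theorem for germs with a given
quasi-homogeneous principal part (`exists_normal_form`): the coordinates are corrected weight by
weight, and the corrections converge. For a sextic without real points the coefficient of `u³v³` in
the adapted coordinates cannot vanish when the quadratic part at `O` does
(`coeff_ne_zero_of_eval_ne_zero`), since on the real line `w = 0` the form is then a multiple of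
`(uv)³`. Hence the multiplicity at `O` is three and the tangent cone is a triple line
(`exists_cube_of_not_isADE`). After a shift of the coordinates, all terms at `O` have weight at
least `6`; the same holds at `Ō`, and the only monomials of degree six allowed by both points are
`w^(6-2i) (uv)^i` (`eq_sum_of_germ_mem_Fil`). This is a cubic form in `w²` and `uv`, and so

  `F = c ∏ᵢ (z² - σᵢ (x² + y²))`

in suitable real coordinates (`exists_nf`). The set of the parameters `σᵢ` is invariant under
conjugation, the parameters are pairwise distinct because the form is square-free, and none of them
is a nonnegative real number because there are no real points (`Adm`).

**Splitting.** The conics `z² = σᵢ (x² + y²)` are tangent to each other at `[1 : ±i : 0]` and meet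
nowhere else. The germs at these points are brought to the normal form of **J**₁₀ explicitly
(`exists_j10`). They are not simple since they lie in the cube of the ideal of an infinitely near
point, a property that does not depend on the coordinates and fails for the normal forms of types
**A**, **D** and **E** (`not_isADE_of_mem_nearIdeal_pow`). Conjugation acts on the three parameters
as an involution, so that one or all three of them are real, and the number of the real conics is
read off from `σ` because the irreducible factors of a form are unique
(`HasNormalForm.hasThreeRealConics_iff`).

**Deformations.** Real projective transformations preserve the families
(`preservesFamilies_of_det_ne_zero`): an invertible matrix is a product of transvections and of a
diagonal matrix, each of which is connected to the identity up to sign, and the sign acts trivially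
on the plane. So the family depends only on `σ`. To move `σ`, the coordinate `z` is multiplied by a
square root of a function of the ratio `s = z² / (x² + y²)`; this realizes isotopies of the line of
the parameters `s` that fix `0` and `∞` and commute with conjugation (`IsStretch.normalFamily_eq`).
Radial stretches and horizontal shears of this line suffice to bring `σ` to `(-1, -2, -3)` or to
`(-1, 2i, -2i)`.

The two families are different: outside of two conjugate points, three real conics form three
disjoint closed parts invariant under conjugation, and this property (`SplitsIntoRealParts`) is
carried along by equivariant homeomorphisms. Conics without finitely many points are connected, and
two conjugate ones have to lie in the same invariant part, so that the other normal form does not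
have this property (`not_splitsIntoRealParts_nf`).
-/


open EmptySextics

namespace EmptySextics

/-! ### Weighted filtrations of the ring of power series -/

/-- The ideal of the power series all of whose monomials `x ^ i * y ^ j` have weight
`p * i + q * j` at least `k`. -/
def Fil (p q k : ℕ) : Ideal Germ where
  carrier := {f | ∀ d : Fin 2 →₀ ℕ, p * d 0 + q * d 1 < k → MvPowerSeries.coeff d f = 0}
  add_mem' hf hg d hd := by simp [hf d hd, hg d hd]
  zero_mem' d _ := by simp
  smul_mem' c f hf d hd := by
    classical
    rw [smul_eq_mul, MvPowerSeries.coeff_mul]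
    refine Finset.sum_eq_zero fun e he => ?_
    rw [Finset.HasAntidiagonal.mem_antidiagonal] at he
    rw [hf e.2, mul_zero]
    subst he
    simp only [Finsupp.add_apply, mul_add] at hd
    omega

variable {p q : ℕ}

theorem Fil_anti {k l : ℕ} (h : k ≤ l) : Fil p q l ≤ Fil p q k :=
  fun _ hf d hd => hf d (hd.trans_le h)

theorem mem_Fil_zero (f : Germ) : f ∈ Fil p q 0 := fun d hd => absurd hd (by omega)

theorem mul_mem_Fil {k l : ℕ} {f g : Germ} (hf : f ∈ Fil p q k) (hg : g ∈ Fil p q l) :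
    f * g ∈ Fil p q (k + l) := by
  classical
  intro d hd
  rw [MvPowerSeries.coeff_mul]
  refine Finset.sum_eq_zero fun e he => ?_
  rw [Finset.HasAntidiagonal.mem_antidiagonal] at he
  subst he
  simp only [Finsupp.add_apply, mul_add] at hd
  by_cases h : p * e.1 0 + q * e.1 1 < k
  · rw [hf _ h, zero_mul]
  · rw [hg e.2 (by omega), mul_zero]

theorem pow_mem_Fil {k : ℕ} {f : Germ} (hf : f ∈ Fil p q k) (n : ℕ) :
    f ^ n ∈ Fil p q (n * k) := by
  induction n with
  | zero => simpa using mem_Fil_zero _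
  | succ n ih =>
    rw [pow_succ, Nat.succ_mul]
    exact mul_mem_Fil ih hf

theorem smul_mem_Fil {k : ℕ} {f : Germ} (hf : f ∈ Fil p q k) (c : ℂ) : c • f ∈ Fil p q k :=
  fun d hd => by simp [hf d hd]

theorem X0_mem_Fil : gx ∈ Fil p q p := by
  classical
  intro d hd
  rw [MvPowerSeries.coeff_X, if_neg]
  rintro rfl
  simp at hd

theorem X1_mem_Fil : gy ∈ Fil p q q := by
  classical
  intro d hd
  rw [MvPowerSeries.coeff_X, if_neg]
  rintro rfl
  simp at hd

theorem constantCoeff_eq_zero_of_mem_Fil {k : ℕ} (hk : 0 < k) {f : Germ} (hf : f ∈ Fil p q k) :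
    MvPowerSeries.constantCoeff f = 0 := by
  rw [← MvPowerSeries.coeff_zero_eq_constantCoeff_apply]
  exact hf 0 (by simpa using hk)

theorem eq_zero_of_forall_mem_Fil {f : Germ} (h : ∀ k, f ∈ Fil p q k) : f = 0 := by
  ext d
  simpa using h (p * d 0 + q * d 1 + 1) d (by omega)

/-- A monomial, as a product of powers of the coordinates. -/
theorem monomial_eq_gx_gy (d : Fin 2 →₀ ℕ) (c : ℂ) :
    (MvPowerSeries.monomial d c : Germ) = c • (gx ^ d 0 * gy ^ d 1) := by
  classical
  rw [MvPowerSeries.X_pow_eq, MvPowerSeries.X_pow_eq, MvPowerSeries.monomial_mul_monomial,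
    ← map_smul]
  have : d = Finsupp.single 0 (d 0) + Finsupp.single 1 (d 1) := by
    ext i
    fin_cases i <;> simp
  rw [← this]
  simp

/-- The exponents of weight less than `N` are finite in number if both weights are positive. -/
theorem finite_weight_lt (hp : 0 < p) (hq : 0 < q) (N : ℕ) :
    {d : Fin 2 →₀ ℕ | p * d 0 + q * d 1 < N}.Finite := by
  classical
  refine Set.Finite.subset
    (((Set.finite_lt_nat N).prod (Set.finite_lt_nat N)).image
      fun z : ℕ × ℕ => Finsupp.single 0 z.1 + Finsupp.single 1 z.2) ?_
  intro d hd
  refine ⟨(d 0, d 1), ⟨?_, ?_⟩, ?_⟩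
  · change d 0 < N
    exact lt_of_le_of_lt (Nat.le_mul_of_pos_left _ hp) (lt_of_le_of_lt (Nat.le_add_right _ _) hd)
  · change d 1 < N
    exact lt_of_le_of_lt (Nat.le_mul_of_pos_left _ hq) (lt_of_le_of_lt (Nat.le_add_left _ _) hd)
  · ext i
    fin_cases i <;> simp

/-- A linear operator that raises the weight of every monomial by `j`, and is continuous for the
filtration, raises the filtration by `j`. -/
theorem map_mem_Fil_of_monomial (hp : 0 < p) (hq : 0 < q) (T : Germ →ₗ[ℂ] Germ) (j s : ℕ)
    (hmono : ∀ a b : ℕ, T (gx ^ a * gy ^ b) ∈ Fil p q (p * a + q * b + j))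
    (hcont : ∀ N, ∀ f ∈ Fil p q (N + s), T f ∈ Fil p q N) {k : ℕ} {f : Germ}
    (hf : f ∈ Fil p q k) : T f ∈ Fil p q (k + j) := by
  classical
  have hfin := finite_weight_lt hp hq (k + j + s)
  set P : Germ := ∑ d ∈ hfin.toFinset, MvPowerSeries.monomial d (MvPowerSeries.coeff d f) with hP
  have hP' : f - P ∈ Fil p q (k + j + s) := by
    intro d hd
    rw [map_sub, hP, map_sum, Finset.sum_eq_single d]
    · simp
    · intro b _ hb
      rw [MvPowerSeries.coeff_monomial, if_neg hb.symm]
    · intro h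
      exact absurd (hfin.mem_toFinset.2 hd) h
  have : T f = T P + T (f - P) := by rw [← map_add]; congr 1; ring
  rw [this]
  refine Ideal.add_mem _ ?_ (hcont _ _ hP')
  rw [hP, map_sum]
  refine Ideal.sum_mem _ fun d _ => ?_
  by_cases hd : p * d 0 + q * d 1 < k
  · rw [hf d hd]; simp
  · rw [monomial_eq_gx_gy, map_smul]
    exact smul_mem_Fil (Fil_anti (by omega) (hmono _ _)) _

/-! ### Changes of coordinates -/

theorem hasSubst2 {a b : Germ} (ha : MvPowerSeries.constantCoeff a = 0)
    (hb : MvPowerSeries.constantCoeff b = 0) :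
    MvPowerSeries.HasSubst (![a, b] : Fin 2 → Germ) :=
  MvPowerSeries.hasSubst_of_constantCoeff_zero fun i => by fin_cases i <;> simpa

/-- The substitution `x ↦ a`, `y ↦ b`, as a homomorphism of algebras. -/
noncomputable def subHom (a b : Germ) (ha : MvPowerSeries.constantCoeff a = 0)
    (hb : MvPowerSeries.constantCoeff b = 0) : Germ →ₐ[ℂ] Germ :=
  MvPowerSeries.substAlgHom (hasSubst2 ha hb)

section

variable {a b : Germ} (ha : MvPowerSeries.constantCoeff a = 0)
  (hb : MvPowerSeries.constantCoeff b = 0)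

theorem subHom_gx : subHom a b ha hb gx = a := by
  rw [subHom, MvPowerSeries.substAlgHom_X]; rfl

theorem subHom_gy : subHom a b ha hb gy = b := by
  rw [subHom, MvPowerSeries.substAlgHom_X]; rfl

theorem subHom_mem_Fil (hap : a ∈ Fil p q p) (hbq : b ∈ Fil p q q) {k : ℕ} {f : Germ}
    (hf : f ∈ Fil p q k) : subHom a b ha hb f ∈ Fil p q k := by
  intro d hd
  rw [subHom, MvPowerSeries.substAlgHom_apply, MvPowerSeries.coeff_subst (hasSubst2 ha hb)]
  refine finsum_eq_zero_of_forall_eq_zero fun e => ?_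
  by_cases he : p * e 0 + q * e 1 < k
  · rw [hf e he, zero_smul]
  · have h1 : a ^ e 0 * b ^ e 1 ∈ Fil p q (e 0 * p + e 1 * q) :=
      mul_mem_Fil (pow_mem_Fil hap _) (pow_mem_Fil hbq _)
    have h2 : (e.prod fun i n => (![a, b] : Fin 2 → Germ) i ^ n) = a ^ e 0 * b ^ e 1 := by
      rw [Finsupp.prod_fintype _ _ (by simp)]
      simp
    rw [h2, h1 d (by rw [mul_comm (e 0), mul_comm (e 1)]; omega), smul_zero]

end

/-- The ring of power series is complete for the filtration. -/
theorem exists_limit {g : ℕ → Germ} (hg : ∀ n, g (n + 1) - g n ∈ Fil p q n) :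
    ∃ s, ∀ n, s - g n ∈ Fil p q n := by
  let w : (Fin 2 →₀ ℕ) → ℕ := fun d => p * d 0 + q * d 1
  have hstab : ∀ n m d, w d < n → n ≤ m →
      MvPowerSeries.coeff d (g m) = MvPowerSeries.coeff d (g n) := by
    intro n m d hd hnm
    induction m, hnm using Nat.le_induction with
    | base => rfl
    | succ m hm ih =>
      have := hg m d (lt_of_lt_of_le hd hm)
      rw [map_sub, sub_eq_zero] at this
      rw [this, ih]
  let s : Germ := fun d => MvPowerSeries.coeff d (g (w d + 1))
  refine ⟨s, fun n d hd => ?_⟩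
  rw [map_sub]
  change MvPowerSeries.coeff d (g (w d + 1)) - _ = 0
  rw [hstab (w d + 1) n d (Nat.lt_succ_self _) hd, sub_self]

/-- A linear operator which is the identity up to terms of higher weight is bijective. -/
theorem bijective_of_sub_mem_Fil (T : Germ →ₗ[ℂ] Germ)
    (hT : ∀ k, ∀ f ∈ Fil p q k, T f - f ∈ Fil p q (k + 1)) : Function.Bijective T := by
  constructor
  · rw [injective_iff_map_eq_zero]
    intro f hf
    refine eq_zero_of_forall_mem_Fil (p := p) (q := q) fun k => ?_
    induction k with
    | zero => exact mem_Fil_zero f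
    | succ k ih =>
      have := hT k f ih
      rw [hf, zero_sub] at this
      simpa using this
  · intro f
    -- `g n` approximates a preimage of `f` up to terms of weight `n`
    let g : ℕ → Germ := fun n => Nat.rec 0 (fun _ h => h + (f - T h)) n
    have hg : ∀ n, g (n + 1) = g n + (f - T (g n)) := fun n => rfl
    have happrox : ∀ n, f - T (g n) ∈ Fil p q n := by
      intro n
      induction n with
      | zero => exact mem_Fil_zero _
      | succ n ih =>
        have := hT n _ ih
        rw [hg, map_add]
        rw [← neg_mem_iff] at this
        convert this using 1
        ring
    obtain ⟨s, hs⟩ := exists_limit (p := p) (q := q) (g := g) fun n => by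
      rw [hg, add_sub_cancel_left]
      exact happrox n
    have hTF : ∀ n, ∀ h ∈ Fil p q n, T h ∈ Fil p q n := by
      intro n h hh
      have := Ideal.add_mem _ (Fil_anti (Nat.le_succ n) (hT n h hh)) hh
      simpa using this
    refine ⟨s, ?_⟩
    rw [← sub_eq_zero]
    refine eq_zero_of_forall_mem_Fil (p := p) (q := q) fun n => ?_
    have h1 := hTF n _ (hs n)
    have h2 := Ideal.sub_mem _ h1 (happrox n)
    rw [map_sub] at h2
    convert h2 using 1
    ring

/-- Powers of series that agree up to terms of higher weight. -/
theorem pow_sub_pow_mem_Fil {k e : ℕ} {a a' : Germ} (ha : a ∈ Fil p q k)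
    (h : a' - a ∈ Fil p q (k + e)) (n : ℕ) : a' ^ n - a ^ n ∈ Fil p q (k * n + e) := by
  induction n with
  | zero => simp
  | succ n ih =>
    have ha' : a' ∈ Fil p q k := by
      have := Ideal.add_mem _ (Fil_anti (Nat.le_add_right k e) h) ha
      simpa using this
    have h1 := mul_mem_Fil ih ha'
    have h2 := mul_mem_Fil (pow_mem_Fil ha n) h
    have h3 := Ideal.add_mem _ (Fil_anti (l := k * n + e + k) (k := k * (n + 1) + e)
      (by rw [Nat.mul_succ]; omega) h1)
      (Fil_anti (k := k * (n + 1) + e) (by rw [Nat.mul_succ, mul_comm n k]; omega) h2)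
    convert h3 using 1
    ring

theorem mul_sub_mul_mem_Fil {k l e : ℕ} {a a' b b' : Germ} (ha : a ∈ Fil p q k)
    (h : a' - a ∈ Fil p q (k + e)) (hb : b ∈ Fil p q l) (h' : b' - b ∈ Fil p q (l + e)) :
    a' * b' - a * b ∈ Fil p q (k + l + e) := by
  have hb' : b' ∈ Fil p q l := by
    have := Ideal.add_mem _ (Fil_anti (Nat.le_add_right l e) h') hb
    simpa using this
  have h3 := Ideal.add_mem _ (Fil_anti (k := k + l + e) (by omega) (mul_mem_Fil h hb'))
    (Fil_anti (k := k + l + e) (by omega) (mul_mem_Fil ha h'))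
  convert h3 using 1
  ring

theorem monomial_sub_mem_Fil {e : ℕ} {a a' b b' : Germ} (ha : a ∈ Fil p q p)
    (h : a' - a ∈ Fil p q (p + e)) (hb : b ∈ Fil p q q) (h' : b' - b ∈ Fil p q (q + e))
    (i j : ℕ) : a' ^ i * b' ^ j - a ^ i * b ^ j ∈ Fil p q (p * i + q * j + e) :=
  mul_sub_mul_mem_Fil (Fil_anti (by rw [mul_comm]) (pow_mem_Fil ha i)) (pow_sub_pow_mem_Fil ha h i)
    (Fil_anti (by rw [mul_comm]) (pow_mem_Fil hb j)) (pow_sub_pow_mem_Fil hb h' j)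

/-- Substitutions that agree up to terms of higher weight. -/
theorem subHom_sub_subHom_mem_Fil (hp : 0 < p) (hq : 0 < q) {e : ℕ} {a a' b b' : Germ}
    (ha : a ∈ Fil p q p) (h : a' - a ∈ Fil p q (p + e)) (hb : b ∈ Fil p q q)
    (h' : b' - b ∈ Fil p q (q + e)) (ha0 : MvPowerSeries.constantCoeff a = 0)
    (hb0 : MvPowerSeries.constantCoeff b = 0) (ha0' : MvPowerSeries.constantCoeff a' = 0)
    (hb0' : MvPowerSeries.constantCoeff b' = 0) {k : ℕ} {f : Germ} (hf : f ∈ Fil p q k) :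
    subHom a' b' ha0' hb0' f - subHom a b ha0 hb0 f ∈ Fil p q (k + e) := by
  have ha' : a' ∈ Fil p q p := by
    simpa using Ideal.add_mem _ (Fil_anti (Nat.le_add_right p e) h) ha
  have hb' : b' ∈ Fil p q q := by
    simpa using Ideal.add_mem _ (Fil_anti (Nat.le_add_right q e) h') hb
  refine map_mem_Fil_of_monomial hp hq
    ((subHom a' b' ha0' hb0').toLinearMap - (subHom a b ha0 hb0).toLinearMap) e 0 ?_ ?_ hf
  · intro i j
    simp only [LinearMap.sub_apply, AlgHom.toLinearMap_apply, map_mul, map_pow, subHom_gx,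
      subHom_gy]
    exact monomial_sub_mem_Fil ha h hb h' i j
  · intro N f hf
    exact Ideal.sub_mem _ (subHom_mem_Fil ha0' hb0' ha' hb' hf) (subHom_mem_Fil ha0 hb0 ha hb hf)

/-- A substitution that is the identity up to terms of higher weight is an automorphism. -/
theorem exists_algEquiv_of_sub_mem_Fil (hp : 0 < p) (hq : 0 < q) {a b : Germ}
    (ha : a - gx ∈ Fil p q (p + 1)) (hb : b - gy ∈ Fil p q (q + 1))
    (ha0 : MvPowerSeries.constantCoeff a = 0) (hb0 : MvPowerSeries.constantCoeff b = 0) :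
    ∃ φ : Germ ≃ₐ[ℂ] Germ, ∀ f, φ f = subHom a b ha0 hb0 f := by
  have hid : ∀ f, subHom gx gy (by simp) (by simp) f = f := by
    intro f
    rw [subHom, MvPowerSeries.substAlgHom_apply]
    have : (![gx, gy] : Fin 2 → Germ) = MvPowerSeries.X := by
      ext i : 1; fin_cases i <;> rfl
    rw [this, MvPowerSeries.subst_self, id]
  have hbij : Function.Bijective (subHom a b ha0 hb0) := by
    refine bijective_of_sub_mem_Fil (p := p) (q := q) (subHom a b ha0 hb0).toLinearMap ?_
    intro k f hf
    have := subHom_sub_subHom_mem_Fil hp hq X0_mem_Fil ha X1_mem_Fil hb (by simp) (by simp)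
      ha0 hb0 hf
    rwa [hid] at this
  exact ⟨AlgEquiv.ofBijective _ hbij, fun f => rfl⟩

variable {p q : ℕ}

/-! ### Normal forms by successive approximation -/

/-- The product rule for the linear approximation of an increment, up to terms of higher weight.
Here `u₀`, `u`, `u'` are the values of a quasi-homogeneous function of weight `k` at the standard
coordinates, at nearby ones, and at a perturbation of order `e` of the latter; `δ` is the
differential at the standard coordinates. -/
theorem increment_mul {k l e : ℕ} (he : 1 ≤ e) {u₀ u u' δ v₀ v v' η : Germ}
    (hu₀ : u₀ ∈ Fil p q k) (hu : u - u₀ ∈ Fil p q (k + 1)) (hδ : δ ∈ Fil p q (k + e))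
    (hu' : u' - u - δ ∈ Fil p q (k + e + 1))
    (hv₀ : v₀ ∈ Fil p q l) (hv : v - v₀ ∈ Fil p q (l + 1)) (hη : η ∈ Fil p q (l + e))
    (hv' : v' - v - η ∈ Fil p q (l + e + 1)) :
    u' * v' - u * v - (u₀ * η + v₀ * δ) ∈ Fil p q (k + l + e + 1) := by
  have hu1 : u ∈ Fil p q k := by
    simpa using Ideal.add_mem _ (Fil_anti (Nat.le_succ k) hu) hu₀
  have hv1 : v ∈ Fil p q l := by
    simpa using Ideal.add_mem _ (Fil_anti (Nat.le_succ l) hv) hv₀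
  have h1 : (u - u₀) * η ∈ Fil p q (k + l + e + 1) :=
    Fil_anti (by omega) (mul_mem_Fil hu hη)
  have h2 : δ * (v - v₀) ∈ Fil p q (k + l + e + 1) :=
    Fil_anti (by omega) (mul_mem_Fil hδ hv)
  have h3 : δ * η ∈ Fil p q (k + l + e + 1) :=
    Fil_anti (by omega) (mul_mem_Fil hδ hη)
  have hv2 : v' ∈ Fil p q l := by
    have h := Ideal.add_mem _ (Ideal.add_mem _ (Fil_anti (by omega) hv')
      (Fil_anti (Nat.le_add_right l e) hη)) hv1
    convert h using 1
    ring
  have h4 : (u' - u - δ) * v' ∈ Fil p q (k + l + e + 1) :=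
    Fil_anti (by omega) (mul_mem_Fil hu' hv2)
  have h5 : (u + δ) * (v' - v - η) ∈ Fil p q (k + l + e + 1) :=
    Fil_anti (by omega) (mul_mem_Fil
      (Ideal.add_mem _ hu1 (Fil_anti (Nat.le_add_right k e) hδ)) hv')
  have := Ideal.add_mem _ (Ideal.add_mem _ (Ideal.add_mem _ (Ideal.add_mem _ h1 h2) h3) h4) h5
  convert this using 1
  ring

theorem increment_pow {k e : ℕ} (he : 1 ≤ e) {x a α : Germ}
    (hx : x ∈ Fil p q k) (ha : a - x ∈ Fil p q (k + 1)) (hα : α ∈ Fil p q (k + e)) (n : ℕ) :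
    (a + α) ^ n - a ^ n - (n : ℂ) • (x ^ (n - 1) * α) ∈ Fil p q (k * n + e + 1) := by
  induction n with
  | zero => simp
  | succ n ih =>
    have hn : (n : ℂ) • (x ^ (n - 1) * α) ∈ Fil p q (k * n + e) := by
      rcases n with _ | n
      · simp
      · refine smul_mem_Fil (Fil_anti ?_ (mul_mem_Fil (pow_mem_Fil hx n) hα)) _
        rw [Nat.mul_succ, mul_comm n k]
        omega
    have h := increment_mul he (Fil_anti (k := k * n) (by rw [mul_comm]) (pow_mem_Fil hx n))
      (pow_sub_pow_mem_Fil hx ha n) hn ih hx ha hα (v' := a + α) (by simp)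
    have e1 : x ^ n * α + x * ((n : ℂ) • (x ^ (n - 1) * α))
        = ((n + 1 : ℕ) : ℂ) • (x ^ (n + 1 - 1) * α) := by
      rcases n with _ | n
      · simp
      · simp only [Nat.add_sub_cancel, mul_smul_comm, ← mul_assoc, ← pow_succ']
        push_cast
        simp only [add_smul, one_smul]
        ring
    rw [e1, ← pow_succ, ← pow_succ] at h
    rwa [Nat.mul_succ]

theorem increment_monomial {e : ℕ} (he : 1 ≤ e) {a b α β : Germ}
    (ha : a - gx ∈ Fil p q (p + 1)) (hb : b - gy ∈ Fil p q (q + 1))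
    (hα : α ∈ Fil p q (p + e)) (hβ : β ∈ Fil p q (q + e)) (i j : ℕ) :
    (a + α) ^ i * (b + β) ^ j - a ^ i * b ^ j
      - (α * ((i : ℂ) • (gx ^ (i - 1) * gy ^ j)) + β * ((j : ℂ) • (gx ^ i * gy ^ (j - 1))))
      ∈ Fil p q (p * i + q * j + e + 1) := by
  have hpow : ∀ {k : ℕ} {x α : Germ}, x ∈ Fil p q k → α ∈ Fil p q (k + e) → ∀ n : ℕ,
      (n : ℂ) • (x ^ (n - 1) * α) ∈ Fil p q (k * n + e) := by
    intro k x α hx hα n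
    rcases n with _ | n
    · simp
    · refine smul_mem_Fil (Fil_anti ?_ (mul_mem_Fil (pow_mem_Fil hx n) hα)) _
      rw [Nat.mul_succ, mul_comm n k]
      omega
  have h := increment_mul he (Fil_anti (k := p * i) (by rw [mul_comm]) (pow_mem_Fil X0_mem_Fil i))
    (pow_sub_pow_mem_Fil X0_mem_Fil ha i) (hpow X0_mem_Fil hα i)
    (increment_pow he X0_mem_Fil ha hα i)
    (Fil_anti (k := q * j) (by rw [mul_comm]) (pow_mem_Fil X1_mem_Fil j))
    (pow_sub_pow_mem_Fil X1_mem_Fil hb j) (hpow X1_mem_Fil hβ j)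
    (increment_pow he X1_mem_Fil hb hβ j)
  convert h using 2
  simp only [mul_smul_comm]
  rw [add_comm]
  congr 2 <;> ring

/-- A sequence built step by step, each term being related to the previous one. -/
theorem exists_seq_of_step {α : Type*} (P : ℕ → α → Prop) (Rel : ℕ → α → α → Prop)
    (h₀ : ∃ a, P 0 a) (hs : ∀ n a, P n a → ∃ b, P (n + 1) b ∧ Rel n a b) :
    ∃ s : ℕ → α, (∀ n, P n (s n)) ∧ ∀ n, Rel n (s n) (s (n + 1)) := by
  obtain ⟨a₀, h₀⟩ := h₀
  choose! next hP hR using hs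
  let s : ℕ → α := fun n => Nat.rec a₀ next n
  have hs : ∀ n, P n (s n) := by
    intro n
    induction n with
    | zero => exact h₀
    | succ n ih => exact hP n _ ih
  exact ⟨s, hs, fun n => hR n _ (hs n)⟩

/-- The binomial `c₁ x ^ i₁ y ^ j₁ + c₂ x ^ i₂ y ^ j₂`. -/
noncomputable def binom (c₁ c₂ : ℂ) (i₁ j₁ i₂ j₂ : ℕ) (a b : Germ) : Germ :=
  c₁ • (a ^ i₁ * b ^ j₁) + c₂ • (a ^ i₂ * b ^ j₂)

/-- Its derivative with respect to `x`. -/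
noncomputable def binomX (c₁ c₂ : ℂ) (i₁ j₁ i₂ j₂ : ℕ) : Germ :=
  (c₁ * i₁) • (gx ^ (i₁ - 1) * gy ^ j₁) + (c₂ * i₂) • (gx ^ (i₂ - 1) * gy ^ j₂)

/-- Its derivative with respect to `y`. -/
noncomputable def binomY (c₁ c₂ : ℂ) (i₁ j₁ i₂ j₂ : ℕ) : Germ :=
  (c₁ * j₁) • (gx ^ i₁ * gy ^ (j₁ - 1)) + (c₂ * j₂) • (gx ^ i₂ * gy ^ (j₂ - 1))

/-- The increment of a quasi-homogeneous binomial, up to terms of higher weight, is given by its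
partial derivatives at the standard coordinates. -/
theorem increment_binom {c₁ c₂ : ℂ} {i₁ j₁ i₂ j₂ d : ℕ} (h₁ : p * i₁ + q * j₁ = d)
    (h₂ : p * i₂ + q * j₂ = d) {e : ℕ} (he : 1 ≤ e) {a b α β : Germ}
    (ha : a - gx ∈ Fil p q (p + 1)) (hb : b - gy ∈ Fil p q (q + 1))
    (hα : α ∈ Fil p q (p + e)) (hβ : β ∈ Fil p q (q + e)) :
    binom c₁ c₂ i₁ j₁ i₂ j₂ (a + α) (b + β) - binom c₁ c₂ i₁ j₁ i₂ j₂ a b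
      - (α * binomX c₁ c₂ i₁ j₁ i₂ j₂ + β * binomY c₁ c₂ i₁ j₁ i₂ j₂) ∈ Fil p q (d + e + 1) := by
  have k1 := smul_mem_Fil (increment_monomial he ha hb hα hβ i₁ j₁) c₁
  have k2 := smul_mem_Fil (increment_monomial he ha hb hα hβ i₂ j₂) c₂
  rw [h₁] at k1
  rw [h₂] at k2
  convert Ideal.add_mem _ k1 k2 using 1
  simp only [binom, binomX, binomY, smul_sub, smul_add, mul_add, mul_smul_comm, mul_smul]
  abel

/-- **Quasi-homogeneous normal forms.**  Let `f₀` be a quasi-homogeneous binomial of weight `d`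
such that, in each weight beyond `d`, every series is a combination of the partial derivatives of
`f₀`, up to a remainder with exponents in `S`.  Then every series with principal part `f₀` can be
brought, by a change of coordinates, to the form `f₀ + ρ` with a remainder `ρ` with exponents
in `S`. -/
theorem exists_normal_form (hp : 0 < p) (hq : 0 < q) {c₁ c₂ : ℂ} {i₁ j₁ i₂ j₂ d : ℕ}
    (h₁ : p * i₁ + q * j₁ = d) (h₂ : p * i₂ + q * j₂ = d) (S : Set (Fin 2 →₀ ℕ))
    (hdiv : ∀ e, 1 ≤ e → ∀ r ∈ Fil p q (d + e), ∃ α ∈ Fil p q (p + e), ∃ β ∈ Fil p q (q + e),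
      ∃ ρ ∈ Fil p q (d + e), (∀ m, m ∉ S → MvPowerSeries.coeff m ρ = 0) ∧
        r = α * binomX c₁ c₂ i₁ j₁ i₂ j₂ + β * binomY c₁ c₂ i₁ j₁ i₂ j₂ + ρ)
    {f : Germ} (hf : f - binom c₁ c₂ i₁ j₁ i₂ j₂ gx gy ∈ Fil p q (d + 1)) :
    ∃ φ : Germ ≃ₐ[ℂ] Germ, ∃ ρ ∈ Fil p q (d + 1),
      (∀ m, m ∉ S → MvPowerSeries.coeff m ρ = 0) ∧
      φ f = binom c₁ c₂ i₁ j₁ i₂ j₂ gx gy + ρ := by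
  set f₀ : Germ := binom c₁ c₂ i₁ j₁ i₂ j₂ gx gy with hf₀
  let T : Germ → Germ → Germ := fun a b => MvPowerSeries.subst ![a, b] f
  have hT : ∀ a b ha hb, T a b = subHom a b ha hb f := fun a b ha hb => by
    rw [subHom, MvPowerSeries.substAlgHom_apply]
  have hbin : ∀ a b ha hb, subHom a b ha hb f₀ = binom c₁ c₂ i₁ j₁ i₂ j₂ a b := by
    intro a b ha hb
    simp only [hf₀, binom, map_add, map_smul, map_mul, map_pow, subHom_gx, subHom_gy]
  have hconst : ∀ {k : ℕ} {x a : Germ}, MvPowerSeries.constantCoeff x = 0 →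
      a - x ∈ Fil p q (k + 1) → MvPowerSeries.constantCoeff a = 0 := by
    intro k x a hx ha
    have := constantCoeff_eq_zero_of_mem_Fil (Nat.succ_pos k) ha
    rwa [map_sub, hx, sub_zero] at this
  let P : ℕ → Germ × Germ × Germ → Prop := fun n s =>
    s.1 - gx ∈ Fil p q (p + 1) ∧ s.2.1 - gy ∈ Fil p q (q + 1) ∧ s.2.2 ∈ Fil p q (d + 1) ∧
      (∀ m, m ∉ S → MvPowerSeries.coeff m s.2.2 = 0) ∧
      f₀ + s.2.2 - T s.1 s.2.1 ∈ Fil p q (d + 1 + n)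
  let Rel : ℕ → Germ × Germ × Germ → Germ × Germ × Germ → Prop := fun n s t =>
    t.1 - s.1 ∈ Fil p q (p + 1 + n) ∧ t.2.1 - s.2.1 ∈ Fil p q (q + 1 + n) ∧
      t.2.2 - s.2.2 ∈ Fil p q (d + 1 + n)
  have h0 : ∃ s, P 0 s := by
    refine ⟨(gx, gy, 0), by simp, by simp, by simp, by simp, ?_⟩
    have : T gx gy = f := by
      have : (![gx, gy] : Fin 2 → Germ) = MvPowerSeries.X := by
        ext i : 1; fin_cases i <;> rfl
      simp only [T, this, MvPowerSeries.subst_self, id]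
    simp only [this, add_zero]
    rw [← neg_mem_iff]
    simpa using hf
  have hstep : ∀ n s, P n s → ∃ t, P (n + 1) t ∧ Rel n s t := by
    rintro n ⟨a, b, ρ⟩ ⟨ha, hb, hρ, hρS, hr⟩
    dsimp only at ha hb hρ hρS hr
    rw [add_assoc] at hr
    obtain ⟨α, hα, β, hβ, ρ', hρ', hρS', hr'⟩ := hdiv (1 + n) (by omega) _ hr
    have ha0 := hconst (by simp) ha
    have hb0 := hconst (by simp) hb
    have hα' : α ∈ Fil p q (p + 1) := Fil_anti (by omega) hα
    have hβ' : β ∈ Fil p q (q + 1) := Fil_anti (by omega) hβ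
    have ha1 : a + α - gx ∈ Fil p q (p + 1) := by
      convert Ideal.add_mem _ ha hα' using 1; ring
    have hb1 : b + β - gy ∈ Fil p q (q + 1) := by
      convert Ideal.add_mem _ hb hβ' using 1; ring
    have ha0' := hconst (by simp) ha1
    have hb0' := hconst (by simp) hb1
    have hap : a ∈ Fil p q p := by
      simpa using Ideal.add_mem _ (Fil_anti (Nat.le_succ p) ha) X0_mem_Fil
    have hbq : b ∈ Fil p q q := by
      simpa using Ideal.add_mem _ (Fil_anti (Nat.le_succ q) hb) X1_mem_Fil
    refine ⟨(a + α, b + β, ρ - ρ'), ⟨ha1, hb1, ?_, ?_, ?_⟩, ?_, ?_, ?_⟩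
    · exact Ideal.sub_mem _ hρ (Fil_anti (by omega) hρ')
    · intro m hm
      rw [map_sub, hρS m hm, hρS' m hm, sub_zero]
    · have k1 := increment_binom (c₁ := c₁) (c₂ := c₂) h₁ h₂ (show 1 ≤ 1 + n by omega) ha hb hα hβ
      have k2 := subHom_sub_subHom_mem_Fil hp hq hap (a' := a + α) (e := 1 + n)
        (by simpa using hα) hbq (b' := b + β) (by simpa using hβ) ha0 hb0 ha0' hb0' hf
      rw [map_sub, map_sub, hbin, hbin, ← hT, ← hT] at k2
      have k3 := Ideal.add_mem _ (Fil_anti (k := d + 1 + (n + 1)) (by omega) k1)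
        (Fil_anti (k := d + 1 + (n + 1)) (by omega) k2)
      rw [← neg_mem_iff]
      convert k3 using 1
      dsimp only
      rw [show T a b = f₀ + ρ - (f₀ + ρ - T a b) by ring, hr']
      ring
    · simpa [add_assoc] using hα
    · simpa [add_assoc] using hβ
    · simpa [add_assoc] using hρ'
  obtain ⟨s, hs, hrel⟩ := exists_seq_of_step P Rel h0 hstep
  have hlim : ∀ (g : ℕ → Germ) (k : ℕ), (∀ n, g (n + 1) - g n ∈ Fil p q (k + n)) →
      ∃ t, ∀ n, t - g n ∈ Fil p q (k + n) := by
    intro g k hg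
    obtain ⟨t, ht⟩ := exists_limit (p := p) (q := q) (g := fun n => g (n - k)) fun n => by
      rcases le_or_gt k n with h | h
      · have := hg (n - k)
        rw [Nat.add_sub_cancel' h] at this
        rwa [Nat.succ_sub h]
      · simp [Nat.sub_eq_zero_of_le h.le, Nat.sub_eq_zero_of_le (Nat.succ_le_of_lt h)]
    refine ⟨t, fun n => ?_⟩
    simpa using ht (k + n)
  obtain ⟨a, ha⟩ := hlim (fun n => (s n).1) (p + 1) fun n => (hrel n).1
  obtain ⟨b, hb⟩ := hlim (fun n => (s n).2.1) (q + 1) fun n => (hrel n).2.1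
  obtain ⟨ρ, hρ⟩ := hlim (fun n => (s n).2.2) (d + 1) fun n => (hrel n).2.2
  have ha1 : a - gx ∈ Fil p q (p + 1) := by
    simpa using Ideal.add_mem _ (ha 0) (hs 0).1
  have hb1 : b - gy ∈ Fil p q (q + 1) := by
    simpa using Ideal.add_mem _ (hb 0) (hs 0).2.1
  have ha0 := hconst (by simp) ha1
  have hb0 := hconst (by simp) hb1
  obtain ⟨φ, hφ⟩ := exists_algEquiv_of_sub_mem_Fil hp hq ha1 hb1 ha0 hb0
  refine ⟨φ, ρ, ?_, ?_, ?_⟩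
  · simpa using Ideal.add_mem _ (hρ 0) (hs 0).2.2.1
  · intro m hm
    have := hρ (p * m 0 + q * m 1) m (by omega)
    rwa [map_sub, (hs _).2.2.2.1 m hm, sub_zero] at this
  · rw [hφ, ← sub_eq_zero]
    refine eq_zero_of_forall_mem_Fil (p := p) (q := q) fun n => ?_
    have hsa := hconst (by simp) (hs n).1
    have hsb := hconst (by simp) (hs n).2.1
    have hap : (s n).1 ∈ Fil p q p := by
      simpa using Ideal.add_mem _ (Fil_anti (Nat.le_succ p) (hs n).1) X0_mem_Fil
    have hbq : (s n).2.1 ∈ Fil p q q := by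
      simpa using Ideal.add_mem _ (Fil_anti (Nat.le_succ q) (hs n).2.1) X1_mem_Fil
    have k := subHom_sub_subHom_mem_Fil hp hq hap (a' := a) (e := n)
        (Fil_anti (by omega) (ha n)) hbq (b' := b) (Fil_anti (by omega) (hb n)) hsa hsb ha0 hb0
        (mem_Fil_zero f)
    have k' := (hs n).2.2.2.2
    rw [hT _ _ hsa hsb] at k'
    have := Ideal.sub_mem _ (Ideal.sub_mem _ (Fil_anti (k := n) (by omega) k)
      (Fil_anti (k := n) (by omega) k')) (Fil_anti (k := n) (by omega) (hρ n))
    convert this using 1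
    ring

variable {p q : ℕ}

/-! ### Semi-quasi-homogeneous simple germs -/

/-- Homomorphisms that respect the filtration by the order are determined by the images of the
coordinates. -/
theorem algHom_ext_of_mem_Fil (S T : Germ →ₐ[ℂ] Germ) (hS : ∀ N, ∀ f ∈ Fil 1 1 N, S f ∈ Fil 1 1 N)
    (hT : ∀ N, ∀ f ∈ Fil 1 1 N, T f ∈ Fil 1 1 N) (hx : S gx = T gx) (hy : S gy = T gy) :
    S = T := by
  ext1 f
  rw [← sub_eq_zero]
  refine eq_zero_of_forall_mem_Fil (p := 1) (q := 1) fun k => ?_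
  have := map_mem_Fil_of_monomial Nat.one_pos Nat.one_pos (S.toLinearMap - T.toLinearMap) k 0
    (fun a b => by simp [hx, hy])
    (fun N f hf => Ideal.sub_mem _ (hS N f hf) (hT N f hf)) (mem_Fil_zero f)
  simpa using this

/-- Linear changes of coordinates. -/
theorem exists_linear_algEquiv {α β γ δ : ℂ} (h : α * δ - β * γ ≠ 0) :
    ∃ ψ : Germ ≃ₐ[ℂ] Germ, ψ gx = α • gx + β • gy ∧ ψ gy = γ • gx + δ • gy ∧
      ∀ N, ∀ f ∈ Fil 1 1 N, ψ f ∈ Fil 1 1 N := by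
  have hc : ∀ s t : ℂ, MvPowerSeries.constantCoeff (s • gx + t • gy) = 0 := by intro s t; simp
  have hF : ∀ s t : ℂ, s • gx + t • gy ∈ Fil 1 1 1 := fun s t =>
    Ideal.add_mem _ (smul_mem_Fil X0_mem_Fil s) (smul_mem_Fil X1_mem_Fil t)
  let E := α * δ - β * γ
  let S := subHom (α • gx + β • gy) (γ • gx + δ • gy) (hc _ _) (hc _ _)
  let T := subHom ((δ / E) • gx + (-β / E) • gy) ((-γ / E) • gx + (α / E) • gy) (hc _ _) (hc _ _)
  have hS : ∀ N, ∀ f ∈ Fil 1 1 N, S f ∈ Fil 1 1 N := fun N f hf =>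
    subHom_mem_Fil _ _ (hF _ _) (hF _ _) hf
  have hT : ∀ N, ∀ f ∈ Fil 1 1 N, T f ∈ Fil 1 1 N := fun N f hf =>
    subHom_mem_Fil _ _ (hF _ _) (hF _ _) hf
  have hE : E ≠ 0 := h
  have hE' : α * δ - β * γ = E := rfl
  have h1 : S.comp T = AlgHom.id ℂ Germ := by
    refine algHom_ext_of_mem_Fil _ _ (fun N f hf => hS N _ (hT N f hf)) (fun N f hf => hf) ?_ ?_
    · simp only [AlgHom.comp_apply, S, T, subHom_gx, subHom_gy, map_add, map_smul, AlgHom.id_apply]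
      match_scalars
      · field_simp; linear_combination hE'
      · field_simp; ring
    · simp only [AlgHom.comp_apply, S, T, subHom_gx, subHom_gy, map_add, map_smul, AlgHom.id_apply]
      match_scalars
      · field_simp; ring
      · field_simp; linear_combination hE'
  have h2 : T.comp S = AlgHom.id ℂ Germ := by
    refine algHom_ext_of_mem_Fil _ _ (fun N f hf => hT N _ (hS N f hf)) (fun N f hf => hf) ?_ ?_
    · simp only [AlgHom.comp_apply, S, T, subHom_gx, subHom_gy, map_add, map_smul, AlgHom.id_apply]
      match_scalars
      · field_simp; linear_combination hE'
      · field_simp; ring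
    · simp only [AlgHom.comp_apply, S, T, subHom_gx, subHom_gy, map_add, map_smul, AlgHom.id_apply]
      match_scalars
      · field_simp; ring
      · field_simp; linear_combination hE'
  refine ⟨AlgEquiv.ofAlgHom S T h1 h2, ?_, ?_, hS⟩
  · exact subHom_gx (hc α β) (hc γ δ)
  · exact subHom_gy (hc α β) (hc γ δ)

/-- Scaling of the second coordinate. -/
theorem exists_scale_algEquiv {β : ℂ} (hβ : β ≠ 0) :
    ∃ ψ : Germ ≃ₐ[ℂ] Germ, ψ gx = gx ∧ ψ gy = β • gy ∧
      ∀ p q N, ∀ f ∈ Fil p q N, ψ f ∈ Fil p q N := by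
  have hc : ∀ b : ℂ, MvPowerSeries.constantCoeff (b • gy) = 0 := fun b => by simp
  have hx : MvPowerSeries.constantCoeff gx = (0 : ℂ) := by simp
  let S : ℂ → (Germ →ₐ[ℂ] Germ) := fun b => subHom gx (b • gy) hx (hc b)
  have hS : ∀ b p q N, ∀ f ∈ Fil p q N, S b f ∈ Fil p q N := fun b p q N f hf =>
    subHom_mem_Fil _ _ X0_mem_Fil (smul_mem_Fil X1_mem_Fil b) hf
  have hSx : ∀ b, S b gx = gx := fun b => subHom_gx _ _
  have hSy : ∀ b, S b gy = b • gy := fun b => subHom_gy _ _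
  have hcomp : ∀ a b, a * b = 1 → (S a).comp (S b) = AlgHom.id ℂ Germ := by
    intro a b hab
    refine algHom_ext_of_mem_Fil _ _ (fun N f hf => hS a 1 1 N _ (hS b 1 1 N f hf))
      (fun N f hf => hf) ?_ ?_
    · rw [AlgHom.comp_apply, hSx, hSx, AlgHom.id_apply]
    · rw [AlgHom.comp_apply, hSy, map_smul, hSy, smul_smul, mul_comm, hab, one_smul,
        AlgHom.id_apply]
  exact ⟨AlgEquiv.ofAlgHom (S β) (S β⁻¹) (hcomp _ _ (mul_inv_cancel₀ hβ))
    (hcomp _ _ (inv_mul_cancel₀ hβ)), hSx β, hSy β, hS β⟩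

/-- The germ is equivalent to one of the normal forms **A**, **D**, **E**. -/
def IsADE (f : Germ) : Prop := ∃ g ∈ adeNormalForms, ContactEquivalent f g

theorem ContactEquivalent.of_smul_map {f g : Germ} {c : ℂ} (hc : c ≠ 0) (φ : Germ ≃ₐ[ℂ] Germ)
    (h : ContactEquivalent (c • φ f) g) : ContactEquivalent f g := by
  obtain ⟨ψ, u, hu⟩ := h
  refine ⟨φ.trans ψ, Units.map (algebraMap ℂ Germ).toMonoidHom (Units.mk0 c⁻¹ (inv_ne_zero hc)) * u,
    ?_⟩
  rw [map_smul] at hu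
  rw [AlgEquiv.trans_apply, ← inv_smul_smul₀ hc (ψ (φ f)), hu, Algebra.smul_def, Units.val_mul,
    mul_assoc]
  rfl

theorem IsADE.of_smul_map {f : Germ} {c : ℂ} (hc : c ≠ 0) (φ : Germ ≃ₐ[ℂ] Germ)
    (h : IsADE (c • φ f)) : IsADE f := by
  obtain ⟨g, hg, h⟩ := h
  exact ⟨g, hg, h.of_smul_map hc φ⟩

theorem IsADE.of_map {f : Germ} (φ : Germ ≃ₐ[ℂ] Germ) (h : IsADE (φ f)) : IsADE f :=
  IsADE.of_smul_map one_ne_zero φ (by rwa [one_smul])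

theorem isADE_of_eq {f g : Germ} (φ : Germ ≃ₐ[ℂ] Germ) (hg : g ∈ adeNormalForms) (h : φ f = g) :
    IsADE f := ⟨g, hg, φ, 1, by rw [h]; simp⟩

/-- The coefficients of the principal part can be normalized by scaling one coordinate. -/
theorem exists_scaling {c₁ c₂ : ℂ} (h₁ : c₁ ≠ 0) (h₂ : c₂ ≠ 0) {i₁ j₁ i₂ j₂ k : ℕ} (hj : j₁ < j₂)
    {f : Germ} (hf : f - binom c₁ c₂ i₁ j₁ i₂ j₂ gx gy ∈ Fil p q k) :
    ∃ c : ℂ, c ≠ 0 ∧ ∃ ψ : Germ ≃ₐ[ℂ] Germ,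
      c • ψ f - binom 1 1 i₁ j₁ i₂ j₂ gx gy ∈ Fil p q k := by
  obtain ⟨β, hβ⟩ := IsAlgClosed.exists_pow_nat_eq (c₁ / c₂) (Nat.sub_pos_of_lt hj)
  have hβ0 : β ≠ 0 := by
    rintro rfl
    rw [zero_pow (Nat.sub_pos_of_lt hj).ne'] at hβ
    exact div_ne_zero h₁ h₂ hβ.symm
  obtain ⟨ψ, hψx, hψy, hψF⟩ := exists_scale_algEquiv hβ0
  have hc0 : c₁ * β ^ j₁ ≠ 0 := mul_ne_zero h₁ (pow_ne_zero _ hβ0)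
  refine ⟨(c₁ * β ^ j₁)⁻¹, inv_ne_zero hc0, ψ, ?_⟩
  have h := smul_mem_Fil (hψF p q k _ hf) (c₁ * β ^ j₁)⁻¹
  have e : c₂ * β ^ j₂ = c₁ * β ^ j₁ := by
    rw [← Nat.sub_add_cancel hj.le, pow_add, hβ]
    field_simp
  have : (c₁ * β ^ j₁)⁻¹ • ψ (binom c₁ c₂ i₁ j₁ i₂ j₂ gx gy)
      = binom 1 1 i₁ j₁ i₂ j₂ gx gy := by
    simp only [binom, map_add, map_smul, map_mul, map_pow, hψx, hψy, smul_pow,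
      mul_smul_comm, smul_smul, smul_add]
    rw [e, inv_mul_cancel₀ hc0]
  rwa [map_sub, smul_sub, this] at h

/-- A germ whose principal part is one of the normal forms, all terms beyond it being combinations
of the partial derivatives of the principal part, is equivalent to this normal form. -/
theorem isADE_of_principal_part {i₁ j₁ i₂ j₂ : ℕ} (d : ℕ) (hp : 0 < p) (hq : 0 < q)
    (h₁ : p * i₁ + q * j₁ = d) (h₂ : p * i₂ + q * j₂ = d)
    (hg : gx ^ i₁ * gy ^ j₁ + gx ^ i₂ * gy ^ j₂ ∈ adeNormalForms) {f : Germ}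
    (hf : f - binom 1 1 i₁ j₁ i₂ j₂ gx gy ∈ Fil p q (d + 1))
    (hdiv : ∀ e, 1 ≤ e → ∀ r ∈ Fil p q (d + e), ∃ α ∈ Fil p q (p + e), ∃ β ∈ Fil p q (q + e),
      r = α * binomX 1 1 i₁ j₁ i₂ j₂ + β * binomY 1 1 i₁ j₁ i₂ j₂) : IsADE f := by
  obtain ⟨φ, ρ, hρ, hρS, hφ⟩ := exists_normal_form hp hq h₁ h₂ ∅
    (fun e he r hr => by
      obtain ⟨α, hα, β, hβ, h⟩ := hdiv e he r hr
      exact ⟨α, hα, β, hβ, 0, by simp, by simp, by rw [h, add_zero]⟩) hf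
  obtain rfl : ρ = 0 := by ext m; simpa using hρS m (by simp)
  refine isADE_of_eq φ hg ?_
  rw [hφ]
  simp [binom]

/-- Splitting off the terms divisible by a monomial. -/
theorem exists_split_off (i j : ℕ) {k : ℕ} {r : Germ} (hr : r ∈ Fil p q k) :
    ∃ s ∈ Fil p q (k - (p * i + q * j)), ∃ r' ∈ Fil p q k,
      (∀ d : Fin 2 →₀ ℕ, MvPowerSeries.coeff d r = 0 ∨ (i ≤ d 0 ∧ j ≤ d 1) →
        MvPowerSeries.coeff d r' = 0) ∧ r = gx ^ i * gy ^ j * s + r' := by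
  classical
  let m : Fin 2 →₀ ℕ := Finsupp.single 0 i + Finsupp.single 1 j
  have hm0 : m 0 = i := by simp [m]
  have hm1 : m 1 = j := by simp [m]
  have hmle : ∀ d : Fin 2 →₀ ℕ, m ≤ d ↔ i ≤ d 0 ∧ j ≤ d 1 := by
    intro d
    rw [Finsupp.le_def, Fin.forall_fin_two, hm0, hm1]
  let s : Germ := fun d => MvPowerSeries.coeff (d + m) r
  have hs : ∀ d, MvPowerSeries.coeff d s = MvPowerSeries.coeff (d + m) r := fun d => rfl
  have hcoef : ∀ d, MvPowerSeries.coeff d (r - gx ^ i * gy ^ j * s)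
      = if m ≤ d then 0 else MvPowerSeries.coeff d r := by
    intro d
    have : gx ^ i * gy ^ j = (MvPowerSeries.monomial m 1 : Germ) := by
      rw [monomial_eq_gx_gy, hm0, hm1, one_smul]
    rw [this, map_sub, MvPowerSeries.coeff_monomial_mul]
    split_ifs with h
    · rw [hs, tsub_add_cancel_of_le h, one_mul, sub_self]
    · rw [sub_zero]
  refine ⟨s, ?_, r - gx ^ i * gy ^ j * s, ?_, ?_, by ring⟩
  · intro d hd
    rw [hs]
    refine hr _ ?_
    simp only [Finsupp.add_apply, hm0, hm1, mul_add]
    omega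
  · intro d hd
    rw [hcoef, hr d hd, ite_self]
  · intro d hd
    rw [hcoef]
    rcases hd with hd | hd
    · rw [hd, ite_self]
    · rw [if_pos ((hmle d).2 hd)]

theorem eq_zero_of_coeff {k : ℕ} {r : Germ} (hr : r ∈ Fil p q k)
    (h : ∀ d : Fin 2 →₀ ℕ, k ≤ p * d 0 + q * d 1 → MvPowerSeries.coeff d r = 0) : r = 0 := by
  ext d
  rcases lt_or_ge (p * d 0 + q * d 1) k with hd | hd
  · exact hr d hd
  · exact h d hd

/-- Germs with the principal part `c₁ x² + c₂ y ^ (n + 1)` are of type **A**. -/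
theorem isADE_A {n : ℕ} (hn : 1 ≤ n) {c₁ c₂ : ℂ} (h₁ : c₁ ≠ 0) (h₂ : c₂ ≠ 0) {f : Germ}
    (hf : f - binom c₁ c₂ 2 0 0 (n + 1) gx gy ∈ Fil (n + 1) 2 (2 * n + 3)) : IsADE f := by
  obtain ⟨c, hc, ψ, hψ⟩ := exists_scaling h₁ h₂ (by omega) hf
  refine IsADE.of_smul_map hc ψ ?_
  refine isADE_of_principal_part (2 * n + 2) (by omega) (by omega) (by ring) (by ring)
    ?_ hψ ?_
  · simpa using (show _ ∈ adeNormalForms from (Or.inl ⟨n, hn, rfl⟩))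
  · intro e he r hr
    obtain ⟨s, hs, r', hr', hr'0, e1⟩ := exists_split_off 1 0 hr
    obtain ⟨t, ht, r'', hr'', hr''0, e2⟩ := exists_split_off 0 n hr'
    obtain rfl : r'' = 0 := by
      refine eq_zero_of_coeff hr'' fun d hd => hr''0 d ?_
      by_cases h0 : 1 ≤ d 0
      · exact Or.inl (hr'0 d (Or.inr ⟨h0, by omega⟩))
      · obtain h0 : d 0 = 0 := by omega
        rw [h0] at hd
        exact Or.inr ⟨by omega, by omega⟩
    refine ⟨(2 : ℂ)⁻¹ • s, smul_mem_Fil (Fil_anti (by simp; omega) hs) _,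
      ((n : ℂ) + 1)⁻¹ • t, smul_mem_Fil (Fil_anti (by simp; omega) ht) _, ?_⟩
    have hn' : ((n : ℂ) + 1) ≠ 0 := by exact_mod_cast Nat.succ_ne_zero n
    rw [e1, e2]
    simp [binomX, binomY, smul_smul, hn']
    ring

/-- Germs with the principal part `c₁ x² y + c₂ y ^ (n + 3)` are of type **D**. -/
theorem isADE_D (n : ℕ) {c₁ c₂ : ℂ} (h₁ : c₁ ≠ 0) (h₂ : c₂ ≠ 0) {f : Germ}
    (hf : f - binom c₁ c₂ 2 1 0 (n + 3) gx gy ∈ Fil (n + 2) 2 (2 * n + 7)) : IsADE f := by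
  obtain ⟨c, hc, ψ, hψ⟩ := exists_scaling h₁ h₂ (by omega) hf
  refine IsADE.of_smul_map hc ψ ?_
  refine isADE_of_principal_part (2 * n + 6) (by omega) (by omega) (by ring) (by ring)
    ?_ hψ ?_
  · simpa using (show _ ∈ adeNormalForms from (Or.inr (Or.inl ⟨n + 4, by omega, rfl⟩)))
  · intro e he r hr
    obtain ⟨s, hs, r', hr', hr'0, e1⟩ := exists_split_off 1 1 hr
    obtain ⟨t, ht, r'', hr'', hr''0, e2⟩ := exists_split_off 3 0 hr'
    obtain ⟨v, hv, r₃, hr₃, hr₃0, e3⟩ := exists_split_off 0 (n + 3) hr''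
    obtain rfl : r₃ = 0 := by
      refine eq_zero_of_coeff hr₃ fun d hd => hr₃0 d ?_
      by_cases h1 : 1 ≤ d 0 ∧ 1 ≤ d 1
      · exact Or.inl (hr''0 d (Or.inl (hr'0 d (Or.inr h1))))
      by_cases h0 : 3 ≤ d 0
      · exact Or.inl (hr''0 d (Or.inr ⟨h0, by omega⟩))
      rcases Nat.eq_zero_or_pos (d 0) with h2 | h2
      · rw [h2] at hd
        exact Or.inr ⟨by omega, by omega⟩
      · exfalso
        have h3 : d 1 = 0 := by omega
        have h4 : (n + 2) * d 0 ≤ (n + 2) * 2 := Nat.mul_le_mul_left _ (by omega)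
        rw [h3] at hd
        omega
    have hn' : ((n : ℂ) + 3) ≠ 0 := by exact_mod_cast Nat.succ_ne_zero (n + 2)
    refine ⟨(2 : ℂ)⁻¹ • (s - ((n : ℂ) + 3) • (gy ^ (n + 1) * t) - ((n : ℂ) + 3)⁻¹ • (gx * v)),
      smul_mem_Fil (Ideal.sub_mem _ (Ideal.sub_mem _ (Fil_anti ?_ hs) (smul_mem_Fil
        (Fil_anti ?_ (mul_mem_Fil (pow_mem_Fil X1_mem_Fil (n + 1)) ht)) _))
        (smul_mem_Fil (Fil_anti ?_ (mul_mem_Fil X0_mem_Fil hv)) _)) _,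
      gx * t + ((n : ℂ) + 3)⁻¹ • (gy * v), Ideal.add_mem _
        (Fil_anti ?_ (mul_mem_Fil X0_mem_Fil ht))
        (smul_mem_Fil (Fil_anti ?_ (mul_mem_Fil X1_mem_Fil hv)) _), ?_⟩
    iterate 5 omega
    rw [e1, e2, e3]
    have hu : ((n : ℂ) + 3)⁻¹ * ((n : ℂ) + 3) = 1 := inv_mul_cancel₀ hn'
    generalize ((n : ℂ) + 3)⁻¹ = u at *
    simp only [binomX, binomY, pow_one, pow_zero, mul_one, one_mul, Nat.cast_ofNat,
      Nat.cast_add, Nat.cast_zero, Nat.cast_one, zero_smul, add_zero,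
      show n + 3 - 1 = n + 2 by omega, show 2 - 1 = 1 by rfl]
    generalize (n : ℂ) + 3 = w at *
    have hC : algebraMap ℂ Germ u * algebraMap ℂ Germ w = 1 := by rw [← map_mul, hu, map_one]
    have h2 : algebraMap ℂ Germ 2⁻¹ * algebraMap ℂ Germ 2 = 1 := by
      rw [← map_mul]; norm_num
    simp only [Algebra.smul_def, map_one]
    linear_combination (-(gy ^ (n + 3) * v)) * hC - (gx * gy * s - gx * gy ^ (n + 2) * t *
      algebraMap ℂ Germ w - gx ^ 2 * gy * v * algebraMap ℂ Germ u) * h2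

/-- Germs with the principal part `c₁ x³ + c₂ y⁴` are of type **E**₆. -/
theorem isADE_E6 {c₁ c₂ : ℂ} (h₁ : c₁ ≠ 0) (h₂ : c₂ ≠ 0) {f : Germ}
    (hf : f - binom c₁ c₂ 3 0 0 4 gx gy ∈ Fil 4 3 13) : IsADE f := by
  obtain ⟨c, hc, ψ, hψ⟩ := exists_scaling h₁ h₂ (by omega) hf
  refine IsADE.of_smul_map hc ψ ?_
  refine isADE_of_principal_part (12) (by omega) (by omega) (by ring) (by ring)
    ?_ hψ ?_
  · simpa using (show _ ∈ adeNormalForms from (Or.inr (Or.inr (Or.inl rfl))))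
  · intro e he r hr
    obtain ⟨s, hs, r', hr', hr'0, e1⟩ := exists_split_off 2 0 hr
    obtain ⟨t, ht, r'', hr'', hr''0, e2⟩ := exists_split_off 0 3 hr'
    obtain rfl : r'' = 0 := by
      refine eq_zero_of_coeff hr'' fun d hd => hr''0 d ?_
      by_cases h0 : 2 ≤ d 0
      · exact Or.inl (hr'0 d (Or.inr ⟨h0, by omega⟩))
      · exact Or.inr ⟨by omega, by omega⟩
    refine ⟨(3 : ℂ)⁻¹ • s, smul_mem_Fil (Fil_anti (by omega) hs) _,
      (4 : ℂ)⁻¹ • t, smul_mem_Fil (Fil_anti (by omega) ht) _, ?_⟩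
    rw [e1, e2]
    simp [binomX, binomY, smul_smul]
    ring

/-- Germs with the principal part `c₁ x³ + c₂ x y³` are of type **E**₇. -/
theorem isADE_E7 {c₁ c₂ : ℂ} (h₁ : c₁ ≠ 0) (h₂ : c₂ ≠ 0) {f : Germ}
    (hf : f - binom c₁ c₂ 3 0 1 3 gx gy ∈ Fil 3 2 10) : IsADE f := by
  obtain ⟨c, hc, ψ, hψ⟩ := exists_scaling h₁ h₂ (by omega) hf
  refine IsADE.of_smul_map hc ψ ?_
  refine isADE_of_principal_part (9) (by omega) (by omega) (by ring) (by ring)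
    ?_ hψ ?_
  · simpa using (show _ ∈ adeNormalForms from (Or.inr (Or.inr (Or.inr (Or.inl rfl)))))
  · intro e he r hr
    obtain ⟨s, hs, r', hr', hr'0, e1⟩ := exists_split_off 1 2 hr
    obtain ⟨t, ht, r'', hr'', hr''0, e2⟩ := exists_split_off 3 0 hr'
    obtain ⟨v, hv, r₃, hr₃, hr₃0, e3⟩ := exists_split_off 0 5 hr''
    obtain rfl : r₃ = 0 := by
      refine eq_zero_of_coeff hr₃ fun d hd => hr₃0 d ?_
      by_cases h1 : 1 ≤ d 0 ∧ 2 ≤ d 1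
      · exact Or.inl (hr''0 d (Or.inl (hr'0 d (Or.inr h1))))
      by_cases h0 : 3 ≤ d 0
      · exact Or.inl (hr''0 d (Or.inr ⟨h0, by omega⟩))
      exact Or.inr ⟨by omega, by omega⟩
    refine ⟨(3 : ℂ)⁻¹ • (gx * t) + gy ^ 2 * v, Ideal.add_mem _ (smul_mem_Fil
        (Fil_anti ?_ (mul_mem_Fil X0_mem_Fil ht)) _)
        (Fil_anti ?_ (mul_mem_Fil (pow_mem_Fil X1_mem_Fil 2) hv)),
      (3 : ℂ)⁻¹ • s - (9 : ℂ)⁻¹ • (gy * t) - gx * v, Ideal.sub_mem _ (Ideal.sub_mem _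
        (smul_mem_Fil (Fil_anti ?_ hs) _)
        (smul_mem_Fil (Fil_anti ?_ (mul_mem_Fil X1_mem_Fil ht)) _))
        (Fil_anti ?_ (mul_mem_Fil X0_mem_Fil hv)), ?_⟩
    iterate 5 omega
    rw [e1, e2, e3]
    simp [binomX, binomY]
    algebra

/-- Germs with the principal part `c₁ x³ + c₂ y⁵` are of type **E**₈. -/
theorem isADE_E8 {c₁ c₂ : ℂ} (h₁ : c₁ ≠ 0) (h₂ : c₂ ≠ 0) {f : Germ}
    (hf : f - binom c₁ c₂ 3 0 0 5 gx gy ∈ Fil 5 3 16) : IsADE f := by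
  obtain ⟨c, hc, ψ, hψ⟩ := exists_scaling h₁ h₂ (by omega) hf
  refine IsADE.of_smul_map hc ψ ?_
  refine isADE_of_principal_part (15) (by omega) (by omega) (by ring) (by ring)
    ?_ hψ ?_
  · simpa using (show _ ∈ adeNormalForms from (Or.inr (Or.inr (Or.inr (Or.inr rfl)))))
  · intro e he r hr
    obtain ⟨s, hs, r', hr', hr'0, e1⟩ := exists_split_off 2 0 hr
    obtain ⟨t, ht, r'', hr'', hr''0, e2⟩ := exists_split_off 0 4 hr'
    obtain rfl : r'' = 0 := by
      refine eq_zero_of_coeff hr'' fun d hd => hr''0 d ?_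
      by_cases h0 : 2 ≤ d 0
      · exact Or.inl (hr'0 d (Or.inr ⟨h0, by omega⟩))
      · exact Or.inr ⟨by omega, by omega⟩
    refine ⟨(3 : ℂ)⁻¹ • s, smul_mem_Fil (Fil_anti (by omega) hs) _,
      (5 : ℂ)⁻¹ • t, smul_mem_Fil (Fil_anti (by omega) ht) _, ?_⟩
    rw [e1, e2]
    simp [binomX, binomY, smul_smul]
    ring

variable {p q : ℕ}

/-! ### Recognition of simple germs by their jets -/

theorem coeff_gx_gy (i j : ℕ) (d : Fin 2 →₀ ℕ) :
    MvPowerSeries.coeff d (gx ^ i * gy ^ j : Germ) = if d 0 = i ∧ d 1 = j then 1 else 0 := by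
  classical
  have h0 : (Finsupp.single 0 i + Finsupp.single 1 j : Fin 2 →₀ ℕ) 0 = i := by simp
  have h1 : (Finsupp.single 0 i + Finsupp.single 1 j : Fin 2 →₀ ℕ) 1 = j := by simp
  have h := monomial_eq_gx_gy (Finsupp.single 0 i + Finsupp.single 1 j) 1
  rw [h0, h1, one_smul] at h
  rw [← h, MvPowerSeries.coeff_monomial]
  refine if_congr ?_ rfl rfl
  constructor
  · rintro rfl
    exact ⟨h0, h1⟩
  · rintro ⟨ha, hb⟩
    ext k
    fin_cases k
    · exact ha.trans h0.symm
    · exact hb.trans h1.symm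

/-- The exponent of `x ^ i * y ^ j`. -/
noncomputable def expo (i j : ℕ) : Fin 2 →₀ ℕ := Finsupp.single 0 i + Finsupp.single 1 j

@[simp] theorem expo_zero (i j : ℕ) : expo i j 0 = i := by simp [expo]

@[simp] theorem expo_one (i j : ℕ) : expo i j 1 = j := by simp [expo]

theorem eq_expo {d : Fin 2 →₀ ℕ} {i j : ℕ} (hi : d 0 = i) (hj : d 1 = j) : d = expo i j := by
  ext k
  fin_cases k
  · simpa using hi
  · simpa using hj

theorem squarefree_map {f : Germ} (φ : Germ ≃ₐ[ℂ] Germ) (hf : Squarefree f) :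
    Squarefree (φ f) := by
  intro g hg
  have h := map_dvd φ.symm hg
  rw [map_mul, AlgEquiv.symm_apply_apply] at h
  have := (hf _ h).map φ
  rwa [AlgEquiv.apply_symm_apply] at this

theorem not_isUnit_gx : ¬ IsUnit gx := by
  rw [MvPowerSeries.isUnit_iff_constantCoeff]
  simp

/-- A nonzero series in `y` alone has a lowest term. -/
theorem exists_lowest_term {N : ℕ} {ρ : Germ} (hρ : ρ ∈ Fil 1 1 N) (hρ0 : ρ ≠ 0)
    (hS : ∀ m, m ∉ {m : Fin 2 →₀ ℕ | m 0 = 0} → MvPowerSeries.coeff m ρ = 0) :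
    ∃ n, N ≤ n ∧ ∃ c : ℂ, c ≠ 0 ∧ ∀ m : Fin 2 →₀ ℕ, m 1 ≤ n →
      MvPowerSeries.coeff m (ρ - c • (gx ^ 0 * gy ^ n)) = 0 := by
  classical
  have hex : ∃ n, MvPowerSeries.coeff (expo 0 n) ρ ≠ 0 := by
    by_contra! h
    refine hρ0 ?_
    ext m
    by_cases hm : m 0 = 0
    · rw [eq_expo hm rfl, h]; simp
    · simpa using hS m hm
  refine ⟨Nat.find hex, ?_, _, Nat.find_spec hex, ?_⟩
  · by_contra h
    exact Nat.find_spec hex (hρ _ (by simpa using h))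
  · intro m hm
    rw [map_sub, map_smul, coeff_gx_gy]
    by_cases hm0 : m 0 = 0
    · rcases hm.lt_or_eq with h | h
      · have := Nat.find_min hex h
        rw [not_not, ← eq_expo hm0 rfl] at this
        simp [this, h.ne]
      · simp [hm0, h, ← eq_expo hm0 h]
    · rw [hS m hm0]
      simp [hm0]

/-- A reduced germ with the quadratic part `α x²` is brought to the form `α x² + ρ(y)`; here `ρ` is
not zero because the germ is reduced, and its lowest term gives the principal part. -/
theorem isADE_of_sq_add {α : ℂ} (hα : α ≠ 0) {f : Germ} (hsq : Squarefree f)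
    (hf : f - α • gx ^ 2 ∈ Fil 1 1 3) : IsADE f := by
  obtain ⟨φ, ρ, hρ, hρS, hφ⟩ := exists_normal_form (p := 1) (q := 1) (c₁ := α) (c₂ := 0)
    (i₁ := 2) (j₁ := 0) (i₂ := 2) (j₂ := 0) (d := 2) one_pos one_pos rfl rfl {m | m 0 = 0}
    (fun e he r hr => by
      obtain ⟨s, hs, r', hr', hr'0, e1⟩ := exists_split_off 1 0 hr
      refine ⟨(2 * α)⁻¹ • s, smul_mem_Fil (Fil_anti (by omega) hs) _, 0, by simp, r', hr',
        fun m hm => hr'0 m (Or.inr ⟨Nat.pos_of_ne_zero hm, by omega⟩), ?_⟩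
      rw [e1]
      simp [binomX, smul_smul]
      ring_nf
      rw [mul_inv_cancel₀ hα, one_smul]) (f := f) (by simpa [binom] using hf)
  refine IsADE.of_map φ ?_
  have hφ' : φ f = α • gx ^ 2 + ρ := by rw [hφ]; simp [binom]
  by_cases hρ0 : ρ = 0
  · exfalso
    rw [hρ0, add_zero] at hφ'
    refine not_isUnit_gx (squarefree_map φ hsq gx ⟨algebraMap ℂ Germ α, ?_⟩)
    rw [hφ', Algebra.smul_def]
    ring
  obtain ⟨N, hN, c, hc, hlow⟩ := exists_lowest_term hρ hρ0 hρS
  obtain ⟨n, rfl⟩ : ∃ n, N = n + 1 := ⟨N - 1, by omega⟩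
  refine isADE_A (n := n) (by omega) hα hc ?_
  intro d hd
  have : φ f - binom α c 2 0 0 (n + 1) gx gy = ρ - c • (gx ^ 0 * gy ^ (n + 1)) := by
    rw [hφ']; simp [binom]
  rw [this]
  exact hlow d (by
    have := Nat.zero_le ((n + 1) * d 0)
    omega)

theorem isADE_of_two_jet_aux {α β γ : ℂ} (hα : α ≠ 0) {f : Germ} (hsq : Squarefree f)
    (hf : f - (α • gx ^ 2 + β • (gx * gy) + γ • gy ^ 2) ∈ Fil 1 1 3) : IsADE f := by
  obtain ⟨ψ, hx, hy, hψ⟩ := exists_linear_algEquiv (α := 1) (β := -(β / (2 * α))) (γ := 0) (δ := 1)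
    (by simp)
  refine IsADE.of_map ψ ?_
  have h := hψ _ _ hf
  have hu : α * (β / (2 * α)) = β / 2 := by field_simp
  have hid : ψ (f - (α • gx ^ 2 + β • (gx * gy) + γ • gy ^ 2))
      = ψ f - (α • gx ^ 2 + (γ - β / 2 * (β / (2 * α))) • gy ^ 2) := by
    simp only [map_sub, map_add, map_smul, map_pow, map_mul, hx, hy]
    generalize β / (2 * α) = t at *
    obtain rfl : β = 2 * (α * t) := by rw [hu]; ring
    algebra
  rw [hid] at h
  generalize γ - β / 2 * (β / (2 * α)) = γ' at h
  by_cases hγ : γ' = 0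
  · rw [hγ, zero_smul, add_zero] at h
    exact isADE_of_sq_add hα (squarefree_map ψ hsq) h
  · refine isADE_A (n := 1) le_rfl hα hγ ?_
    intro d hd
    have := h d (by omega)
    simpa [binom] using this

/-- A reduced germ with nonzero quadratic part is of type **A**. -/
theorem isADE_of_two_jet {α β γ : ℂ} (h0 : α ≠ 0 ∨ β ≠ 0 ∨ γ ≠ 0) {f : Germ}
    (hsq : Squarefree f)
    (hf : f - (α • gx ^ 2 + β • (gx * gy) + γ • gy ^ 2) ∈ Fil 1 1 3) : IsADE f := by
  by_cases hα : α ≠ 0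
  · exact isADE_of_two_jet_aux hα hsq hf
  push Not at hα
  by_cases hγ : γ ≠ 0
  · obtain ⟨ψ, hx, hy, hψ⟩ := exists_linear_algEquiv (α := 0) (β := 1) (γ := 1) (δ := 0) (by simp)
    refine IsADE.of_map ψ (isADE_of_two_jet_aux (β := β) (γ := α) hγ (squarefree_map ψ hsq) ?_)
    convert hψ _ _ hf using 1
    simp only [map_sub, map_add, map_smul, map_pow, map_mul, hx, hy]
    algebra
  push Not at hγ
  obtain ⟨ψ, hx, hy, hψ⟩ := exists_linear_algEquiv (α := 1) (β := 0) (γ := 1) (δ := 1) (by simp)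
  refine IsADE.of_map ψ (isADE_of_two_jet_aux (α := β) (β := β) (γ := 0) (by simp_all)
    (squarefree_map ψ hsq) ?_)
  convert hψ _ _ hf using 1
  simp only [map_sub, map_add, map_smul, map_pow, map_mul, hx, hy, hα, hγ]
  algebra

/-- A reduced germ with the cubic part `a x² y` is brought to the form `a x² y + ρ(y)`, and the
lowest term of `ρ` gives the principal part. -/
theorem isADE_of_sq_mul {a : ℂ} (ha : a ≠ 0) {f : Germ} (hsq : Squarefree f)
    (hf : f - a • (gx ^ 2 * gy) ∈ Fil 1 1 4) : IsADE f := by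
  obtain ⟨φ, ρ, hρ, hρS, hφ⟩ := exists_normal_form (p := 1) (q := 1) (c₁ := a) (c₂ := 0)
    (i₁ := 2) (j₁ := 1) (i₂ := 2) (j₂ := 1) (d := 3) one_pos one_pos rfl rfl {m | m 0 = 0}
    (fun e he r hr => by
      obtain ⟨s, hs, r', hr', hr'0, e1⟩ := exists_split_off 1 1 hr
      obtain ⟨t, ht, r'', hr'', hr''0, e2⟩ := exists_split_off 2 0 hr'
      refine ⟨(2 * a)⁻¹ • s, smul_mem_Fil (Fil_anti (by omega) hs) _, a⁻¹ • t,
        smul_mem_Fil (Fil_anti (by omega) ht) _, r'', hr'', fun m hm => ?_, ?_⟩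
      · have hm : m 0 ≠ 0 := hm
        by_cases h1 : 1 ≤ m 1
        · exact hr''0 m (Or.inl (hr'0 m (Or.inr ⟨by omega, h1⟩)))
        · by_cases h2 : 2 ≤ m 0
          · exact hr''0 m (Or.inr ⟨h2, by omega⟩)
          · exact hr'' m (by omega)
      rw [e1, e2]
      simp [binomX, binomY, smul_smul, ha]
      ring_nf
      rw [mul_inv_cancel₀ ha, one_smul]
      ring) (f := f) (by simpa [binom] using hf)
  refine IsADE.of_map φ ?_
  have hφ' : φ f = a • (gx ^ 2 * gy) + ρ := by rw [hφ]; simp [binom]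
  by_cases hρ0 : ρ = 0
  · exfalso
    rw [hρ0, add_zero] at hφ'
    refine not_isUnit_gx (squarefree_map φ hsq gx ⟨algebraMap ℂ Germ a * gy, ?_⟩)
    rw [hφ', Algebra.smul_def]
    ring
  obtain ⟨N, hN, c, hc, hlow⟩ := exists_lowest_term hρ hρ0 hρS
  obtain ⟨n, rfl⟩ : ∃ n, N = n + 3 := ⟨N - 3, by omega⟩
  refine isADE_D n ha hc ?_
  intro d hd
  have : φ f - binom a c 2 1 0 (n + 3) gx gy = ρ - c • (gx ^ 0 * gy ^ (n + 3)) := by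
    rw [hφ']; simp [binom]
  rw [this]
  exact hlow d (by
    have := Nat.zero_le ((n + 2) * d 0)
    omega)

/-- A reduced germ of multiplicity three whose tangent cone has a simple line is of type **D**. -/
theorem isADE_of_simple_tangent {A B C : ℂ} (hA : A ≠ 0) {f : Germ} (hsq : Squarefree f)
    (hf : f - gy * (A • gx ^ 2 + B • (gx * gy) + C • gy ^ 2) ∈ Fil 1 1 4) : IsADE f := by
  obtain ⟨ψ, hx, hy, hψ⟩ := exists_linear_algEquiv (α := 1) (β := -(B / (2 * A))) (γ := 0) (δ := 1)
    (by simp)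
  refine IsADE.of_map ψ ?_
  have h := hψ _ _ hf
  have hu : A * (B / (2 * A)) = B / 2 := by field_simp
  have hid : ψ (f - gy * (A • gx ^ 2 + B • (gx * gy) + C • gy ^ 2))
      = ψ f - (A • (gx ^ 2 * gy) + (C - B / 2 * (B / (2 * A))) • gy ^ 3) := by
    simp only [map_sub, map_add, map_smul, map_pow, map_mul, hx, hy]
    generalize B / (2 * A) = t at *
    obtain rfl : B = 2 * (A * t) := by rw [hu]; ring
    algebra
  rw [hid] at h
  generalize C - B / 2 * (B / (2 * A)) = C' at h
  by_cases hC : C' = 0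
  · rw [hC, zero_smul, add_zero] at h
    exact isADE_of_sq_mul hA (squarefree_map ψ hsq) h
  · refine isADE_D 0 hA hC ?_
    intro d hd
    have := h d (by omega)
    simpa [binom] using this

/-- A monic complex cubic is a product of three linear factors. -/
theorem exists_roots_cubic (b c e : ℂ) : ∃ t₁ t₂ t₃ : ℂ,
    b = -(t₁ + t₂ + t₃) ∧ c = t₁ * t₂ + t₁ * t₃ + t₂ * t₃ ∧ e = -(t₁ * t₂ * t₃) := by
  obtain ⟨t₁, h₁⟩ := IsAlgClosed.exists_root
    (Polynomial.X ^ 3 + Polynomial.C b * Polynomial.X ^ 2 + Polynomial.C c * Polynomial.X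
      + Polynomial.C e : Polynomial ℂ) (by
      have : (Polynomial.X ^ 3 + Polynomial.C b * Polynomial.X ^ 2 + Polynomial.C c * Polynomial.X
        + Polynomial.C e : Polynomial ℂ).degree = 3 := by compute_degree!
      rw [this]; decide)
  simp only [Polynomial.IsRoot.def, Polynomial.eval_add, Polynomial.eval_mul, Polynomial.eval_pow,
    Polynomial.eval_X, Polynomial.eval_C] at h₁
  -- the remaining two roots satisfy `t ^ 2 + (b + t₁) * t + (c + t₁ * (b + t₁)) = 0`
  obtain ⟨s, hs⟩ := IsAlgClosed.exists_pow_nat_eq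
    ((b + t₁) ^ 2 - 4 * (c + t₁ * (b + t₁))) (n := 2) (by norm_num)
  refine ⟨t₁, (-(b + t₁) + s) / 2, (-(b + t₁) - s) / 2, by ring, ?_, ?_⟩
  · linear_combination (1 / 4 : ℂ) * hs
  · linear_combination h₁ - (t₁ / 4) * hs

/-- A reduced germ of multiplicity three is of type **D**, unless its tangent cone is a triple
line. -/
theorem isADE_or_cube_of_three_jet {a b c e : ℂ} (ha : a ≠ 0) {f : Germ} (hsq : Squarefree f)
    (hf : f - (a • gx ^ 3 + b • (gx ^ 2 * gy) + c • (gx * gy ^ 2) + e • gy ^ 3) ∈ Fil 1 1 4) :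
    IsADE f ∨ ∃ t : ℂ, f - a • (gx + t • gy) ^ 3 ∈ Fil 1 1 4 := by
  obtain ⟨t₁, t₂, t₃, h₁, h₂, h₃⟩ := exists_roots_cubic (b / a) (c / a) (e / a)
  have hb : b = a * -(t₁ + t₂ + t₃) := by rw [← h₁]; field_simp
  have hc : c = a * (t₁ * t₂ + t₁ * t₃ + t₂ * t₃) := by rw [← h₂]; field_simp
  have he : e = a * -(t₁ * t₂ * t₃) := by rw [← h₃]; field_simp
  have hf' : f - a • ((gx - t₁ • gy) * (gx - t₂ • gy) * (gx - t₃ • gy)) ∈ Fil 1 1 4 := by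
    convert hf using 2
    rw [hb, hc, he]
    algebra
  -- a simple root gives a simple line in the tangent cone
  have key : ∀ t s₁ s₂ : ℂ, t ≠ s₁ → t ≠ s₂ →
      f - a • ((gx - s₁ • gy) * (gx - s₂ • gy) * (gx - t • gy)) ∈ Fil 1 1 4 → IsADE f := by
    intro t s₁ s₂ hs₁ hs₂ h
    obtain ⟨ψ, hx, hy, hψ⟩ := exists_linear_algEquiv (α := t) (β := 1) (γ := 1) (δ := 0) (by simp)
    refine IsADE.of_map ψ (isADE_of_simple_tangent (A := a * ((t - s₁) * (t - s₂)))
      (B := a * ((t - s₁) + (t - s₂))) (C := a)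
      (mul_ne_zero ha (mul_ne_zero (sub_ne_zero.2 hs₁) (sub_ne_zero.2 hs₂)))
      (squarefree_map ψ hsq) ?_)
    convert hψ _ _ h using 1
    simp only [map_sub, map_smul, map_mul, hx, hy]
    algebra
  by_cases h12 : t₁ = t₂
  · by_cases h13 : t₁ = t₃
    · refine Or.inr ⟨-t₁, ?_⟩
      convert hf' using 2
      rw [← h12, ← h13]
      algebra
    · exact Or.inl (key t₃ t₁ t₂ (Ne.symm h13) (h12 ▸ Ne.symm h13) hf')
  · by_cases h13 : t₁ = t₃
    · refine Or.inl (key t₂ t₁ t₃ (Ne.symm h12) (h13 ▸ Ne.symm h12) ?_)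
      convert hf' using 2
      algebra
    · refine Or.inl (key t₁ t₂ t₃ h12 h13 ?_)
      convert hf' using 2
      algebra

/-- A germ whose tangent cone is the triple line `x = 0` is of type **E**, unless all its terms
have weight at least six when `x` and `y` have weights two and one. -/
theorem isADE_or_mem_Fil_of_cube {a : ℂ} (ha : a ≠ 0) {f : Germ}
    (hf : f - a • gx ^ 3 ∈ Fil 1 1 4) : IsADE f ∨ f ∈ Fil 2 1 6 := by
  have hcoef : ∀ d : Fin 2 →₀ ℕ, d 0 + d 1 < 4 → MvPowerSeries.coeff d f
      = a * if d 0 = 3 ∧ d 1 = 0 then 1 else 0 := by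
    intro d hd
    have h := hf d (by omega)
    have h2 := coeff_gx_gy 3 0 d
    rw [pow_zero, mul_one] at h2
    rwa [map_sub, map_smul, h2, sub_eq_zero, smul_eq_mul] at h
  have hsub : ∀ (c : ℂ) (i j : ℕ) (d : Fin 2 →₀ ℕ),
      MvPowerSeries.coeff d (f - binom a c 3 0 i j gx gy) = MvPowerSeries.coeff d f
        - a * (if d 0 = 3 ∧ d 1 = 0 then 1 else 0) - c * if d 0 = i ∧ d 1 = j then 1 else 0 := by
    intro c i j d
    rw [binom, map_sub, map_add, map_smul, map_smul, coeff_gx_gy, coeff_gx_gy]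
    simp only [smul_eq_mul]
    ring
  by_cases h04 : MvPowerSeries.coeff (expo 0 4) f = 0
  swap
  · refine Or.inl (isADE_E6 ha h04 fun d hd => ?_)
    rw [hsub]
    by_cases h : d 0 + d 1 < 4
    · rw [hcoef d h, if_neg (c := d 0 = 0 ∧ d 1 = 4) (by omega)]
      ring
    · obtain rfl : d = expo 0 4 := eq_expo (by omega) (by omega)
      simp
  by_cases h13 : MvPowerSeries.coeff (expo 1 3) f = 0
  swap
  · refine Or.inl (isADE_E7 ha h13 fun d hd => ?_)
    rw [hsub]
    by_cases h : d 0 + d 1 < 4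
    · rw [hcoef d h, if_neg (c := d 0 = 1 ∧ d 1 = 3) (by omega)]
      ring
    · by_cases h0 : d 0 = 0
      · obtain rfl : d = expo 0 4 := eq_expo (by omega) (by omega)
        simp [h04]
      · obtain rfl : d = expo 1 3 := eq_expo (by omega) (by omega)
        simp
  by_cases h05 : MvPowerSeries.coeff (expo 0 5) f = 0
  swap
  · refine Or.inl (isADE_E8 ha h05 fun d hd => ?_)
    rw [hsub]
    by_cases h : d 0 + d 1 < 4
    · rw [hcoef d h, if_neg (c := d 0 = 0 ∧ d 1 = 5) (by omega)]
      ring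
    · by_cases h0 : d 0 = 0
      · by_cases h1 : d 1 = 4
        · obtain rfl : d = expo 0 4 := eq_expo h0 h1
          simp [h04]
        · obtain rfl : d = expo 0 5 := eq_expo h0 (by omega)
          simp
      · obtain rfl : d = expo 1 3 := eq_expo (by omega) (by omega)
        simp [h13]
  refine Or.inr fun d hd => ?_
  by_cases h : d 0 + d 1 < 4
  · rw [hcoef d h, if_neg (by omega), mul_zero]
  · by_cases h0 : d 0 = 0
    · by_cases h1 : d 1 = 4
      · rwa [eq_expo h0 h1]
      · rwa [eq_expo (d := d) (i := 0) (j := 5) h0 (by omega)]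
    · rwa [eq_expo (d := d) (i := 1) (j := 3) (by omega) (by omega)]

/-! ### Germs with an infinitely near triple point -/

/-- The maximal ideal of the ring of power series. -/
noncomputable abbrev maxIdeal : Ideal Germ := Fil 1 1 1

theorem mem_maxIdeal {f : Germ} : f ∈ maxIdeal ↔ MvPowerSeries.constantCoeff f = 0 := by
  refine ⟨constantCoeff_eq_zero_of_mem_Fil one_pos, fun h d hd => ?_⟩
  have : d = 0 := by
    ext k
    fin_cases k
    · change d 0 = 0
      omega
    · change d 1 = 0
      omega
  rwa [this, MvPowerSeries.coeff_zero_eq_constantCoeff_apply]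

theorem map_mem_maxIdeal (φ : Germ ≃ₐ[ℂ] Germ) {f : Germ} (hf : f ∈ maxIdeal) :
    φ f ∈ maxIdeal := by
  have key : ∀ f : Germ, f ∈ maxIdeal ↔ ¬ IsUnit f := fun f => by
    rw [mem_maxIdeal, MvPowerSeries.isUnit_iff_constantCoeff, isUnit_iff_ne_zero, not_not]
  rw [key] at hf ⊢
  rwa [MulEquiv.isUnit_map]

/-- The ideal generated by `ℓ` and the square of the maximal ideal: for `ℓ` in the maximal ideal,
the ideal of the germs that vanish at the origin and at the infinitely near point in the direction
of `ℓ = 0`. -/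
noncomputable def nearIdeal (ℓ : Germ) : Ideal Germ := Ideal.span {ℓ} ⊔ maxIdeal ^ 2

theorem maxIdeal_sq_le : maxIdeal ^ 2 ≤ Fil 1 1 2 := by
  rw [pow_two, Ideal.mul_le]
  exact fun a ha b hb => mul_mem_Fil ha hb

theorem map_mem_nearIdeal_pow (φ : Germ ≃ₐ[ℂ] Germ) {ℓ f : Germ} (hf : f ∈ nearIdeal ℓ ^ 3) :
    φ f ∈ nearIdeal (φ ℓ) ^ 3 := by
  have h1 := Ideal.mem_map_of_mem φ.toRingEquiv.toRingHom hf
  rw [Ideal.map_pow] at h1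
  refine Ideal.pow_right_mono ?_ 3 h1
  rw [nearIdeal, Ideal.map_sup, Ideal.map_span, Ideal.map_pow, Set.image_singleton]
  refine sup_le_sup le_rfl (Ideal.pow_right_mono ?_ 2)
  rw [Ideal.map_le_iff_le_comap]
  exact fun g hg => map_mem_maxIdeal φ hg

theorem nearIdeal_pow_three_le {ℓ : Germ} (hℓ : ℓ ∈ maxIdeal) :
    nearIdeal ℓ ^ 3 ≤ Ideal.span {ℓ ^ 3} ⊔ Fil 1 1 4 := by
  have hle : nearIdeal ℓ ≤ Ideal.span {ℓ} ⊔ Fil 1 1 2 := sup_le_sup le_rfl maxIdeal_sq_le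
  have hmul : ∀ n, (Ideal.span {ℓ ^ n} ⊔ Fil 1 1 (n + 1)) * nearIdeal ℓ
      ≤ Ideal.span {ℓ ^ (n + 1)} ⊔ Fil 1 1 (n + 2) := by
    intro n
    rw [Ideal.mul_le]
    intro f hf g hg
    obtain ⟨f₁, hf₁, f₂, hf₂, rfl⟩ := Submodule.mem_sup.1 hf
    obtain ⟨g₁, hg₁, g₂, hg₂, rfl⟩ := Submodule.mem_sup.1 (hle hg)
    obtain ⟨s, rfl⟩ := Ideal.mem_span_singleton'.1 hf₁
    obtain ⟨t, rfl⟩ := Ideal.mem_span_singleton'.1 hg₁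
    refine Submodule.mem_sup.2 ⟨s * t * ℓ ^ (n + 1), Ideal.mem_span_singleton'.2 ⟨_, rfl⟩,
      s * (ℓ ^ n * g₂) + t * (f₂ * ℓ) + f₂ * g₂, ?_, by ring⟩
    refine Ideal.add_mem _ (Ideal.add_mem _ (Ideal.mul_mem_left _ _ ?_)
      (Ideal.mul_mem_left _ _ ?_)) ?_
    · exact Fil_anti (by omega) (mul_mem_Fil (pow_mem_Fil hℓ n) hg₂)
    · exact Fil_anti (by omega) (mul_mem_Fil hf₂ hℓ)
    · exact Fil_anti (by omega) (mul_mem_Fil hf₂ hg₂)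
  have h0 : nearIdeal ℓ ^ 0 ≤ Ideal.span {ℓ ^ 0} ⊔ Fil 1 1 1 := by simp
  have hstep : ∀ n, nearIdeal ℓ ^ n ≤ Ideal.span {ℓ ^ n} ⊔ Fil 1 1 (n + 1) := by
    intro n
    induction n with
    | zero => exact h0
    | succ n ih =>
      rw [pow_succ]
      exact (Ideal.mul_mono_left ih).trans (hmul n)
  exact hstep 3

theorem coeff_gx_pow (i : ℕ) (d : Fin 2 →₀ ℕ) :
    MvPowerSeries.coeff d (gx ^ i : Germ) = if d 0 = i ∧ d 1 = 0 then 1 else 0 := by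
  simpa using coeff_gx_gy i 0 d

theorem coeff_gy_pow (j : ℕ) (d : Fin 2 →₀ ℕ) :
    MvPowerSeries.coeff d (gy ^ j : Germ) = if d 0 = 0 ∧ d 1 = j then 1 else 0 := by
  simpa using coeff_gx_gy 0 j d

/-- The two lowest jets of an element of the cube of `nearIdeal ℓ`: the quadratic part vanishes and
the cubic part is proportional to the cube of the linear part of `ℓ`. -/
theorem exists_coeff_of_mem_nearIdeal_pow {ℓ g : Germ} (hℓ : ℓ ∈ maxIdeal)
    (hg : g ∈ nearIdeal ℓ ^ 3) : ∃ s : ℂ,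
      MvPowerSeries.coeff (expo 2 0) g = 0 ∧
      MvPowerSeries.coeff (expo 3 0) g = s * MvPowerSeries.coeff (expo 1 0) ℓ ^ 3 ∧
      MvPowerSeries.coeff (expo 2 1) g = s * (3 * MvPowerSeries.coeff (expo 1 0) ℓ ^ 2 *
        MvPowerSeries.coeff (expo 0 1) ℓ) ∧
      MvPowerSeries.coeff (expo 0 3) g = s * MvPowerSeries.coeff (expo 0 1) ℓ ^ 3 := by
  set α := MvPowerSeries.coeff (expo 1 0) ℓ with hα
  set β := MvPowerSeries.coeff (expo 0 1) ℓ with hβ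
  obtain ⟨_, h₁, h, hh, rfl⟩ := Submodule.mem_sup.1 (nearIdeal_pow_three_le hℓ hg)
  obtain ⟨s, rfl⟩ := Ideal.mem_span_singleton'.1 h₁
  set s₀ : ℂ := MvPowerSeries.constantCoeff s with hs₀
  have hlin : α • gx + β • gy ∈ Fil 1 1 1 :=
    Ideal.add_mem _ (smul_mem_Fil X0_mem_Fil α) (smul_mem_Fil X1_mem_Fil β)
  have hℓ' : ℓ - (α • gx + β • gy) ∈ Fil 1 1 (1 + 1) := by
    intro d hd
    have e1 := coeff_gx_pow 1 d
    have e2 := coeff_gy_pow 1 d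
    rw [pow_one] at e1 e2
    rw [map_sub, map_add, map_smul, map_smul, e1, e2]
    by_cases h0 : d 0 = 0
    · by_cases h1 : d 1 = 0
      · rw [hℓ d (by omega)]
        simp [h0, h1]
      · obtain rfl : d = expo 0 1 := eq_expo h0 (by omega)
        simp [hβ]
    · obtain rfl : d = expo 1 0 := eq_expo (by omega) (by omega)
      simp [hα]
  have hs : s - algebraMap ℂ Germ s₀ ∈ Fil 1 1 1 := by
    rw [mem_maxIdeal, map_sub, MvPowerSeries.algebraMap_apply, Algebra.algebraMap_self_apply,
      MvPowerSeries.constantCoeff_C, sub_self]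
  have hcube := pow_sub_pow_mem_Fil hlin hℓ' 3
  have hrem : s * ℓ ^ 3 + h - s₀ • (α • gx + β • gy) ^ 3 ∈ Fil 1 1 4 := by
    have k1 := Ideal.mul_mem_left _ (algebraMap ℂ Germ s₀) hcube
    have k2 := Fil_anti (k := 4) (by omega) (mul_mem_Fil hs (pow_mem_Fil hℓ 3))
    have := Ideal.add_mem _ (Ideal.add_mem _ k1 k2) hh
    convert this using 1
    rw [Algebra.smul_def]
    ring
  have hexp : s₀ • (α • gx + β • gy) ^ 3 = (s₀ * α ^ 3) • (gx ^ 3 * gy ^ 0)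
      + (s₀ * (3 * α ^ 2 * β)) • (gx ^ 2 * gy ^ 1) + (s₀ * (3 * α * β ^ 2)) • (gx ^ 1 * gy ^ 2)
      + (s₀ * β ^ 3) • (gx ^ 0 * gy ^ 3) := by algebra
  rw [hexp] at hrem
  have hcoef : ∀ i j, i + j < 4 → MvPowerSeries.coeff (expo i j) (s * ℓ ^ 3 + h)
      = MvPowerSeries.coeff (expo i j) ((s₀ * α ^ 3) • (gx ^ 3 * gy ^ 0)
      + (s₀ * (3 * α ^ 2 * β)) • (gx ^ 2 * gy ^ 1) + (s₀ * (3 * α * β ^ 2)) • (gx ^ 1 * gy ^ 2)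
      + (s₀ * β ^ 3) • (gx ^ 0 * gy ^ 3)) := by
    intro i j hij
    have := hrem (expo i j) (by simpa using hij)
    rwa [map_sub, sub_eq_zero] at this
  simp only [map_add, map_smul, coeff_gx_gy, expo_zero, expo_one] at hcoef
  refine ⟨s₀, ?_, ?_, ?_, ?_⟩
  · simpa using hcoef 2 0 (by omega)
  · simpa using hcoef 3 0 (by omega)
  · simpa using hcoef 2 1 (by omega)
  · simpa using hcoef 0 3 (by omega)

/-- A germ with an infinitely near triple point is not simple. -/
theorem not_isADE_of_mem_nearIdeal_pow {ℓ f : Germ} (hℓ : ℓ ∈ maxIdeal)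
    (hf : f ∈ nearIdeal ℓ ^ 3) : ¬ IsADE f := by
  rintro ⟨g, hg, φ, u, hu⟩
  have hℓ' := map_mem_maxIdeal φ hℓ
  have hg' : g ∈ nearIdeal (φ ℓ) ^ 3 := by
    have := map_mem_nearIdeal_pow φ hf
    rw [hu] at this
    rwa [Ideal.unit_mul_mem_iff_mem _ u.isUnit] at this
  generalize φ ℓ = m at *
  obtain ⟨s, h20, h30, h21, h03⟩ := exists_coeff_of_mem_nearIdeal_pow hℓ' hg'
  -- in the **E** cases the tangent line is `x = 0`, and all weights are at least six
  have hE : MvPowerSeries.coeff (expo 3 0) g = 1 → MvPowerSeries.coeff (expo 2 1) g = 0 →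
      g ∈ Fil 2 1 6 := by
    intro e30 e21
    rw [e30] at h30
    rw [e21] at h21
    have hβ : MvPowerSeries.coeff (expo 0 1) m = 0 := by
      have hα : MvPowerSeries.coeff (expo 1 0) m ≠ 0 := by
        intro h
        rw [h] at h30
        simp at h30
      have hs : s ≠ 0 := by
        rintro rfl
        simp at h30
      simpa [hs, hα] using h21.symm
    have hm : m ∈ Fil 2 1 2 := by
      intro d hd
      by_cases h1 : d 1 = 0
      · exact hℓ' d (by omega)
      · rwa [eq_expo (d := d) (i := 0) (j := 1) (by omega) (by omega)]
    have hle : nearIdeal m ≤ Fil 2 1 2 := by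
      refine sup_le ((Ideal.span_singleton_le_iff_mem _).2 hm) (maxIdeal_sq_le.trans ?_)
      exact fun f hf d hd => hf d (by omega)
    have hle3 : nearIdeal m ^ 3 ≤ Fil 2 1 6 := by
      refine (Ideal.pow_right_mono hle 3).trans ?_
      rw [pow_three, Ideal.mul_le]
      intro a ha b hb
      have hb' : b ∈ Fil 2 1 4 := (Ideal.mul_le.2 fun a ha b hb => mul_mem_Fil ha hb) hb
      exact mul_mem_Fil ha hb'
    exact hle3 hg'
  rcases hg with ⟨n, hn, rfl⟩ | ⟨n, hn, rfl⟩ | rfl | rfl | rfl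
  · rw [map_add, coeff_gx_pow, coeff_gy_pow] at h20
    simp at h20
  · rw [map_add, coeff_gy_pow] at h30 h21
    have e1 := coeff_gx_gy 2 1
    simp only [pow_one] at e1
    rw [e1] at h30 h21
    simp only [expo_zero, expo_one] at h30 h21
    norm_num at h30 h21
    rcases h30 with h | h <;> simp [h] at h21
  · have := hE (by simp [coeff_gx_pow, coeff_gy_pow]) (by simp [coeff_gx_pow, coeff_gy_pow])
      (expo 0 4) (by simp)
    simp [coeff_gx_pow, coeff_gy_pow] at this
  · have e1 := coeff_gx_gy 1 3
    simp only [pow_one] at e1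
    have := hE (by simp [coeff_gx_pow, e1]) (by simp [coeff_gx_pow, e1])
      (expo 1 3) (by simp)
    simp [coeff_gx_pow, e1] at this
  · have := hE (by simp [coeff_gx_pow, coeff_gy_pow]) (by simp [coeff_gx_pow, coeff_gy_pow])
      (expo 0 5) (by simp)
    simp [coeff_gx_pow, coeff_gy_pow] at this

/-- Three smooth germs tangent to each other form a singularity of type **J**₁₀: the coordinate
`x` is shifted by the critical value `t` of the cubic polynomial with roots `μ₀`, `μ₁`, `μ₂`, which
kills the coefficient of `x y⁴`. -/
theorem exists_j10 {c μ₀ μ₁ μ₂ : ℂ} (hc : c ≠ 0) (h01 : μ₀ ≠ μ₁) (h02 : μ₀ ≠ μ₂) (h12 : μ₁ ≠ μ₂) :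
    ∃ g ∈ j10NormalForms, ContactEquivalent
      (c • ((gx - μ₀ • gy ^ 2) * (gx - μ₁ • gy ^ 2) * (gx - μ₂ • gy ^ 2))) g := by
  obtain ⟨r, hr⟩ := IsAlgClosed.exists_pow_nat_eq
    ((μ₀ + μ₁ + μ₂) ^ 2 - 3 * (μ₀ * μ₁ + μ₀ * μ₂ + μ₁ * μ₂)) (n := 2) (by norm_num)
  obtain ⟨t, ht⟩ : ∃ t, t = (μ₀ + μ₁ + μ₂ + r) / 3 := ⟨_, rfl⟩
  have he2 : (t - μ₀) * (t - μ₁) + (t - μ₀) * (t - μ₂) + (t - μ₁) * (t - μ₂) = 0 := by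
    rw [ht]
    linear_combination (1 / 3 : ℂ) * hr
  have hν0 : t - μ₀ ≠ 0 := by
    intro h
    rw [h, zero_mul, zero_mul, zero_add, zero_add] at he2
    rcases mul_eq_zero.1 he2 with h' | h'
    · exact h01 (by linear_combination h' - h)
    · exact h02 (by linear_combination h' - h)
  have hν1 : t - μ₁ ≠ 0 := by
    intro h
    rw [h, mul_zero, zero_mul, zero_add, add_zero] at he2
    rcases mul_eq_zero.1 he2 with h' | h'
    · exact h01 (by linear_combination h - h')
    · exact h12 (by linear_combination h' - h)
  have hν2 : t - μ₂ ≠ 0 := by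
    intro h
    rw [h, mul_zero, mul_zero, add_zero, add_zero] at he2
    rcases mul_eq_zero.1 he2 with h' | h'
    · exact h02 (by linear_combination h - h')
    · exact h12 (by linear_combination h - h')
  obtain ⟨s, hs⟩ := IsAlgClosed.exists_pow_nat_eq ((t - μ₀) * (t - μ₁) * (t - μ₂)) (n := 3)
    (by norm_num)
  have hs0 : s ≠ 0 := by
    rintro rfl
    rw [zero_pow (by norm_num)] at hs
    exact mul_ne_zero (mul_ne_zero hν0 hν1) hν2 hs.symm
  have hty : MvPowerSeries.constantCoeff (gx + t • gy ^ 2) = (0 : ℂ) := by simp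
  obtain ⟨φ, hφ⟩ := exists_algEquiv_of_sub_mem_Fil (p := 1) (q := 1) one_pos one_pos
    (a := gx + t • gy ^ 2) (b := gy)
    (by
      rw [add_sub_cancel_left]
      exact smul_mem_Fil (by simpa using pow_mem_Fil X1_mem_Fil 2) t)
    (by simp) hty (by simp)
  have hφx : φ gx = gx + t • gy ^ 2 := by rw [hφ, subHom_gx]
  have hφy : φ gy = gy := by rw [hφ, subHom_gy]
  obtain ⟨ψ, hψx, hψy, -⟩ := exists_linear_algEquiv (α := s) (β := 0) (γ := 0) (δ := 1)
    (by simpa using hs0)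
  rw [zero_smul, add_zero] at hψx
  rw [zero_smul, zero_add, one_smul] at hψy
  have hcs : (c * s ^ 3)⁻¹ ≠ 0 := inv_ne_zero (mul_ne_zero hc (pow_ne_zero _ hs0))
  set e₁ := (t - μ₀) + (t - μ₁) + (t - μ₂) with he₁
  refine ⟨_, ⟨e₁ / s, ?_, rfl⟩, ContactEquivalent.of_smul_map hcs (φ.trans ψ)
    ⟨AlgEquiv.refl, 1, ?_⟩⟩
  · -- the discriminant of the cubic polynomial with roots `μ₀`, `μ₁`, `μ₂`
    intro h
    have h1 : 4 * e₁ ^ 3 + 27 * ((t - μ₀) * (t - μ₁) * (t - μ₂)) = 0 := by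
      rw [← hs]
      have : 4 * e₁ ^ 3 + 27 * s ^ 3 = s ^ 3 * (4 * (e₁ / s) ^ 3 + 27) := by
        field_simp
      rw [this, h, mul_zero]
    have h2 : ((μ₀ - μ₁) * (μ₀ - μ₂) * (μ₁ - μ₂)) ^ 2 = 0 := by
      have gen : ∀ a b d : ℂ, a * b + a * d + b * d = 0 →
          4 * (a + b + d) ^ 3 + 27 * (a * b * d) = 0 →
          ((b - a) * (d - a) * (d - b)) ^ 2 = 0 := by
        intro a b d h1 h2
        linear_combination ((a + b + d) ^ 2 * (a * b + a * d + b * d)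
          - 4 * (a * b + a * d + b * d) ^ 2 + 18 * (a + b + d) * (a * b * d)) * h1
          - (a * b * d) * h2
      have := gen _ _ _ he2 h1
      rw [← this]
      ring
    rw [sq_eq_zero_iff] at h2
    exact mul_ne_zero (mul_ne_zero (sub_ne_zero.2 h01) (sub_ne_zero.2 h02)) (sub_ne_zero.2 h12) h2
  · simp only [AlgEquiv.trans_apply, map_smul, map_mul, map_sub, map_add,
      map_pow, hφx, hφy, hψx, hψy, AlgEquiv.coe_refl, id, Units.val_one, one_mul]
    have hprod : (s • gx + t • gy ^ 2 - μ₀ • gy ^ 2) * (s • gx + t • gy ^ 2 - μ₁ • gy ^ 2)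
        * (s • gx + t • gy ^ 2 - μ₂ • gy ^ 2)
        = (s ^ 3) • gx ^ 3 + (s ^ 2 * e₁) • (gx ^ 2 * gy ^ 2)
          + (s * ((t - μ₀) * (t - μ₁) + (t - μ₀) * (t - μ₂) + (t - μ₁) * (t - μ₂)))
            • (gx * gy ^ 4)
          + ((t - μ₀) * (t - μ₁) * (t - μ₂)) • gy ^ 6 := by
      rw [he₁]
      algebra
    rw [hprod, he2, ← hs, mul_zero, zero_smul, add_zero, smul_smul,
      show (c * s ^ 3)⁻¹ * c = (s ^ 3)⁻¹ by field_simp]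
    simp only [smul_add, smul_smul]
    rw [inv_mul_cancel₀ (pow_ne_zero _ hs0), show (s ^ 3)⁻¹ * (s ^ 2 * e₁) = e₁ / s by field_simp,
      one_smul, one_smul, ← MvPowerSeries.smul_eq_C_mul, smul_mul_assoc]

/-! ### Germs of reduced curves -/

/-- A square-free polynomial over a unique factorization domain of characteristic zero and its
derivative span an ideal that contains a nonzero constant. -/
theorem exists_bezout_derivative {S : Type*} [CommRing S] [IsDomain S]
    [UniqueFactorizationMonoid S] [CharZero S] {f : Polynomial S} (hf : Squarefree f) :
    ∃ A B : Polynomial S, ∃ r : S, r ≠ 0 ∧ A * f + B * f.derivative = Polynomial.C r := by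
  classical
  let : StrongNormalizationMonoid S := UniqueFactorizationMonoid.strongNormalizationMonoid
  let : NormalizedGCDMonoid S := UniqueFactorizationMonoid.toNormalizedGCDMonoid S
  let K := FractionRing S
  have : CharZero K := charZero_of_injective_algebraMap (IsFractionRing.injective S K)
  let i : S →+* K := algebraMap S K
  have hi : Function.Injective i := IsFractionRing.injective S K
  have hsq : Squarefree (f.map i) := by
    intro g hg
    have hf0 : f.map i ≠ 0 := by
      rw [Ne, Polynomial.map_eq_zero_iff hi]
      exact hf.ne_zero
    have hg0 : g ≠ 0 := by
      rintro rfl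
      rw [mul_zero, zero_dvd_iff] at hg
      exact hf0 hg
    obtain ⟨b, hbm, hb⟩ := IsLocalization.integerNormalization_spec (nonZeroDivisors S) g
    set h := IsLocalization.integerNormalization (nonZeroDivisors S) g with hh
    have hb0 : i b ≠ 0 := by
      rw [Ne, map_eq_zero_iff i hi]
      exact nonZeroDivisors.ne_zero hbm
    have hh0 : h ≠ 0 := by
      rw [hh, Ne, IsFractionRing.integerNormalization_eq_zero_iff]
      exact hg0
    have hc0 : i h.content ≠ 0 := by
      rw [Ne, map_eq_zero_iff i hi, Polynomial.content_eq_zero_iff]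
      exact hh0
    -- `g` is the primitive part of `h` up to a constant of the field of fractions
    have hg1 : g = Polynomial.C ((i b)⁻¹ * i h.content) * h.primPart.map i := by
      have e1 : h.map i = Polynomial.C (i h.content) * h.primPart.map i := by
        conv_lhs => rw [h.eq_C_content_mul_primPart]
        rw [Polynomial.map_mul, Polynomial.map_C]
      have e2 : Polynomial.C (i b) * g = h.map i := by
        rw [hb, ← algebraMap_smul K, Polynomial.smul_eq_C_mul]
      rw [Polynomial.C_mul, mul_assoc, ← e1, ← e2, ← mul_assoc, ← Polynomial.C_mul,
        inv_mul_cancel₀ hb0, Polynomial.C_1, one_mul]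
    have hprim := h.isPrimitive_primPart
    have hdvd : h.primPart * h.primPart ∣ f := by
      refine (hprim.mul hprim).dvd_of_fraction_map_dvd_fraction_map (K := K) ?_
      rw [Polynomial.map_mul]
      refine dvd_trans (mul_dvd_mul ?_ ?_) hg <;>
      · rw [hg1]
        exact dvd_mul_left _ _
    rw [hg1]
    refine IsUnit.mul (Polynomial.isUnit_C.2 (mul_ne_zero (inv_ne_zero hb0) hc0).isUnit) ?_
    exact (hf _ hdvd).map (Polynomial.mapRingHom i)
  have hsep := PerfectField.separable_iff_squarefree.2 hsq
  obtain ⟨A, B, hAB⟩ := hsep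
  obtain ⟨a, ham, ha⟩ := IsLocalization.integerNormalization_spec (nonZeroDivisors S) A
  obtain ⟨b, hbm, hb⟩ := IsLocalization.integerNormalization_spec (nonZeroDivisors S) B
  set A' := IsLocalization.integerNormalization (nonZeroDivisors S) A
  set B' := IsLocalization.integerNormalization (nonZeroDivisors S) B
  refine ⟨Polynomial.C b * A', Polynomial.C a * B', a * b,
    mul_ne_zero (nonZeroDivisors.ne_zero ham) (nonZeroDivisors.ne_zero hbm), ?_⟩
  apply Polynomial.map_injective i hi
  rw [← algebraMap_smul K, Polynomial.smul_eq_C_mul] at ha hb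
  simp only [Polynomial.map_add, Polynomial.map_mul, Polynomial.map_C, map_mul]
  rw [ha, hb, ← Polynomial.derivative_map]
  linear_combination (Polynomial.C (i a) * Polynomial.C (i b)) * hAB

theorem prime_gx : Prime gx := by
  have hw : ∀ f : Germ, gx ∣ f ↔ 1 ≤ f.weightedOrder ![1, 0] := by
    intro f
    rw [MvPowerSeries.X_dvd_iff]
    constructor
    · intro h
      refine MvPowerSeries.le_weightedOrder _ fun d hd => h d ?_
      simpa [Finsupp.weight_apply, Finsupp.sum_fintype] using hd
    · intro h d hd
      refine MvPowerSeries.coeff_eq_zero_of_lt_weightedOrder ![1, 0] (lt_of_lt_of_le ?_ h)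
      simp [Finsupp.weight_apply, Finsupp.sum_fintype, hd]
  have hne : gx ≠ 0 := by
    intro h
    have h1 := coeff_gx_pow 1 (expo 1 0)
    rw [pow_one, h] at h1
    simp at h1
  refine ⟨hne, not_isUnit_gx, fun a b h => ?_⟩
  rw [hw, MvPowerSeries.weightedOrder_mul] at h
  rw [hw, hw]
  by_contra! hab
  rw [Order.lt_one_iff, Order.lt_one_iff] at hab
  rw [hab.1, hab.2] at h
  simp at h

/-- A nonzero polynomial in one coordinate is a power of this coordinate times a unit. -/
theorem exists_aeval_gx_eq {R : Polynomial ℂ} (hR : R ≠ 0) :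
    ∃ (k : ℕ) (u : Germˣ), Polynomial.aeval gx R = gx ^ k * u := by
  obtain ⟨q, hq, hq0⟩ := R.exists_eq_pow_rootMultiplicity_mul_and_not_dvd hR 0
  rw [Polynomial.C_0, sub_zero] at hq hq0
  have hu : IsUnit (Polynomial.aeval gx q) := by
    rw [MvPowerSeries.isUnit_iff_constantCoeff, isUnit_iff_ne_zero]
    rw [Polynomial.X_dvd_iff] at hq0
    have e : MvPowerSeries.constantCoeff (Polynomial.aeval gx q) = q.coeff 0 := by
      rw [← Polynomial.divX_mul_X_add q]
      simp [MvPowerSeries.algebraMap_apply]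
    rwa [e]
  refine ⟨R.rootMultiplicity 0, hu.unit, ?_⟩
  conv_lhs => rw [hq]
  rw [map_mul, map_pow, Polynomial.aeval_X, IsUnit.unit_spec]

/-- Values of a form at proportional vectors. -/
theorem aeval_smul_of_isHomogeneous {A : Type*} [CommRing A] [Algebra ℂ A] {n : ℕ}
    {P : MvPolynomial (Fin 3) ℂ} (hP : P.IsHomogeneous n) (c : ℂ) (z : Fin 3 → A) :
    MvPolynomial.aeval (fun i => c • z i) P = c ^ n • MvPolynomial.aeval z P := by
  rw [MvPolynomial.aeval_def, MvPolynomial.aeval_def, MvPolynomial.eval₂_eq',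
    MvPolynomial.eval₂_eq', Finset.smul_sum]
  refine Finset.sum_congr rfl fun m hm => ?_
  have hdeg := hP (MvPolynomial.mem_support_iff.1 hm)
  rw [Finsupp.weight_apply, Finsupp.sum_fintype _ _ (by simp), Fin.sum_univ_three] at hdeg
  simp only [Pi.one_apply, smul_eq_mul, mul_one] at hdeg
  rw [← hdeg, Fin.prod_univ_three, Fin.prod_univ_three]
  simp only [Algebra.smul_def, pow_add, map_mul, map_pow]
  ring

/-- The germ at `[0 : 1 : 0]` of the curve `P = 0`. -/
noncomputable def germ (P : MvPolynomial (Fin 3) ℂ) : Germ :=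
  MvPolynomial.aeval ![gy, 1, gx] P

/-- The exponent of `X₀ ^ i * X₁ ^ j * X₂ ^ k`. -/
noncomputable def expo₃ (i j k : ℕ) : Fin 3 →₀ ℕ :=
  Finsupp.single 0 i + Finsupp.single 1 j + Finsupp.single 2 k

theorem eq_expo₃ (m : Fin 3 →₀ ℕ) : m = expo₃ (m 0) (m 1) (m 2) := by
  ext i
  fin_cases i <;> simp [expo₃]

theorem coeff_germ {n : ℕ} {P : MvPolynomial (Fin 3) ℂ} (hP : P.IsHomogeneous n)
    (d : Fin 2 →₀ ℕ) (k : ℕ) (hk : d 1 + k + d 0 = n) :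
    MvPowerSeries.coeff d (germ P) = MvPolynomial.coeff (expo₃ (d 1) k (d 0)) P := by
  classical
  rw [germ, MvPolynomial.aeval_def, MvPolynomial.eval₂_eq', map_sum]
  have hterm : ∀ m : Fin 3 →₀ ℕ, MvPowerSeries.coeff d
      (algebraMap ℂ Germ (MvPolynomial.coeff m P) * ∏ i, (![gy, 1, gx] : Fin 3 → Germ) i ^ m i)
      = if d 0 = m 2 ∧ d 1 = m 0 then MvPolynomial.coeff m P else 0 := by
    intro m
    have : algebraMap ℂ Germ (MvPolynomial.coeff m P) * ∏ i, (![gy, 1, gx] : Fin 3 → Germ) i ^ m i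
        = MvPolynomial.coeff m P • (gx ^ m 2 * gy ^ m 0) := by
      rw [Fin.prod_univ_three, Algebra.smul_def]
      simp [mul_comm]
    rw [this, map_smul, coeff_gx_gy]
    simp
  simp only [hterm]
  rw [Finset.sum_eq_single (expo₃ (d 1) k (d 0))]
  · rw [if_pos (by simp [expo₃])]
  · intro m hm hne
    rw [if_neg]
    rintro ⟨h1, h2⟩
    refine hne ?_
    have hdeg := hP (MvPolynomial.mem_support_iff.1 hm)
    rw [Finsupp.weight_apply, Finsupp.sum_fintype _ _ (by simp), Fin.sum_univ_three] at hdeg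
    simp only [Pi.one_apply, smul_eq_mul, mul_one] at hdeg
    rw [eq_expo₃ m, ← h1, ← h2]
    congr 1
    omega
  · intro h
    rw [MvPolynomial.notMem_support_iff.1 h, ite_self]

/-- If the double line `x² = 0` is contained in the germ of a curve, the curve contains the
corresponding double line of the plane. -/
theorem X_sq_dvd_of_gx_sq_dvd {n : ℕ} {P : MvPolynomial (Fin 3) ℂ} (hP : P.IsHomogeneous n)
    (h : gx ^ 2 ∣ germ P) : MvPolynomial.X 2 * MvPolynomial.X 2 ∣ P := by
  classical
  rw [MvPowerSeries.X_pow_dvd_iff] at h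
  have hX : (MvPolynomial.X 2 * MvPolynomial.X 2 : MvPolynomial (Fin 3) ℂ)
      = MvPolynomial.monomial (Finsupp.single 2 2) 1 := by
    rw [← pow_two, MvPolynomial.X_pow_eq_monomial]
  rw [hX, MvPolynomial.monomial_one_dvd_iff_modMonomial_eq_zero]
  ext m
  by_cases hm : Finsupp.single 2 2 ≤ m
  · rw [MvPolynomial.coeff_modMonomial_of_le _ hm]
    simp
  · rw [MvPolynomial.coeff_modMonomial_of_not_le _ hm, MvPolynomial.coeff_zero]
    rw [Finsupp.single_le_iff, not_le] at hm
    by_contra hne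
    have hdeg := hP hne
    rw [Finsupp.weight_apply, Finsupp.sum_fintype _ _ (by simp), Fin.sum_univ_three] at hdeg
    simp only [Pi.one_apply, smul_eq_mul, mul_one] at hdeg
    have := coeff_germ hP (expo (m 2) (m 0)) (m 1) (by simpa using hdeg)
    rw [expo_zero, expo_one, ← eq_expo₃ m, h _ (by simpa using hm)] at this
    exact hne this.symm

/-- The germ of a reduced curve is reduced.  The proof compares a hypothetical double factor with
the discriminant, which is a nonzero polynomial in `x`, so that the double factor is a power
of `x`. -/
theorem squarefree_germ {n : ℕ} {P : MvPolynomial (Fin 3) ℂ} (hP : P.IsHomogeneous n)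
    (hsq : Squarefree P) : Squarefree (germ P) := by
  classical
  intro g hg
  set F := MvPolynomial.finSuccEquiv ℂ 2 P with hF
  have hFsq : Squarefree F := by
    intro a ha
    have h := map_dvd (MvPolynomial.finSuccEquiv ℂ 2).symm ha
    rw [map_mul, hF, AlgEquiv.symm_apply_apply] at h
    have := (hsq _ h).map (MvPolynomial.finSuccEquiv ℂ 2)
    rwa [AlgEquiv.apply_symm_apply] at this
  obtain ⟨A, B, r, hr, hAB⟩ := exists_bezout_derivative hFsq
  -- a value `c` of the homogenizing variable at which the discriminant does not vanish
  obtain ⟨z, hz⟩ : ∃ z : Fin 2 → ℂ, MvPolynomial.eval z (r * MvPolynomial.X 0) ≠ 0 := by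
    by_contra! h
    refine mul_ne_zero hr (MvPolynomial.X_ne_zero 0) (MvPolynomial.funext fun z => ?_)
    rw [h z, map_zero]
  rw [map_mul, MvPolynomial.eval_X] at hz
  set c := z 0 with hc
  have hc0 : c ≠ 0 := right_ne_zero_of_mul hz
  let R : Polynomial ℂ := MvPolynomial.aeval ![Polynomial.C c, Polynomial.C c * Polynomial.X] r
  have hR : R ≠ 0 := by
    intro h0
    have h1 : Polynomial.aeval (z 1 / c) R = 0 := by rw [h0, map_zero]
    have h2 : Polynomial.aeval (z 1 / c) R = MvPolynomial.aeval z r := by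
      have : (Polynomial.aeval (z 1 / c)).comp
          (MvPolynomial.aeval ![Polynomial.C c, Polynomial.C c * Polynomial.X])
          = MvPolynomial.aeval z := by
        ext i
        fin_cases i
        · simp [hc]
        · simp [mul_div_cancel₀ _ hc0]
      rw [← this, AlgHom.comp_apply]
    have h3 : MvPolynomial.aeval z r = MvPolynomial.eval z r :=
      congrArg (fun h : _ →+* ℂ => h r) (MvPolynomial.coe_aeval_eq_eval z)
    rw [← h3, ← h2, h1, zero_mul] at hz
    exact hz rfl
  let θ : MvPolynomial (Fin 2) ℂ →ₐ[ℂ] Germ := MvPolynomial.aeval ![algebraMap ℂ Germ c, c • gx]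
  let Θ : Polynomial (MvPolynomial (Fin 2) ℂ) →+* Germ :=
    Polynomial.eval₂RingHom θ.toRingHom (c • gy)
  have hΘC : ∀ a, Θ (Polynomial.C a) = θ a := fun a => Polynomial.eval₂_C _ _
  have hΘX : Θ Polynomial.X = c • gy := Polynomial.eval₂_X _ _
  have hθr : θ r = Polynomial.aeval gx R := by
    have : (Polynomial.aeval gx).comp
        (MvPolynomial.aeval ![Polynomial.C c, Polynomial.C c * Polynomial.X]) = θ := by
      refine MvPolynomial.algHom_ext fun i => ?_
      fin_cases i
      · simp [θ]
      · simp [θ, Algebra.smul_def]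
    rw [← this, AlgHom.comp_apply]
  have hΘF : Θ F = c ^ n • germ P := by
    rw [germ, ← aeval_smul_of_isHomogeneous hP, hF]
    have : Θ.comp (MvPolynomial.finSuccEquiv ℂ 2).toRingEquiv.toRingHom
        = (MvPolynomial.aeval fun i => c • (![gy, 1, gx] : Fin 3 → Germ) i).toRingHom := by
      refine MvPolynomial.ringHom_ext (fun a => ?_) fun i => ?_
      · simp [MvPolynomial.finSuccEquiv_apply, hΘC, θ]
      · refine Fin.cases ?_ (fun j => ?_) i
        · simp [MvPolynomial.finSuccEquiv_X_zero, hΘX]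
        · have e : MvPolynomial.finSuccEquiv ℂ 2 (MvPolynomial.X j.succ)
              = Polynomial.C (MvPolynomial.X j) := MvPolynomial.finSuccEquiv_X_succ
          change Θ (MvPolynomial.finSuccEquiv ℂ 2 (MvPolynomial.X j.succ)) = _
          rw [e, hΘC]
          fin_cases j <;> simp [θ, Algebra.smul_def]
    exact congrArg (fun h : _ →+* Germ => h P) this
  have hθ0 : ∀ a, MvPowerSeries.pderiv ℂ 1 (θ a) = 0 := by
    intro a
    induction a using MvPolynomial.induction_on with
    | C a => simp [θ, MvPowerSeries.algebraMap_apply]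
    | add a b ha hb => rw [map_add, map_add, ha, hb, add_zero]
    | mul_X a i ha =>
      rw [map_mul, Derivation.leibniz, ha]
      fin_cases i
      · simp [θ, MvPowerSeries.algebraMap_apply]
      · simp [θ, MvPowerSeries.pderiv_X_of_ne]
  have hchain : ∀ G, MvPowerSeries.pderiv ℂ 1 (Θ G) = c • Θ G.derivative := by
    intro G
    induction G using Polynomial.induction_on' with
    | add a b ha hb => simp only [map_add, ha, hb, smul_add]
    | monomial k a =>
      rw [Polynomial.derivative_monomial, ← Polynomial.C_mul_X_pow_eq_monomial,
        ← Polynomial.C_mul_X_pow_eq_monomial, Θ.map_mul, Θ.map_mul, Θ.map_pow, Θ.map_pow,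
        hΘX, hΘC, hΘC, Derivation.leibniz, hθ0, smul_zero, add_zero, MvPowerSeries.pderiv_pow,
        Derivation.map_smul, MvPowerSeries.pderiv_X_self, map_mul θ, map_natCast]
      simp only [smul_eq_mul, Algebra.smul_def]
      ring
  have hgF : g ∣ Θ F := by
    rw [hΘF]
    exact ((dvd_mul_right g g).trans hg).trans (dvd_smul_of_dvd _ dvd_rfl)
  have hgF' : g ∣ Θ F.derivative := by
    have h1 : g ∣ c • Θ F.derivative := by
      rw [← hchain]
      obtain ⟨h, hh⟩ : g * g ∣ Θ F := by
        rw [hΘF]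
        exact hg.trans (dvd_smul_of_dvd _ dvd_rfl)
      rw [hh, Derivation.leibniz, Derivation.leibniz]
      simp only [smul_eq_mul]
      exact ⟨g * MvPowerSeries.pderiv ℂ 1 h + 2 * h * MvPowerSeries.pderiv ℂ 1 g, by ring⟩
    have h2 := dvd_smul_of_dvd (c⁻¹) h1
    rwa [smul_smul, inv_mul_cancel₀ hc0, one_smul] at h2
  have hgr : g ∣ θ r := by
    rw [← hΘC, ← hAB, map_add, map_mul, map_mul]
    exact dvd_add (hgF.mul_left _) (hgF'.mul_left _)
  obtain ⟨k, u, hu⟩ := exists_aeval_gx_eq hR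
  rw [hθr, hu, Units.dvd_mul_right, dvd_prime_pow prime_gx] at hgr
  obtain ⟨j, -, hj⟩ := hgr
  rcases Nat.eq_zero_or_pos j with rfl | hj0
  · rw [pow_zero] at hj
    exact associated_one_iff_isUnit.1 hj
  · exfalso
    have hxg : gx ∣ g := (dvd_pow_self gx hj0.ne').trans hj.symm.dvd
    have hx2 : gx ^ 2 ∣ germ P := by
      rw [pow_two]
      exact (mul_dvd_mul hxg hxg).trans hg
    have := hsq _ (X_sq_dvd_of_gx_sq_dvd hP hx2)
    exact (MvPolynomial.X_prime (R := ℂ) (i := (2 : Fin 3))).not_isUnit this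

/-! ### Linear substitutions -/

/-- The linear substitution `F ↦ F ∘ M` on ternary forms. -/
noncomputable def act {K : Type*} [Field K] (M : Matrix (Fin 3) (Fin 3) K) :
    MvPolynomial (Fin 3) K →ₐ[K] MvPolynomial (Fin 3) K :=
  MvPolynomial.aeval fun i => ∑ j, MvPolynomial.C (M i j) * MvPolynomial.X j

section act

variable {K : Type*} [Field K] (M N : Matrix (Fin 3) (Fin 3) K) (F : MvPolynomial (Fin 3) K)

theorem act_X (i : Fin 3) :
    act M (MvPolynomial.X i) = ∑ j, MvPolynomial.C (M i j) * MvPolynomial.X j :=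
  MvPolynomial.aeval_X _ _

theorem act_C (a : K) : act M (MvPolynomial.C a) = MvPolynomial.C a :=
  MvPolynomial.aeval_C _ _

/-- Substitution of elements of an algebra into a transformed form. -/
theorem aeval_act {A : Type*} [CommRing A] [Algebra K A] (z : Fin 3 → A) :
    MvPolynomial.aeval z (act M F) = MvPolynomial.aeval (fun i => ∑ j, M i j • z j) F := by
  have : (MvPolynomial.aeval z).comp (act M) = MvPolynomial.aeval fun i => ∑ j, M i j • z j := by
    refine MvPolynomial.algHom_ext fun i => ?_
    simp [act_X, Algebra.smul_def]
  rw [← this, AlgHom.comp_apply]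

theorem eval_act (v : Fin 3 → K) :
    MvPolynomial.eval v (act M F) = MvPolynomial.eval (M.mulVec v) F := by
  have := aeval_act M F v
  simp only [MvPolynomial.aeval_eq_eval, smul_eq_mul] at this
  exact this

theorem act_act : act M (act N F) = act (N * M) F := by
  conv_lhs => rw [act]
  rw [aeval_act, act]
  congr 2
  funext i
  simp only [Matrix.mul_apply, map_sum, Finset.sum_mul, Finset.smul_sum]
  rw [Finset.sum_comm]
  refine Finset.sum_congr rfl fun j _ => Finset.sum_congr rfl fun k _ => ?_
  rw [MvPolynomial.smul_eq_C_mul, map_mul, mul_assoc]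

theorem act_one : act (1 : Matrix (Fin 3) (Fin 3) K) F = F := by
  have : act (1 : Matrix (Fin 3) (Fin 3) K) = AlgHom.id K _ := by
    refine MvPolynomial.algHom_ext fun i => ?_
    rw [act_X, Finset.sum_eq_single i]
    · simp
    · intro j _ hj
      rw [Matrix.one_apply_ne hj.symm, map_zero, zero_mul]
    · simp
  rw [this, AlgHom.id_apply]

theorem isHomogeneous_act {n : ℕ} {F : MvPolynomial (Fin 3) K} (hF : F.IsHomogeneous n) :
    (act M F).IsHomogeneous n := by
  have := hF.aeval (fun i => ∑ j, MvPolynomial.C (M i j) * MvPolynomial.X j) (n := 1) fun i =>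
    MvPolynomial.IsHomogeneous.sum _ _ _ fun j _ => by
      simpa using (MvPolynomial.isHomogeneous_C (Fin 3) (M i j)).mul
        (MvPolynomial.isHomogeneous_X K j)
  simpa [act] using this

variable {M N}

/-- An invertible substitution, as an automorphism of the ring of polynomials. -/
noncomputable def actEquiv (hMN : M * N = 1) (hNM : N * M = 1) :
    MvPolynomial (Fin 3) K ≃ₐ[K] MvPolynomial (Fin 3) K :=
  AlgEquiv.ofAlgHom (act M) (act N)
    (AlgHom.ext fun F => by rw [AlgHom.comp_apply, act_act, hNM, act_one, AlgHom.id_apply])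
    (AlgHom.ext fun F => by rw [AlgHom.comp_apply, act_act, hMN, act_one, AlgHom.id_apply])

theorem squarefree_act {F : MvPolynomial (Fin 3) K} (hMN : M * N = 1) (hNM : N * M = 1)
    (hF : Squarefree F) : Squarefree (act M F) := by
  intro g hg
  have h := map_dvd (act N) hg
  rw [act_act, hMN, act_one, map_mul] at h
  have h1 := (hF _ h).map (act M)
  rwa [act_act, hNM, act_one] at h1

theorem irreducible_act {F : MvPolynomial (Fin 3) K} (hMN : M * N = 1) (hNM : N * M = 1)
    (hF : Irreducible F) : Irreducible (act M F) :=
  (MulEquiv.irreducible_iff (actEquiv hMN hNM)).2 hF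

end act

/-- The complexification of a real matrix. -/
noncomputable def complexMatrix (M : Matrix (Fin 3) (Fin 3) ℝ) : Matrix (Fin 3) (Fin 3) ℂ :=
  M.map Complex.ofRealHom

theorem complexMatrix_mul (M N : Matrix (Fin 3) (Fin 3) ℝ) :
    complexMatrix (M * N) = complexMatrix M * complexMatrix N :=
  Matrix.map_mul

theorem complexMatrix_one : complexMatrix 1 = 1 :=
  Matrix.map_one _ (map_zero _) (map_one _)

theorem complexify_act (M : Matrix (Fin 3) (Fin 3) ℝ) (F : MvPolynomial (Fin 3) ℝ) :
    complexify (act M F) = act (complexMatrix M) (complexify F) := by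
  have : (MvPolynomial.map Complex.ofRealHom).comp (act M).toRingHom
      = (act (complexMatrix M)).toRingHom.comp (MvPolynomial.map Complex.ofRealHom) := by
    refine MvPolynomial.ringHom_ext (fun a => ?_) fun i => ?_
    · simp [AlgHom.toRingHom_eq_coe]
    · simp [act_X, complexMatrix]
  exact congrArg (fun h : _ →+* MvPolynomial (Fin 3) ℂ => h F) this

theorem conjForm_act (M : Matrix (Fin 3) (Fin 3) ℂ) (Q : MvPolynomial (Fin 3) ℂ) :
    conjForm (act M Q) = act (M.map (starRingEnd ℂ)) (conjForm Q) := by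
  have : (MvPolynomial.map (starRingEnd ℂ)).comp (act M).toRingHom
      = (act (M.map (starRingEnd ℂ))).toRingHom.comp (MvPolynomial.map (starRingEnd ℂ)) := by
    refine MvPolynomial.ringHom_ext (fun a => ?_) fun i => ?_
    · simp
    · simp [act_X]
  exact congrArg (fun h : _ →+* MvPolynomial (Fin 3) ℂ => h Q) this

theorem complexify_injective : Function.Injective complexify :=
  MvPolynomial.map_injective _ Complex.ofReal_injective

theorem complexify_smul (c : ℝ) (F : MvPolynomial (Fin 3) ℝ) :
    complexify (c • F) = (c : ℂ) • complexify F := by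
  rw [complexify, MvPolynomial.smul_eq_C_mul, map_mul, MvPolynomial.map_C,
    MvPolynomial.smul_eq_C_mul]
  rfl

theorem conjForm_complexify (F : MvPolynomial (Fin 3) ℝ) :
    conjForm (complexify F) = complexify F := by
  ext m
  simp [conjForm, complexify, MvPolynomial.coeff_map]

theorem isHomogeneous_complexify {n : ℕ} {F : MvPolynomial (Fin 3) ℝ} (hF : F.IsHomogeneous n) :
    (complexify F).IsHomogeneous n :=
  hF.map _

theorem eval_complexify (F : MvPolynomial (Fin 3) ℝ) (v : Fin 3 → ℝ) :
    MvPolynomial.eval (fun i => (v i : ℂ)) (complexify F) = (MvPolynomial.eval v F : ℝ) := by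
  have := MvPolynomial.map_eval Complex.ofRealHom v F
  exact this.symm

theorem eval_conjForm (Q : MvPolynomial (Fin 3) ℂ) (v : Fin 3 → ℂ) :
    MvPolynomial.eval (star v) (conjForm Q) = star (MvPolynomial.eval v Q) := by
  have := MvPolynomial.map_eval (starRingEnd ℂ) v Q
  exact this.symm

/-! ### Forms at points of the projective plane -/

theorem eval_smul_of_isHomogeneous {n : ℕ} {Q : MvPolynomial (Fin 3) ℂ} (hQ : Q.IsHomogeneous n)
    (c : ℂ) (v : Fin 3 → ℂ) :
    MvPolynomial.eval (c • v) Q = c ^ n * MvPolynomial.eval v Q := by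
  have := aeval_smul_of_isHomogeneous hQ c v
  simp only [MvPolynomial.aeval_eq_eval, smul_eq_mul] at this
  exact this

theorem grad_smul_of_isHomogeneous {n : ℕ} {Q : MvPolynomial (Fin 3) ℂ} (hQ : Q.IsHomogeneous n)
    (c : ℂ) (v : Fin 3 → ℂ) : grad Q (c • v) = c ^ (n - 1) • grad Q v := by
  funext i
  exact eval_smul_of_isHomogeneous hQ.pderiv c v

theorem grad_mul (P Q : MvPolynomial (Fin 3) ℂ) (v : Fin 3 → ℂ) :
    grad (P * Q) v
      = MvPolynomial.eval v P • grad Q v + MvPolynomial.eval v Q • grad P v := by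
  funext i
  simp [grad]

theorem grad_smul (c : ℂ) (Q : MvPolynomial (Fin 3) ℂ) (v : Fin 3 → ℂ) :
    grad (c • Q) v = c • grad Q v := by
  funext i
  simp [grad]

theorem grad_act (M : Matrix (Fin 3) (Fin 3) ℂ) (Q : MvPolynomial (Fin 3) ℂ) (v : Fin 3 → ℂ) :
    grad (act M Q) v = Matrix.vecMul (grad Q (M.mulVec v)) M := by
  funext j
  have key : MvPolynomial.pderiv j (act M Q)
      = ∑ i, MvPolynomial.C (M i j) * act M (MvPolynomial.pderiv i Q) := by
    induction Q using MvPolynomial.induction_on with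
    | C a => simp
    | add p q hp hq => simp only [map_add, hp, hq, mul_add, Finset.sum_add_distrib]
    | mul_X p k hp =>
      have h1 : MvPolynomial.pderiv j (act M (MvPolynomial.X k)) = MvPolynomial.C (M k j) := by
        rw [act_X, map_sum, Finset.sum_eq_single j]
        · simp
        · intro i _ hi
          simp [MvPolynomial.pderiv_X_of_ne hi]
        · simp
      have h2 : ∀ i, MvPolynomial.C (M i j) * act M (MvPolynomial.pderiv i (p * MvPolynomial.X k))
          = MvPolynomial.C (M i j) * (act M p * act M (MvPolynomial.pderiv i (MvPolynomial.X k)))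
            + act M (MvPolynomial.X k) * (MvPolynomial.C (M i j) * act M (MvPolynomial.pderiv i p))
          := fun i => by
        rw [Derivation.leibniz, smul_eq_mul, smul_eq_mul, map_add, map_mul, map_mul]
        ring
      rw [Finset.sum_congr rfl fun i _ => h2 i, Finset.sum_add_distrib, ← Finset.mul_sum, ← hp,
        Finset.sum_eq_single k]
      · rw [map_mul, Derivation.leibniz, h1, MvPolynomial.pderiv_X_self, map_one, smul_eq_mul,
          smul_eq_mul]
        ring
      · intro i _ hi
        rw [MvPolynomial.pderiv_X_of_ne hi.symm, map_zero, mul_zero, mul_zero]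
      · simp
  simp only [grad, key, map_sum, map_mul, MvPolynomial.eval_C, eval_act, Matrix.vecMul,
    dotProduct]
  exact Finset.sum_congr rfl fun i _ => mul_comm _ _

theorem exists_rep_eq_smul (v : Fin 3 → ℂ) (hv : v ≠ 0) :
    ∃ c : ℂ, c ≠ 0 ∧ (Projectivization.mk ℂ v hv).rep = c • v := by
  obtain ⟨a, ha⟩ := Projectivization.exists_smul_eq_mk_rep ℂ v hv
  exact ⟨a, a.ne_zero, ha.symm⟩

theorem mk_mem_curve {n : ℕ} {Q : MvPolynomial (Fin 3) ℂ} (hQ : Q.IsHomogeneous n)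
    {v : Fin 3 → ℂ} (hv : v ≠ 0) :
    Projectivization.mk ℂ v hv ∈ curve Q ↔ MvPolynomial.eval v Q = 0 := by
  obtain ⟨c, hc, h⟩ := exists_rep_eq_smul v hv
  rw [curve, Set.mem_ofPred_eq, h, eval_smul_of_isHomogeneous hQ, mul_eq_zero,
    or_iff_right (pow_ne_zero _ hc)]

theorem mk_mem_singularPoints {n : ℕ} {Q : MvPolynomial (Fin 3) ℂ} (hQ : Q.IsHomogeneous n)
    {v : Fin 3 → ℂ} (hv : v ≠ 0) :
    Projectivization.mk ℂ v hv ∈ singularPoints Q ↔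
      MvPolynomial.eval v Q = 0 ∧ grad Q v = 0 := by
  obtain ⟨c, hc, h⟩ := exists_rep_eq_smul v hv
  rw [singularPoints, Set.mem_ofPred_eq, h, eval_smul_of_isHomogeneous hQ, mul_eq_zero,
    or_iff_right (pow_ne_zero _ hc), grad_smul_of_isHomogeneous hQ, smul_eq_zero,
    or_iff_right (pow_ne_zero _ hc)]

theorem areTangentAt_mk {n : ℕ} {P Q : MvPolynomial (Fin 3) ℂ} (hP : P.IsHomogeneous n)
    (hQ : Q.IsHomogeneous n) {v : Fin 3 → ℂ} (hv : v ≠ 0) :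
    AreTangentAt P Q (Projectivization.mk ℂ v hv) ↔
      MvPolynomial.eval v P = 0 ∧ MvPolynomial.eval v Q = 0 ∧ grad P v ≠ 0 ∧
        ∃ c : ℂ, c ≠ 0 ∧ grad Q v = c • grad P v := by
  rw [AreTangentAt, mk_mem_curve hP, mk_mem_curve hQ]
  obtain ⟨c, hc, h⟩ := exists_rep_eq_smul v hv
  have hc' := pow_ne_zero (n - 1) hc
  rw [h, grad_smul_of_isHomogeneous hQ, grad_smul_of_isHomogeneous hP, Ne, smul_eq_zero,
    or_iff_right hc']
  simp only [smul_comm _ (c ^ (n - 1)), (smul_right_injective (Fin 3 → ℂ) hc').eq_iff]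

theorem mk_eq_mk {v w : Fin 3 → ℂ} (hv : v ≠ 0) (hw : w ≠ 0) :
    Projectivization.mk ℂ v hv = Projectivization.mk ℂ w hw ↔ ∃ c : ℂ, c ≠ 0 ∧ v = c • w := by
  rw [Projectivization.mk_eq_mk_iff]
  constructor
  · rintro ⟨a, ha⟩
    exact ⟨a, a.ne_zero, ha.symm⟩
  · rintro ⟨c, hc, h⟩
    exact ⟨Units.mk0 c hc, h.symm⟩

theorem conjPoint_mk {v : Fin 3 → ℂ} (hv : v ≠ 0) :
    conjPoint (Projectivization.mk ℂ v hv)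
      = Projectivization.mk ℂ (star v) (star_ne_zero.2 hv) := by
  rw [conjPoint, Projectivization.map_mk]
  rfl

theorem conjPoint_conjPoint (p : CP2) : conjPoint (conjPoint p) = p := by
  induction p using Projectivization.ind with
  | h v hv => simp only [conjPoint_mk, star_star]

/-! ### Local equations -/

theorem localEquation_eq_aeval (Q : MvPolynomial (Fin 3) ℂ) (v a b : Fin 3 → ℂ) :
    localEquation Q v a b
      = MvPolynomial.aeval (fun i => v i • (1 : Germ) + a i • gx + b i • gy) Q := by
  have : ((MvPolynomial.coeToMvPowerSeries.algHom ℂ).comp (MvPolynomial.aeval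
      (fun i => MvPolynomial.C (v i) + MvPolynomial.C (a i) * MvPolynomial.X 0
        + MvPolynomial.C (b i) * MvPolynomial.X 1)) : MvPolynomial (Fin 3) ℂ →ₐ[ℂ] Germ)
      = MvPolynomial.aeval (fun i => v i • (1 : Germ) + a i • gx + b i • gy) := by
    refine MvPolynomial.algHom_ext fun i => ?_
    simp [MvPolynomial.coeToMvPowerSeries.algHom_apply, Algebra.smul_def,
      MvPowerSeries.algebraMap_apply]
  rw [← this, AlgHom.comp_apply, MvPolynomial.coeToMvPowerSeries.algHom_apply]
  simp [localEquation]

theorem localEquation_act (M : Matrix (Fin 3) (Fin 3) ℂ) (Q : MvPolynomial (Fin 3) ℂ)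
    (v a b : Fin 3 → ℂ) :
    localEquation (act M Q) v a b
      = localEquation Q (M.mulVec v) (M.mulVec a) (M.mulVec b) := by
  rw [localEquation_eq_aeval, localEquation_eq_aeval, aeval_act]
  congr 2
  funext i
  simp only [Matrix.mulVec, dotProduct, Fin.sum_univ_three, Algebra.smul_def, map_add, map_mul]
  ring

theorem localEquation_smul (c : ℂ) (Q : MvPolynomial (Fin 3) ℂ) (v a b : Fin 3 → ℂ) :
    localEquation (c • Q) v a b = c • localEquation Q v a b := by
  rw [localEquation_eq_aeval, localEquation_eq_aeval, map_smul]

/-- The matrix with the columns `b`, `v`, `a`: the coordinates in which the local equation at `v`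
is the germ at `[0 : 1 : 0]`. -/
def frame (b v a : Fin 3 → ℂ) : Matrix (Fin 3) (Fin 3) ℂ := fun i => ![b i, v i, a i]

theorem germ_act_frame (Q : MvPolynomial (Fin 3) ℂ) (v a b : Fin 3 → ℂ) :
    germ (act (frame b v a) Q) = localEquation Q v a b := by
  rw [localEquation_eq_aeval, germ, aeval_act]
  congr 2
  funext i
  simp only [frame, Fin.sum_univ_three, Matrix.cons_val]
  abel

theorem HasGermType.of_act {M N : Matrix (Fin 3) (Fin 3) ℂ} (hMN : M * N = 1)
    {Q : MvPolynomial (Fin 3) ℂ} {v : Fin 3 → ℂ} {hv : v ≠ 0} (hNv : N.mulVec v ≠ 0)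
    {S : Set Germ} (h : HasGermType Q (Projectivization.mk ℂ v hv) S) :
    HasGermType (act M Q) (Projectivization.mk ℂ (N.mulVec v) hNv) S := by
  obtain ⟨w, a, b, hind, hp, g, hg, he⟩ := h
  have hM : ∀ x, M.mulVec (N.mulVec x) = x := fun x => by
    rw [Matrix.mulVec_mulVec, hMN, Matrix.one_mulVec]
  have hind' : LinearIndependent ℂ ![N.mulVec w, N.mulVec a, N.mulVec b] := by
    have h1 := hind.map' N.mulVecLin (LinearMap.ker_eq_bot.2
      (Function.LeftInverse.injective (g := M.mulVec) hM))
    have h2 : N.mulVecLin ∘ ![w, a, b] = ![N.mulVec w, N.mulVec a, N.mulVec b] := by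
      funext i
      fin_cases i <;> rfl
    rwa [h2] at h1
  refine ⟨_, _, _, hind', ?_, g, hg, ?_⟩
  · obtain ⟨c, hc, hv⟩ := (mk_eq_mk _ (hind.ne_zero 0)).1 hp
    refine (mk_eq_mk _ (hind'.ne_zero 0)).2 ⟨c, hc, ?_⟩
    rw [hv]
    exact Matrix.mulVec_smul _ _ _
  · rwa [localEquation_act, hM, hM, hM]

theorem HasGermType.of_smul {c : ℂ} (hc : c ≠ 0) {Q : MvPolynomial (Fin 3) ℂ} {p : CP2}
    {S : Set Germ} (h : HasGermType Q p S) : HasGermType (c • Q) p S := by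
  obtain ⟨w, a, b, hind, hp, g, hg, φ, u, he⟩ := h
  refine ⟨w, a, b, hind, hp, g, hg, φ, Units.map (algebraMap ℂ Germ) (Units.mk0 c hc) * u, ?_⟩
  rw [localEquation_smul, map_smul, he, Algebra.smul_def, Units.val_mul, mul_assoc]
  rfl

/-! ### Sextics in the coordinates given by a singular point and its conjugate -/

theorem expo₃_zero (i j k : ℕ) : expo₃ i j k 0 = i := by simp [expo₃]

theorem expo₃_one (i j k : ℕ) : expo₃ i j k 1 = j := by simp [expo₃]

theorem expo₃_two (i j k : ℕ) : expo₃ i j k 2 = k := by simp [expo₃]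

theorem constantCoeff_germ (P : MvPolynomial (Fin 3) ℂ) :
    MvPowerSeries.constantCoeff (germ P) = MvPolynomial.eval ![0, 1, 0] P := by
  induction P using MvPolynomial.induction_on with
  | C a => simp [germ, MvPowerSeries.algebraMap_apply]
  | add p q hp hq =>
    rw [germ, map_add, map_add, map_add, ← hp, ← hq]
    rfl
  | mul_X p i hp =>
    rw [germ, map_mul, map_mul, map_mul, ← hp, MvPolynomial.aeval_X, MvPolynomial.eval_X]
    fin_cases i <;> simp [germ]

theorem pderiv_germ_zero (P : MvPolynomial (Fin 3) ℂ) :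
    MvPowerSeries.pderiv ℂ 0 (germ P) = germ (MvPolynomial.pderiv 2 P) := by
  induction P using MvPolynomial.induction_on with
  | C a => simp [germ, MvPowerSeries.algebraMap_apply]
  | add p q hp hq =>
    rw [map_add, germ, germ, map_add, map_add, map_add]
    exact congrArg₂ (· + ·) hp hq
  | mul_X p i hp =>
    rw [Derivation.leibniz, germ, germ, map_add, map_mul, Derivation.leibniz, MvPolynomial.aeval_X]
    change _ • _ + _ • MvPowerSeries.pderiv ℂ 0 (germ p) = _
    rw [hp]
    fin_cases i
    · simp [germ, MvPowerSeries.pderiv_X_of_ne]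
    · simp [germ]
    · simp [germ]

theorem pderiv_germ_one (P : MvPolynomial (Fin 3) ℂ) :
    MvPowerSeries.pderiv ℂ 1 (germ P) = germ (MvPolynomial.pderiv 0 P) := by
  induction P using MvPolynomial.induction_on with
  | C a => simp [germ, MvPowerSeries.algebraMap_apply]
  | add p q hp hq =>
    rw [map_add, germ, germ, map_add, map_add, map_add]
    exact congrArg₂ (· + ·) hp hq
  | mul_X p i hp =>
    rw [Derivation.leibniz, germ, germ, map_add, map_mul, Derivation.leibniz, MvPolynomial.aeval_X]
    change _ • _ + _ • MvPowerSeries.pderiv ℂ 1 (germ p) = _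
    rw [hp]
    fin_cases i
    · simp [germ]
    · simp [germ]
    · simp [germ, MvPowerSeries.pderiv_X_of_ne]

/-- The form is real with respect to the real structure that interchanges the last two
coordinates. -/
def IsConjSymm (P : MvPolynomial (Fin 3) ℂ) : Prop :=
  ∀ i j k, MvPolynomial.coeff (expo₃ k i j) P = star (MvPolynomial.coeff (expo₃ k j i) P)

theorem isConjSymm_act_frame (F : MvPolynomial (Fin 3) ℝ) (r : Fin 3 → ℝ) (o : Fin 3 → ℂ) :
    IsConjSymm (act (frame (fun i => (r i : ℂ)) o (star o)) (complexify F)) := by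
  intro i j k
  set P := act (frame (fun i => (r i : ℂ)) o (star o)) (complexify F) with hP
  have h1 : conjForm P = MvPolynomial.rename (Equiv.swap (1 : Fin 3) 2) P := by
    have h2 : (frame (fun i => (r i : ℂ)) o (star o)).map (starRingEnd ℂ)
        = frame (fun i => (r i : ℂ)) (star o) o := by
      ext i j
      fin_cases j <;> simp [frame]
    rw [hP, conjForm_act, conjForm_complexify, h2]
    have : act (frame (fun i => (r i : ℂ)) (star o) o)
        = (MvPolynomial.rename (Equiv.swap (1 : Fin 3) 2)).comp
          (act (frame (fun i => (r i : ℂ)) o (star o))) := by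
      refine MvPolynomial.algHom_ext fun i => ?_
      have h0 : Equiv.swap (1 : Fin 3) 2 0 = 0 := rfl
      simp only [AlgHom.comp_apply, act_X, map_add, map_mul, MvPolynomial.rename_C,
        MvPolynomial.rename_X, Fin.sum_univ_three, frame, Matrix.cons_val, h0,
        Equiv.swap_apply_left, Equiv.swap_apply_right]
      ring
    rw [this, AlgHom.comp_apply]
  have h3 : (expo₃ k i j).mapDomain (Equiv.swap (1 : Fin 3) 2) = expo₃ k j i := by
    have h0 : Equiv.swap (1 : Fin 3) 2 0 = 0 := rfl
    simp only [expo₃, Finsupp.mapDomain_add, Finsupp.mapDomain_single, h0,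
        Equiv.swap_apply_left, Equiv.swap_apply_right]
    abel
  rw [← MvPolynomial.coeff_rename_mapDomain _ (Equiv.swap (1 : Fin 3) 2).injective, h3, ← h1,
    conjForm, MvPolynomial.coeff_map]
  rfl

theorem coeff_sub_binomials (d : Fin 2 →₀ ℕ) (f : Germ) (a b c e : ℂ) :
    MvPowerSeries.coeff d (f - (a • gx ^ 3 + b • (gx ^ 2 * gy) + c • (gx * gy ^ 2) + e • gy ^ 3))
      = MvPowerSeries.coeff d f - (a * (if d 0 = 3 ∧ d 1 = 0 then 1 else 0)
        + b * (if d 0 = 2 ∧ d 1 = 1 then 1 else 0) + c * (if d 0 = 1 ∧ d 1 = 2 then 1 else 0)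
        + e * (if d 0 = 0 ∧ d 1 = 3 then 1 else 0)) := by
  have h1 : gx ^ 3 = gx ^ 3 * gy ^ 0 := by rw [pow_zero, mul_one]
  have h2 : gy ^ 3 = gx ^ 0 * gy ^ 3 := by rw [pow_zero, one_mul]
  have h3 : gx ^ 2 * gy = gx ^ 2 * gy ^ 1 := by rw [pow_one]
  have h4 : gx * gy ^ 2 = gx ^ 1 * gy ^ 2 := by rw [pow_one]
  rw [h1, h2, h3, h4]
  simp only [map_sub, map_add, map_smul, coeff_gx_gy, smul_eq_mul]

theorem sub_quadratic_mem_Fil {f : Germ} (h : ∀ d : Fin 2 →₀ ℕ, d 0 + d 1 < 2 →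
    MvPowerSeries.coeff d f = 0) :
    f - (MvPowerSeries.coeff (expo 2 0) f • gx ^ 2 + MvPowerSeries.coeff (expo 1 1) f • (gx * gy)
      + MvPowerSeries.coeff (expo 0 2) f • gy ^ 2) ∈ Fil 1 1 3 := by
  intro d hd
  have h1 : gx ^ 2 = gx ^ 2 * gy ^ 0 := by rw [pow_zero, mul_one]
  have h2 : gy ^ 2 = gx ^ 0 * gy ^ 2 := by rw [pow_zero, one_mul]
  have h3 : gx * gy = gx ^ 1 * gy ^ 1 := by rw [pow_one, pow_one]
  rw [h1, h2, h3]
  simp only [map_sub, map_add, map_smul, coeff_gx_gy, smul_eq_mul]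
  obtain ⟨i, hi⟩ : ∃ i, d 0 = i := ⟨_, rfl⟩
  obtain ⟨j, hj⟩ : ∃ j, d 1 = j := ⟨_, rfl⟩
  by_cases hs : d 0 + d 1 < 2
  · rw [h d hs]
    rw [hi, hj] at hs ⊢
    rw [if_neg (by omega), if_neg (by omega), if_neg (by omega)]
    simp
  · rw [eq_expo hi hj]
    simp only [expo_zero, expo_one]
    have : (i = 2 ∧ j = 0) ∨ (i = 1 ∧ j = 1) ∨ (i = 0 ∧ j = 2) := by omega
    rcases this with ⟨rfl, rfl⟩ | ⟨rfl, rfl⟩ | ⟨rfl, rfl⟩ <;> simp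

theorem sub_cubic_mem_Fil {f : Germ} (h : f ∈ Fil 1 1 3) :
    f - (MvPowerSeries.coeff (expo 3 0) f • gx ^ 3
      + MvPowerSeries.coeff (expo 2 1) f • (gx ^ 2 * gy)
      + MvPowerSeries.coeff (expo 1 2) f • (gx * gy ^ 2)
      + MvPowerSeries.coeff (expo 0 3) f • gy ^ 3) ∈ Fil 1 1 4 := by
  intro d hd
  rw [coeff_sub_binomials]
  obtain ⟨i, hi⟩ : ∃ i, d 0 = i := ⟨_, rfl⟩
  obtain ⟨j, hj⟩ : ∃ j, d 1 = j := ⟨_, rfl⟩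
  by_cases hs : 1 * d 0 + 1 * d 1 < 3
  · rw [h d hs]
    rw [hi, hj] at hs ⊢
    rw [if_neg (by omega), if_neg (by omega), if_neg (by omega), if_neg (by omega)]
    simp
  · rw [eq_expo hi hj]
    simp only [expo_zero, expo_one]
    have : (i = 3 ∧ j = 0) ∨ (i = 2 ∧ j = 1) ∨ (i = 1 ∧ j = 2) ∨ (i = 0 ∧ j = 3) := by omega
    rcases this with ⟨rfl, rfl⟩ | ⟨rfl, rfl⟩ | ⟨rfl, rfl⟩ | ⟨rfl, rfl⟩ <;> simp

theorem degree_of_mem_support {n : ℕ} {P : MvPolynomial (Fin 3) ℂ} (hP : P.IsHomogeneous n)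
    {m : Fin 3 →₀ ℕ} (hm : MvPolynomial.coeff m P ≠ 0) : m 0 + m 1 + m 2 = n := by
  have hdeg := hP hm
  rw [Finsupp.weight_apply, Finsupp.sum_fintype _ _ (by simp), Fin.sum_univ_three] at hdeg
  simpa using hdeg

/-- On the line `w = 0` through a triple point and its conjugate, a real sextic is a multiple of
`(uv)³`, which does not vanish if there are no real points. -/
theorem coeff_ne_zero_of_eval_ne_zero {P : MvPolynomial (Fin 3) ℂ} (hP : P.IsHomogeneous 6)
    (hsymm : IsConjSymm P) (hf : germ P ∈ Fil 1 1 3)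
    (hne : MvPolynomial.eval ![0, 1, 1] P ≠ 0) :
    MvPowerSeries.coeff (expo 3 0) (germ P) ≠ 0 := by
  rw [coeff_germ hP _ 3 (by simp), expo_zero, expo_one]
  intro h33
  refine hne ?_
  have hlow : ∀ i j, i + j = 6 → j < 3 → MvPolynomial.coeff (expo₃ 0 i j) P = 0 := by
    intro i j hij hj
    have := coeff_germ hP (expo j 0) i (by simp; omega)
    rw [expo_zero, expo_one] at this
    rw [← this]
    exact hf _ (by simpa using hj)
  have hall : ∀ i j, i + j = 6 → MvPolynomial.coeff (expo₃ 0 i j) P = 0 := by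
    intro i j hij
    rcases lt_trichotomy j 3 with h | h | h
    · exact hlow i j hij h
    · obtain rfl : i = 3 := by omega
      rw [h, h33]
    · rw [hsymm, hlow j i (by omega) (by omega), star_zero]
  rw [MvPolynomial.eval_eq']
  refine Finset.sum_eq_zero fun m hm => ?_
  have hdeg := degree_of_mem_support hP (MvPolynomial.mem_support_iff.1 hm)
  by_cases h0 : m 0 = 0
  · rw [eq_expo₃ m, h0, hall _ _ (by omega), zero_mul]
  · rw [Fin.prod_univ_three]
    simp [h0]

/-- A singular point that is not simple, of a real sextic without real points, is a triple point
whose tangent cone is a triple line. -/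
theorem exists_cube_of_not_isADE {P : MvPolynomial (Fin 3) ℂ} (hP : P.IsHomogeneous 6)
    (hsq : Squarefree P) (hsymm : IsConjSymm P) (hne : MvPolynomial.eval ![0, 1, 1] P ≠ 0)
    (h0 : MvPolynomial.eval ![0, 1, 0] P = 0) (h1 : grad P ![0, 1, 0] = 0)
    (hADE : ¬ IsADE (germ P)) :
    ∃ a : ℂ, a ≠ 0 ∧ ∃ t : ℂ, germ P - a • (gx + t • gy) ^ 3 ∈ Fil 1 1 4 := by
  have hsing : ∀ d : Fin 2 →₀ ℕ, d 0 + d 1 < 2 → MvPowerSeries.coeff d (germ P) = 0 := by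
    intro d hd
    have : (d 0 = 0 ∧ d 1 = 0) ∨ (d 0 = 1 ∧ d 1 = 0) ∨ (d 0 = 0 ∧ d 1 = 1) := by omega
    rcases this with ⟨hi, hj⟩ | ⟨hi, hj⟩ | ⟨hi, hj⟩
    · have : d = 0 := by
        ext k
        fin_cases k
        · exact hi
        · exact hj
      rw [this, MvPowerSeries.coeff_zero_eq_constantCoeff_apply, constantCoeff_germ, h0]
    · have h2 := congrFun h1 2
      rw [grad, ← constantCoeff_germ, ← pderiv_germ_zero,
        ← MvPowerSeries.coeff_zero_eq_constantCoeff_apply, MvPowerSeries.coeff_pderiv] at h2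
      rw [eq_expo hi hj]
      simpa [expo] using h2
    · have h2 := congrFun h1 0
      rw [grad, ← constantCoeff_germ, ← pderiv_germ_one,
        ← MvPowerSeries.coeff_zero_eq_constantCoeff_apply, MvPowerSeries.coeff_pderiv] at h2
      rw [eq_expo hi hj]
      simpa [expo] using h2
  have hsqf := squarefree_germ hP hsq
  have hquad := sub_quadratic_mem_Fil hsing
  have hα : MvPowerSeries.coeff (expo 2 0) (germ P) = 0 := by
    by_contra h
    exact hADE (isADE_of_two_jet (Or.inl h) hsqf hquad)
  have hβ : MvPowerSeries.coeff (expo 1 1) (germ P) = 0 := by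
    by_contra h
    exact hADE (isADE_of_two_jet (Or.inr (Or.inl h)) hsqf hquad)
  have hγ : MvPowerSeries.coeff (expo 0 2) (germ P) = 0 := by
    by_contra h
    exact hADE (isADE_of_two_jet (Or.inr (Or.inr h)) hsqf hquad)
  have h3 : germ P ∈ Fil 1 1 3 := by
    simpa [hα, hβ, hγ] using hquad
  have ha := coeff_ne_zero_of_eval_ne_zero hP hsymm h3 hne
  exact ⟨_, ha, (isADE_or_cube_of_three_jet ha hsqf (sub_cubic_mem_Fil h3)).resolve_left hADE⟩

theorem aeval_mem_Fil {n k : ℕ} {R : MvPolynomial (Fin 3) ℂ} (hR : R.IsHomogeneous n)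
    (hf : germ R ∈ Fil 1 1 k) {x y u : Germ} (hx : x ∈ Fil 1 1 1) (hy : y ∈ Fil 1 1 1) :
    MvPolynomial.aeval ![y, u, x] R ∈ Fil 1 1 k := by
  rw [MvPolynomial.aeval_def, MvPolynomial.eval₂_eq']
  refine Ideal.sum_mem _ fun m hm => Ideal.mul_mem_left _ _ ?_
  have hm' := MvPolynomial.mem_support_iff.1 hm
  have hdeg := degree_of_mem_support hR hm'
  have hle : k ≤ m 0 + m 2 := by
    by_contra! hlt
    have := coeff_germ hR (expo (m 2) (m 0)) (m 1) (by simp; omega)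
    rw [expo_zero, expo_one, ← eq_expo₃ m, hf _ (by simp; omega)] at this
    exact hm' this.symm
  rw [Fin.prod_univ_three]
  have h : y ^ m 0 * x ^ m 2 ∈ Fil 1 1 (m 0 * 1 + m 2 * 1) :=
    mul_mem_Fil (pow_mem_Fil hy _) (pow_mem_Fil hx _)
  have h2 := Ideal.mul_mem_left _ (u ^ m 1) (Fil_anti (p := 1) (q := 1) (k := k) (by omega) h)
  have e : (![y, u, x] : Fin 3 → Germ) 0 ^ m 0 * (![y, u, x] : Fin 3 → Germ) 1 ^ m 1
      * (![y, u, x] : Fin 3 → Germ) 2 ^ m 2 = u ^ m 1 * (y ^ m 0 * x ^ m 2) := by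
    simp only [Matrix.cons_val]
    ring
  rwa [e]

/-- The matrix of the substitution `(w, u, v) ↦ (w, u - s w, v - t w)`. -/
def shiftMatrix (s t : ℂ) : Matrix (Fin 3) (Fin 3) ℂ := !![1, 0, 0; -s, 1, 0; -t, 0, 1]

/-- The shift of the coordinate `v` that makes the cubic part of the germ equal to `a x³`. -/
theorem germ_shift_sub_mem_Fil {P : MvPolynomial (Fin 3) ℂ} (hP : P.IsHomogeneous 6) {a t : ℂ}
    (s : ℂ) (h : germ P - a • (gx + t • gy) ^ 3 ∈ Fil 1 1 4) :
    germ (act (shiftMatrix s t) P) - a • gx ^ 3 ∈ Fil 1 1 4 := by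
  let V : MvPolynomial (Fin 3) ℂ := MvPolynomial.X 2 + MvPolynomial.C t * MvPolynomial.X 0
  have hV : V.IsHomogeneous 1 := by
    refine (MvPolynomial.isHomogeneous_X ℂ 2).add ?_
    simpa using (MvPolynomial.isHomogeneous_C (Fin 3) t).mul (MvPolynomial.isHomogeneous_X ℂ 0)
  let R : MvPolynomial (Fin 3) ℂ := P - MvPolynomial.C a * (V ^ 3 * MvPolynomial.X 1 ^ 3)
  have hR : R.IsHomogeneous 6 := by
    refine hP.sub ?_
    have := (MvPolynomial.isHomogeneous_C (Fin 3) a).mul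
      ((hV.pow 3).mul ((MvPolynomial.isHomogeneous_X ℂ (1 : Fin 3)).pow 3))
    simpa using this
  have hgR : germ R = germ P - a • (gx + t • gy) ^ 3 := by
    simp [R, V, germ, Algebra.smul_def, MvPowerSeries.algebraMap_apply]
  have hPR : P = R + MvPolynomial.C a * (V ^ 3 * MvPolynomial.X 1 ^ 3) := by
    simp [R]
  have hz : (fun i => ∑ j, shiftMatrix s t i j • (![gy, 1, gx] : Fin 3 → Germ) j)
      = ![gy, 1 - s • gy, gx - t • gy] := by
    funext i
    fin_cases i
    · simp [shiftMatrix, Fin.sum_univ_three]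
    · simp [shiftMatrix, Fin.sum_univ_three]
      ring
    · simp [shiftMatrix, Fin.sum_univ_three]
      ring
  have hx1 : gx ∈ Fil 1 1 1 := X0_mem_Fil
  have hy1 : gy ∈ Fil 1 1 1 := X1_mem_Fil
  have hfin : germ (act (shiftMatrix s t) P) - a • gx ^ 3
      = MvPolynomial.aeval ![gy, 1 - s • gy, gx - t • gy] R
        + gx ^ 3 * gy * (a • (-(3 * s) • 1 + (3 * s ^ 2) • gy - s ^ 3 • gy ^ 2)) := by
    rw [germ, aeval_act, hz]
    conv_lhs => rw [hPR]
    have e1 : MvPolynomial.aeval (![gy, 1 - s • gy, gx - t • gy] : Fin 3 → Germ)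
        (MvPolynomial.C a * (V ^ 3 * MvPolynomial.X 1 ^ 3))
        = a • (gx ^ 3 * (1 - s • gy) ^ 3) := by
      simp [V, Algebra.smul_def, MvPowerSeries.algebraMap_apply]
    rw [map_add, e1, add_sub_assoc]
    congr 1
    simp only [Algebra.smul_def, map_mul, map_pow, map_neg, map_ofNat]
    ring
  rw [hfin]
  refine Ideal.add_mem _ (aeval_mem_Fil hR ?_ ?_ hy1) ?_
  · rw [hgR]
    exact h
  · exact Ideal.sub_mem _ hx1 (smul_mem_Fil hy1 _)
  · refine Ideal.mul_mem_right _ _ ?_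
    have := mul_mem_Fil (pow_mem_Fil hx1 3) hy1
    simpa using this

/-- A sextic that is real and sufficiently degenerate at a pair of conjugate points is a cubic
form in `w²` and `uv`. -/
theorem eq_sum_of_germ_mem_Fil {P : MvPolynomial (Fin 3) ℂ} (hP : P.IsHomogeneous 6)
    (hsymm : IsConjSymm P) (hf : germ P ∈ Fil 2 1 6) :
    P = ∑ i ∈ Finset.range 4, MvPolynomial.C (MvPolynomial.coeff (expo₃ (6 - 2 * i) i i) P)
      * (MvPolynomial.X 0 ^ (6 - 2 * i) * (MvPolynomial.X 1 * MvPolynomial.X 2) ^ i) := by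
  classical
  have hlow : ∀ i j k, i + j + k = 6 → j < i → MvPolynomial.coeff (expo₃ k i j) P = 0 := by
    intro i j k hijk hlt
    have := coeff_germ hP (expo j k) i (by simp; omega)
    rw [expo_zero, expo_one] at this
    rw [← this]
    exact hf _ (by simp; omega)
  have hmon : ∀ i, MvPolynomial.C (MvPolynomial.coeff (expo₃ (6 - 2 * i) i i) P)
      * (MvPolynomial.X 0 ^ (6 - 2 * i) * (MvPolynomial.X 1 * MvPolynomial.X 2) ^ i)
      = MvPolynomial.monomial (expo₃ (6 - 2 * i) i i)
        (MvPolynomial.coeff (expo₃ (6 - 2 * i) i i) P) := by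
    intro i
    rw [MvPolynomial.monomial_eq, Finsupp.prod_fintype _ _ (by simp), Fin.prod_univ_three,
      expo₃_zero, expo₃_one, expo₃_two, mul_pow, mul_assoc (MvPolynomial.X 0 ^ _)]
  simp only [hmon]
  ext m
  rw [MvPolynomial.coeff_sum]
  simp only [MvPolynomial.coeff_monomial]
  by_cases hm : MvPolynomial.coeff m P = 0
  · rw [hm]
    refine (Finset.sum_eq_zero fun i _ => ?_).symm
    split_ifs with h
    · rw [h, hm]
    · rfl
  · have hdeg := degree_of_mem_support hP hm
    have h12 : m 1 = m 2 := by
      rcases lt_trichotomy (m 1) (m 2) with h | h | h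
      · refine absurd ?_ hm
        rw [eq_expo₃ m, hsymm, hlow _ _ _ (by omega) h, star_zero]
      · exact h
      · refine absurd ?_ hm
        rw [eq_expo₃ m, hlow _ _ _ (by omega) h]
    have hm' : m = expo₃ (6 - 2 * m 1) (m 1) (m 1) := by
      conv_lhs => rw [eq_expo₃ m, ← h12]
      congr 1
      omega
    rw [Finset.sum_eq_single (m 1)]
    · rw [if_pos hm'.symm, ← hm']
    · intro i _ hi
      rw [if_neg]
      intro h
      apply hi
      rw [← h]
      simp [expo₃]
    · intro h
      rw [Finset.mem_range] at h
      omega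

/-! ### Normal forms of the sextics -/

/-- The conic `z² = s (x² + y²)`.  All these conics are tangent to each other at `[1 : ±i : 0]`. -/
noncomputable def quad (s : ℂ) : MvPolynomial (Fin 3) ℂ :=
  MvPolynomial.X 2 ^ 2 - MvPolynomial.C s * (MvPolynomial.X 0 ^ 2 + MvPolynomial.X 1 ^ 2)

/-- The sextic that consists of the three conics `z² = σᵢ (x² + y²)`. -/
noncomputable def nf (σ : Fin 3 → ℂ) : MvPolynomial (Fin 3) ℂ := ∏ i, quad (σ i)

theorem eval_quad (s : ℂ) (v : Fin 3 → ℂ) :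
    MvPolynomial.eval v (quad s) = v 2 ^ 2 - s * (v 0 ^ 2 + v 1 ^ 2) := by
  simp [quad]

theorem eval_nf (σ : Fin 3 → ℂ) (v : Fin 3 → ℂ) :
    MvPolynomial.eval v (nf σ) = ∏ i, (v 2 ^ 2 - σ i * (v 0 ^ 2 + v 1 ^ 2)) := by
  simp [nf, eval_quad]

/-- The parameters of the normal forms that are real, reduced and have no real points. -/
structure Adm (σ : Fin 3 → ℂ) : Prop where
  injective : Function.Injective σ
  conj : ∀ i, ∃ j, star (σ i) = σ j
  ne_ofReal : ∀ i (r : ℝ), 0 ≤ r → σ i ≠ r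

theorem adm_of_complexify_eq {G : MvPolynomial (Fin 3) ℝ} {c : ℂ} {σ : Fin 3 → ℂ} (hc : c ≠ 0)
    (h : complexify G = MvPolynomial.C c * nf σ) (hsq : Squarefree (complexify G))
    (hG : ∀ v : Fin 3 → ℝ, v ≠ 0 → MvPolynomial.eval v G ≠ 0) : Adm σ where
  injective := by
    intro i j hij
    by_contra hne
    have h1 : quad (σ i) * quad (σ j) ∣ nf σ := by
      rw [nf, ← Finset.prod_pair (f := fun i => quad (σ i)) hne]
      exact Finset.prod_dvd_prod_of_subset _ _ _ (Finset.subset_univ _)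
    rw [← hij] at h1
    have h2 := (hsq _ (by rw [h]; exact h1.mul_left _)).map (MvPolynomial.eval (0 : Fin 3 → ℂ))
    rw [eval_quad] at h2
    simp at h2
  conj := by
    intro i
    obtain ⟨z, hz⟩ := IsAlgClosed.exists_pow_nat_eq (σ i) (n := 2) (by norm_num)
    have h1 : MvPolynomial.eval ![1, 0, z] (complexify G) = 0 := by
      rw [h, map_mul, eval_nf, Finset.prod_eq_zero (Finset.mem_univ i), mul_zero]
      simp [hz]
    have h2 := eval_conjForm (complexify G) ![1, 0, z]
    rw [conjForm_complexify, h1, star_zero, h, map_mul, MvPolynomial.eval_C, mul_eq_zero,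
      or_iff_right hc, eval_nf, Finset.prod_eq_zero_iff] at h2
    obtain ⟨j, -, hj⟩ := h2
    refine ⟨j, ?_⟩
    rw [← hz, star_pow]
    simpa [sub_eq_zero] using hj
  ne_ofReal := by
    intro i r hr hi
    refine hG ![1, 0, √r] (fun h0 => by simpa using congrFun h0 0) ?_
    have h1 := eval_complexify G ![1, 0, √r]
    rw [h, map_mul, eval_nf, Finset.prod_eq_zero (Finset.mem_univ i), mul_zero] at h1
    · exact_mod_cast h1.symm
    · have : ((√r : ℝ) : ℂ) ^ 2 = r := by
        rw [← Complex.ofReal_pow, Real.sq_sqrt hr]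
      simp [hi, this]

/-- The real matrix with the columns `x`, `y`, `r`. -/
def realFrame (x y r : Fin 3 → ℝ) : Matrix (Fin 3) (Fin 3) ℝ := fun i => ![x i, y i, r i]

theorem not_isADE_localEquation {Q : MvPolynomial (Fin 3) ℂ} {o a b : Fin 3 → ℂ} (ho : o ≠ 0)
    (h : ¬ HasGermType Q (Projectivization.mk ℂ o ho) adeNormalForms)
    (hind : LinearIndependent ℂ ![o, a, b]) : ¬ IsADE (localEquation Q o a b) :=
  fun hA => h ⟨o, a, b, hind, rfl, hA⟩

theorem linearIndependent_frame {x y r : Fin 3 → ℝ} (hdet : (realFrame x y r).det ≠ 0) :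
    LinearIndependent ℂ ![fun i => (x i : ℂ) + y i * Complex.I,
      star (fun i => (x i : ℂ) + y i * Complex.I), fun i => (r i : ℂ)] := by
  have h : IsUnit (Matrix.of ![fun i => (x i : ℂ) + y i * Complex.I,
      star (fun i => (x i : ℂ) + y i * Complex.I), fun i => (r i : ℂ)]) := by
    rw [Matrix.isUnit_iff_isUnit_det, isUnit_iff_ne_zero]
    have e : (Matrix.of ![fun i => (x i : ℂ) + y i * Complex.I,
        star (fun i => (x i : ℂ) + y i * Complex.I), fun i => (r i : ℂ)]).det
        = -2 * Complex.I * ((realFrame x y r).det : ℝ) := by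
      rw [Matrix.det_fin_three, Matrix.det_fin_three]
      simp [realFrame]
      ring
    rw [e]
    simp only [ne_eq, mul_eq_zero, Complex.I_ne_zero, or_false, Complex.ofReal_eq_zero, hdet]
    norm_num
  exact Matrix.linearIndependent_rows_iff_isUnit.2 h

theorem realFrame_det_shift (x y r : Fin 3 → ℝ) (a b : ℝ) :
    (realFrame x y fun i => r i - 2 * (a * x i + b * y i)).det = (realFrame x y r).det := by
  rw [Matrix.det_fin_three, Matrix.det_fin_three]
  simp [realFrame]
  ring

/-- The real and the imaginary part of a zero of a real form without real zeros are linearly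
independent, hence a part of a real basis. -/
theorem exists_realFrame {F : MvPolynomial (Fin 3) ℝ} {n : ℕ} (hF : F.IsHomogeneous n)
    (hne : ∀ v : Fin 3 → ℝ, v ≠ 0 → MvPolynomial.eval v F ≠ 0) {x y : Fin 3 → ℝ}
    (ho : (fun i => (x i : ℂ) + y i * Complex.I) ≠ 0)
    (h0 : MvPolynomial.eval (fun i => (x i : ℂ) + y i * Complex.I) (complexify F) = 0) :
    ∃ r : Fin 3 → ℝ, (realFrame x y r).det ≠ 0 := by
  -- a complex multiple of a real vector cannot be a zero of `F`
  have hno : ∀ (v : Fin 3 → ℝ) (c : ℂ), (fun i => (x i : ℂ) + y i * Complex.I)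
      ≠ c • fun i => (v i : ℂ) := by
    intro v c hv
    have hc : c ≠ 0 := by
      rintro rfl
      exact ho (by rw [hv, zero_smul])
    have hv0 : v ≠ 0 := by
      rintro rfl
      exact ho (by rw [hv]; funext i; simp)
    rw [hv, eval_smul_of_isHomogeneous (isHomogeneous_complexify hF), eval_complexify,
      mul_eq_zero, or_iff_right (pow_ne_zero _ hc)] at h0
    exact hne v hv0 (by exact_mod_cast h0)
  have hind : LinearIndependent ℝ ![x, y] := by
    rw [LinearIndependent.pair_iff]
    intro s t hst
    have hst' : ∀ i, (s : ℂ) * x i + t * y i = 0 := fun i => by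
      have := congrFun hst i
      simp only [Pi.add_apply, Pi.smul_apply, smul_eq_mul, Pi.zero_apply] at this
      exact_mod_cast this
    have ht : t = 0 := by
      by_contra ht
      have ht' : (t : ℂ) ≠ 0 := by exact_mod_cast ht
      refine hno x (1 - s / t * Complex.I) (funext fun i => ?_)
      simp only [Pi.smul_apply, smul_eq_mul]
      have : (y i : ℂ) = -(s / t) * x i := by
        field_simp
        linear_combination hst' i
      rw [this]
      ring
    have hs : s = 0 := by
      by_contra hs
      have hs' : (s : ℂ) ≠ 0 := by exact_mod_cast hs
      refine hno y Complex.I (funext fun i => ?_)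
      simp only [Pi.smul_apply, smul_eq_mul]
      have h1 := hst' i
      rw [ht] at h1
      have : (x i : ℂ) = 0 := by simpa [hs] using h1
      rw [this]
      ring
    exact ⟨hs, ht⟩
  rw [← crossProduct_ne_zero_iff_linearIndependent] at hind
  refine ⟨crossProduct x y, fun hdet => hind ?_⟩
  have e : (realFrame x y (crossProduct x y)).det
      = (crossProduct x y 0) ^ 2 + (crossProduct x y 1) ^ 2 + (crossProduct x y 2) ^ 2 := by
    rw [Matrix.det_fin_three]
    simp [realFrame, cross_apply]
    ring
  rw [e] at hdet
  have h2 := sq_nonneg (crossProduct x y 0)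
  have h3 := sq_nonneg (crossProduct x y 1)
  have h4 := sq_nonneg (crossProduct x y 2)
  funext i
  fin_cases i
  · exact pow_eq_zero_iff (two_ne_zero) |>.1 (show crossProduct x y 0 ^ 2 = 0 by linarith)
  · exact pow_eq_zero_iff (two_ne_zero) |>.1 (show crossProduct x y 1 ^ 2 = 0 by linarith)
  · exact pow_eq_zero_iff (two_ne_zero) |>.1 (show crossProduct x y 2 ^ 2 = 0 by linarith)

/-- The substitution that expresses the coordinates adapted to a pair of conjugate points in terms
of real ones. -/
noncomputable def realifyMatrix : Matrix (Fin 3) (Fin 3) ℂ :=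
  !![0, 0, 1; 1 / 2, -Complex.I / 2, 0; 1 / 2, Complex.I / 2, 0]

theorem frame_mul_realifyMatrix (x y r : Fin 3 → ℝ) :
    frame (fun i => (r i : ℂ)) (fun i => (x i : ℂ) + y i * Complex.I)
      (star fun i => (x i : ℂ) + y i * Complex.I) * realifyMatrix
      = complexMatrix (realFrame x y r) := by
  ext i j
  rw [Matrix.mul_apply, Fin.sum_univ_three]
  fin_cases j <;> simp [frame, realifyMatrix, complexMatrix, realFrame]
  · ring
  · linear_combination (-(y i : ℂ)) * Complex.I_sq

theorem frame_mul_shiftMatrix (x y r : Fin 3 → ℝ) (t : ℂ) :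
    frame (fun i => (r i : ℂ)) (fun i => (x i : ℂ) + y i * Complex.I)
      (star fun i => (x i : ℂ) + y i * Complex.I) * shiftMatrix (star t) t
      = frame (fun i => ((r i - 2 * (t.re * x i + t.im * y i) : ℝ) : ℂ))
        (fun i => (x i : ℂ) + y i * Complex.I) (star fun i => (x i : ℂ) + y i * Complex.I) := by
  ext i j
  rw [Matrix.mul_apply, Fin.sum_univ_three]
  fin_cases j <;> simp [frame, shiftMatrix]
  have h1 : (starRingEnd ℂ) t = t.re - t.im * Complex.I := by
    apply Complex.ext <;> simp
  rw [h1]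
  conv_lhs => rw [← Complex.re_add_im t]
  simp only [Complex.add_re, Complex.add_im, Complex.ofReal_re, Complex.ofReal_im, Complex.mul_re,
    Complex.mul_im, Complex.I_re, Complex.I_im]
  push_cast
  linear_combination (2 * (t.im : ℂ) * y i) * Complex.I_sq

/-- Every empty sextic with a singular point that is not simple is, in suitable real coordinates,
a union of three conics of the pencil `z² = s (x² + y²)`. -/
theorem exists_nf {F : MvPolynomial (Fin 3) ℝ} (hF : IsNonSimpleEmptySextic F) :
    ∃ (g : Matrix (Fin 3) (Fin 3) ℝ) (σ : Fin 3 → ℂ) (c : ℝ), g.det ≠ 0 ∧ Adm σ ∧ c ≠ 0 ∧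
      complexify (act g F) = MvPolynomial.C (c : ℂ) * nf σ := by
  obtain ⟨p, hp, hADE⟩ := hF.nonsimple
  have hhom := isHomogeneous_complexify hF.homogeneous
  induction p using Projectivization.ind with
  | h o ho =>
  obtain ⟨x, hx⟩ : ∃ x : Fin 3 → ℝ, x = fun i => (o i).re := ⟨_, rfl⟩
  obtain ⟨y, hy⟩ : ∃ y : Fin 3 → ℝ, y = fun i => (o i).im := ⟨_, rfl⟩
  obtain rfl : o = fun i => (x i : ℂ) + y i * Complex.I := by
    funext i
    rw [hx, hy]
    exact (Complex.re_add_im _).symm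
  clear hx hy
  rw [mk_mem_singularPoints hhom] at hp
  obtain ⟨r, hr⟩ := exists_realFrame hF.homogeneous hF.empty ho hp.1
  obtain ⟨M, hM⟩ : ∃ M : (Fin 3 → ℝ) → Matrix (Fin 3) (Fin 3) ℂ, M = fun r =>
    frame (fun i => (r i : ℂ)) (fun i => (x i : ℂ) + y i * Complex.I)
      (star fun i => (x i : ℂ) + y i * Complex.I) := ⟨_, rfl⟩
  obtain ⟨N, hN⟩ : ∃ N : (Fin 3 → ℝ) → Matrix (Fin 3) (Fin 3) ℂ, N = fun r =>
    realifyMatrix * (complexMatrix (realFrame x y r)⁻¹) := ⟨_, rfl⟩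
  have hMN : ∀ r, (realFrame x y r).det ≠ 0 → M r * N r = 1 := by
    intro r hr
    rw [hM, hN]
    dsimp only
    rw [← Matrix.mul_assoc, frame_mul_realifyMatrix, ← complexMatrix_mul,
      Matrix.mul_nonsing_inv _ (isUnit_iff_ne_zero.2 hr), complexMatrix_one]
  have hMv : ∀ r (a b c : ℂ), (M r).mulVec ![a, b, c] = fun i =>
      a * r i + b * (x i + y i * Complex.I) + c * (x i - y i * Complex.I) := by
    intro r a b c
    funext i
    rw [hM, Matrix.mulVec, dotProduct, Fin.sum_univ_three]
    simp [frame]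
    ring
  -- the properties of the transformed sextic for all choices of the third vector
  have hprop : ∀ r, (realFrame x y r).det ≠ 0 → (act (M r) (complexify F)).IsHomogeneous 6 ∧
      Squarefree (act (M r) (complexify F)) ∧ IsConjSymm (act (M r) (complexify F)) ∧
      MvPolynomial.eval ![0, 1, 1] (act (M r) (complexify F)) ≠ 0 ∧
      MvPolynomial.eval ![1, 0, 0] (act (M r) (complexify F)) ≠ 0 ∧
      ¬ IsADE (germ (act (M r) (complexify F))) := by
    intro r hr
    refine ⟨isHomogeneous_act _ hhom, squarefree_act (hMN r hr)
      (mul_eq_one_comm.1 (hMN r hr)) hF.reduced, ?_, ?_, ?_, ?_⟩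
    · rw [hM]
      exact isConjSymm_act_frame F r _
    · rw [eval_act, hMv]
      have h1 : (fun i => (0 : ℂ) * r i + 1 * (x i + y i * Complex.I)
          + 1 * (x i - y i * Complex.I)) = fun i => ((2 * x i : ℝ) : ℂ) := by
        funext i
        push_cast
        ring
      rw [h1, eval_complexify F fun i => 2 * x i, Complex.ofReal_ne_zero]
      refine hF.empty _ fun h0 => hr ?_
      have h2 : x = 0 := funext fun i => by simpa using congrFun h0 i
      rw [Matrix.det_fin_three]
      simp [realFrame, h2]
    · rw [eval_act, hMv]
      have h1 : (fun i => (1 : ℂ) * r i + 0 * (x i + y i * Complex.I)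
          + 0 * (x i - y i * Complex.I)) = fun i => (r i : ℂ) := by
        funext i
        ring
      rw [h1, eval_complexify, Complex.ofReal_ne_zero]
      refine hF.empty _ fun h0 => hr ?_
      rw [Matrix.det_fin_three]
      simp [realFrame, h0]
    · rw [hM, germ_act_frame]
      exact not_isADE_localEquation ho hADE (linearIndependent_frame hr)
  obtain ⟨h1, h2, h3, h4, -, h6⟩ := hprop r hr
  have hv1 : (M r).mulVec ![0, 1, 0] = fun i => (x i : ℂ) + y i * Complex.I := by
    rw [hMv]
    funext i
    ring
  obtain ⟨a, ha, t, ht⟩ := exists_cube_of_not_isADE h1 h2 h3 h4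
    (by rw [eval_act, hv1, hp.1]) (by rw [grad_act, hv1, hp.2, Matrix.zero_vecMul]) h6
  obtain ⟨r', hr'⟩ : ∃ r' : Fin 3 → ℝ, r' = fun i => r i - 2 * (t.re * x i + t.im * y i) :=
    ⟨_, rfl⟩
  have hdet' : (realFrame x y r').det ≠ 0 := by
    rw [hr', realFrame_det_shift]
    exact hr
  have hshift : M r * shiftMatrix (star t) t = M r' := by
    rw [hM, hr']
    exact frame_mul_shiftMatrix x y r t
  have hcube := germ_shift_sub_mem_Fil h1 (star t) ht
  rw [act_act, hshift] at hcube
  obtain ⟨h1', h2', h3', -, h5', h6'⟩ := hprop r' hdet'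
  have hform := eq_sum_of_germ_mem_Fil h1' h3'
    ((isADE_or_mem_Fil_of_cube ha hcube).resolve_left h6')
  obtain ⟨k, hk⟩ : ∃ k : ℕ → ℂ, k = fun i =>
    MvPolynomial.coeff (expo₃ (6 - 2 * i) i i) (act (M r') (complexify F)) := ⟨_, rfl⟩
  have heval : ∀ v, MvPolynomial.eval v (act (M r') (complexify F)) = k 0 * v 0 ^ 6
      + k 1 * (v 0 ^ 4 * (v 1 * v 2)) + k 2 * (v 0 ^ 2 * (v 1 * v 2) ^ 2)
      + k 3 * (v 1 * v 2) ^ 3 := by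
    intro v
    rw [hform, hk]
    simp [Finset.sum_range_succ]
  have hk0 : k 0 ≠ 0 := by
    rw [heval] at h5'
    simpa using h5'
  have hk0' : ((k 0).re : ℂ) = k 0 := by
    rw [← Complex.conj_eq_iff_re]
    have := h3' 0 0 6
    rw [hk]
    exact this.symm
  obtain ⟨t₀, t₁, t₂, e₁, e₂, e₃⟩ := exists_roots_cubic (k 1 / k 0) (k 2 / k 0) (k 3 / k 0)
  rw [div_eq_iff hk0] at e₁ e₂ e₃
  have hmain : complexify (act (realFrame x y r') F)
      = MvPolynomial.C ((k 0).re : ℂ) * nf ![t₀ / 4, t₁ / 4, t₂ / 4] := by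
    refine MvPolynomial.funext fun v => ?_
    rw [complexify_act, ← frame_mul_realifyMatrix]
    have hM' : frame (fun i => (r' i : ℂ)) (fun i => (x i : ℂ) + y i * Complex.I)
      (star fun i => (x i : ℂ) + y i * Complex.I) = M r' := by rw [hM]
    rw [hM', ← act_act, eval_act, heval, map_mul, eval_nf, MvPolynomial.eval_C, hk0',
      Fin.prod_univ_three]
    have hw : realifyMatrix.mulVec v 0 = v 2 := by
      simp [realifyMatrix, Matrix.mulVec, dotProduct, Fin.sum_univ_three]
    have huv : realifyMatrix.mulVec v 1 * realifyMatrix.mulVec v 2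
        = (v 0 ^ 2 + v 1 ^ 2) / 4 := by
      simp [realifyMatrix, Matrix.mulVec, dotProduct, Fin.sum_univ_three]
      linear_combination (-(v 1 ^ 2) / 4) * Complex.I_sq
    rw [hw, huv, e₁, e₂, e₃]
    simp only [Matrix.cons_val]
    ring
  refine ⟨realFrame x y r', _, (k 0).re, hdet', ?_, ?_, hmain⟩
  · have hgdet := isUnit_iff_ne_zero.2 hdet'
    have hgh := Matrix.mul_nonsing_inv _ hgdet
    have hhg := Matrix.nonsing_inv_mul _ hgdet
    refine adm_of_complexify_eq (by rwa [hk0']) hmain ?_ fun v hv => ?_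
    · rw [complexify_act]
      exact squarefree_act (by rw [← complexMatrix_mul, hgh, complexMatrix_one])
        (by rw [← complexMatrix_mul, hhg, complexMatrix_one]) hF.reduced
    · rw [eval_act]
      refine hF.empty _ fun h0 => hv ?_
      have := congrArg (Matrix.mulVec (realFrame x y r')⁻¹) h0
      rwa [Matrix.mulVec_mulVec, hhg, Matrix.one_mulVec, Matrix.mulVec_zero] at this
  · intro h0
    rw [h0, Complex.ofReal_zero] at hk0'
    exact hk0 hk0'.symm

/-! ### The conics of the normal forms -/

theorem aeval_quad {A : Type*} [CommRing A] [Algebra ℂ A] (s : ℂ) (z : Fin 3 → A) :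
    MvPolynomial.aeval z (quad s) = z 2 ^ 2 - s • (z 0 ^ 2 + z 1 ^ 2) := by
  simp [quad, Algebra.smul_def]

theorem grad_quad (s : ℂ) (v : Fin 3 → ℂ) :
    grad (quad s) v = ![-(2 * s * v 0), -(2 * s * v 1), 2 * v 2] := by
  funext i
  fin_cases i <;> simp [grad, quad] <;> ring

theorem conjForm_quad (s : ℂ) : conjForm (quad s) = quad (star s) := by
  simp [conjForm, quad]

theorem isHomogeneous_quad (s : ℂ) : (quad s).IsHomogeneous 2 := by
  have hX : ∀ i : Fin 3, (MvPolynomial.X i ^ 2 : MvPolynomial (Fin 3) ℂ).IsHomogeneous 2 :=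
    fun i => by simpa using (MvPolynomial.isHomogeneous_X ℂ i).pow 2
  refine (hX 2).sub ?_
  simpa using (MvPolynomial.isHomogeneous_C (Fin 3) s).mul ((hX 0).add (hX 1))

theorem isHomogeneous_nf (σ : Fin 3 → ℂ) : (nf σ).IsHomogeneous 6 := by
  have := MvPolynomial.IsHomogeneous.prod Finset.univ (fun i => quad (σ i)) (fun _ => 2)
    fun i _ => isHomogeneous_quad (σ i)
  simpa [nf] using this

theorem irreducible_quad {s : ℂ} (hs : s ≠ 0) : Irreducible (quad s) := by
  -- in the coordinates `z`, `x + iy`, `x - iy` the equation is linear in the last one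
  have h1 : act !![0, 1 / 2, 1 / 2; 0, -Complex.I / 2, Complex.I / 2; 1, 0, 0] (quad s)
      = MvPolynomial.C (-s) * MvPolynomial.X 1 * MvPolynomial.X 2 + MvPolynomial.X 0 ^ 2 := by
    refine MvPolynomial.funext fun v => ?_
    rw [eval_act, eval_quad]
    simp [Matrix.mulVec, dotProduct, Fin.sum_univ_three]
    linear_combination (-s * (v 2 - v 1) ^ 2 / 4) * Complex.I_sq
  have hs' : (MvPolynomial.C (-s) : MvPolynomial (Fin 3) ℂ) ≠ 0 := by
    simpa using hs
  have hu : IsUnit (MvPolynomial.C (-s) : MvPolynomial (Fin 3) ℂ) :=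
    (neg_ne_zero.2 hs).isUnit.map MvPolynomial.C
  have h2 : Irreducible (MvPolynomial.C (-s) * MvPolynomial.X 1 * MvPolynomial.X 2
      + MvPolynomial.X 0 ^ 2 : MvPolynomial (Fin 3) ℂ) := by
    refine MvPolynomial.irreducible_mul_X_add _ _ _ (mul_ne_zero hs' (MvPolynomial.X_ne_zero 1))
      ?_ ?_ ?_
    · rw [MvPolynomial.vars_C_mul _ (neg_ne_zero.2 hs)]
      simp
    · rw [MvPolynomial.X_pow_eq_monomial, MvPolynomial.vars_monomial one_ne_zero]
      simp
    · have hp : Irreducible (MvPolynomial.C (-s) * MvPolynomial.X 1 : MvPolynomial (Fin 3) ℂ) :=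
        (irreducible_isUnit_mul hu).2 (MvPolynomial.X_prime (i := (1 : Fin 3))).irreducible
      rw [hp.isRelPrime_iff_not_dvd]
      rintro ⟨k, hk⟩
      have := congrArg (MvPolynomial.eval ![1, 0, 0]) hk
      simp at this
  rw [← h1] at h2
  have hinv : (!![0, 1 / 2, 1 / 2; 0, -Complex.I / 2, Complex.I / 2; 1, 0, 0] :
      Matrix (Fin 3) (Fin 3) ℂ) * !![0, 0, 1; 1, Complex.I, 0; 1, -Complex.I, 0] = 1 := by
    ext i j
    rw [Matrix.mul_apply, Fin.sum_univ_three]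
    fin_cases i <;> fin_cases j <;> simp
    · norm_num
    · ring
    · linear_combination (-1 : ℂ) * Complex.I_sq
  have h3 := irreducible_act (mul_eq_one_comm.1 hinv) hinv h2
  rwa [act_act, hinv, act_one] at h3

theorem eq_of_quad_dvd {s s' : ℂ} (h : quad s ∣ quad s') : s = s' := by
  obtain ⟨k, hk⟩ := h
  obtain ⟨z, hz⟩ := IsAlgClosed.exists_pow_nat_eq s (n := 2) (by norm_num)
  have := congrArg (MvPolynomial.eval ![1, 0, z]) hk
  rw [map_mul, eval_quad, eval_quad] at this
  simpa [hz, sub_eq_zero] using this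

theorem isConic_quad {s : ℂ} (hs : s ≠ 0) : IsConic (quad s) :=
  ⟨isHomogeneous_quad s, irreducible_quad hs⟩

theorem Adm.ne_zero {σ : Fin 3 → ℂ} (hσ : Adm σ) (i : Fin 3) : σ i ≠ 0 := by
  simpa using hσ.ne_ofReal i 0 le_rfl

theorem nf_eq_mul (σ : Fin 3 → ℂ) : nf σ = quad (σ 0) * quad (σ 1) * quad (σ 2) :=
  Fin.prod_univ_three _

theorem squarefree_nf {σ : Fin 3 → ℂ} (hσ : Adm σ) : Squarefree (nf σ) := by
  have hirr := fun i => irreducible_quad (hσ.ne_zero i)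
  have hrel : ∀ i j, i ≠ j → IsRelPrime (quad (σ i)) (quad (σ j)) := fun i j hij => by
    rw [(hirr i).isRelPrime_iff_not_dvd]
    exact fun h => hij (hσ.injective (eq_of_quad_dvd h))
  rw [nf_eq_mul, squarefree_mul_iff, squarefree_mul_iff]
  exact ⟨IsRelPrime.mul_left (hrel 0 2 (by decide)) (hrel 1 2 (by decide)),
    ⟨hrel 0 1 (by decide), (hirr 0).squarefree, (hirr 1).squarefree⟩, (hirr 2).squarefree⟩

theorem conjForm_nf {σ : Fin 3 → ℂ} (hσ : Adm σ) : conjForm (nf σ) = nf σ := by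
  choose f hf using hσ.conj
  have hinj : Function.Injective f := fun i j hij => hσ.injective (star_injective (by
    rw [hf, hf, hij]))
  have h1 : conjForm (nf σ) = ∏ i, quad (σ (f i)) := by
    rw [nf, conjForm, map_prod]
    refine Finset.prod_congr rfl fun i _ => ?_
    rw [← hf]
    exact conjForm_quad _
  rw [h1, nf]
  exact Fintype.prod_bijective f (Finite.injective_iff_bijective.1 hinj) _ _ fun i => rfl

/-- The coefficientwise real part of a form. -/
noncomputable def realForm (Q : MvPolynomial (Fin 3) ℂ) : MvPolynomial (Fin 3) ℝ :=
  ∑ m ∈ Q.support, MvPolynomial.monomial m (MvPolynomial.coeff m Q).re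

theorem coeff_realForm (Q : MvPolynomial (Fin 3) ℂ) (m : Fin 3 →₀ ℕ) :
    MvPolynomial.coeff m (realForm Q) = (MvPolynomial.coeff m Q).re := by
  classical
  rw [realForm, MvPolynomial.coeff_sum]
  simp only [MvPolynomial.coeff_monomial]
  rw [Finset.sum_ite_eq' Q.support m]
  split_ifs with h
  · rfl
  · rw [MvPolynomial.notMem_support_iff.1 h, Complex.zero_re]

theorem complexify_realForm {Q : MvPolynomial (Fin 3) ℂ} (hQ : conjForm Q = Q) :
    complexify (realForm Q) = Q := by
  ext m
  rw [complexify, MvPolynomial.coeff_map, coeff_realForm]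
  have := congrArg (MvPolynomial.coeff m) hQ
  rw [conjForm, MvPolynomial.coeff_map] at this
  exact Complex.conj_eq_iff_re.1 this

theorem isHomogeneous_of_complexify {F : MvPolynomial (Fin 3) ℝ} {n : ℕ}
    (h : (complexify F).IsHomogeneous n) : F.IsHomogeneous n := by
  intro m hm
  refine h (d := m) ?_
  rw [complexify, MvPolynomial.coeff_map]
  exact Complex.ofReal_ne_zero.2 hm

theorem complexify_realForm_nf {σ : Fin 3 → ℂ} (hσ : Adm σ) :
    complexify (realForm (nf σ)) = nf σ :=
  complexify_realForm (conjForm_nf hσ)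

theorem isReducedSextic_nf {σ : Fin 3 → ℂ} (hσ : Adm σ) :
    IsReducedSextic (realForm (nf σ)) where
  homogeneous := isHomogeneous_of_complexify
    (by rw [complexify_realForm_nf hσ]; exact isHomogeneous_nf σ)
  reduced := by
    rw [complexify_realForm_nf hσ]
    exact squarefree_nf hσ

/-- The common points of the conics `z² = s (x² + y²)` are `[1 : ε : 0]`, where `ε² = -1`. -/
theorem base_ne_zero (ε : ℂ) : (![1, ε, 0] : Fin 3 → ℂ) ≠ 0 := fun h => by
  simpa using congrFun h 0

theorem star_base : star (![1, Complex.I, 0] : Fin 3 → ℂ) = ![1, -Complex.I, 0] := by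
  funext i
  fin_cases i <;> simp

theorem mk_base_ne :
    Projectivization.mk ℂ ![1, -Complex.I, 0] (base_ne_zero _)
      ≠ Projectivization.mk ℂ ![1, Complex.I, 0] (base_ne_zero _) := by
  rw [Ne, mk_eq_mk]
  rintro ⟨c, -, h⟩
  have h0 := congrFun h 0
  have h1 := congrFun h 1
  simp only [Matrix.cons_val, Pi.smul_apply, smul_eq_mul, mul_one] at h0 h1
  rw [← h0, one_mul, neg_eq_iff_add_eq_zero, ← two_mul] at h1
  simp at h1

theorem areTangentAt_quad {s s' ε : ℂ} (hε : ε ^ 2 = -1) (hs : s ≠ 0) (hs' : s' ≠ 0) :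
    AreTangentAt (quad s) (quad s') (Projectivization.mk ℂ ![1, ε, 0] (base_ne_zero ε)) := by
  rw [areTangentAt_mk (isHomogeneous_quad s) (isHomogeneous_quad s'), eval_quad, eval_quad,
    grad_quad, grad_quad]
  refine ⟨by simp [hε], by simp [hε], fun h => ?_, s' / s, div_ne_zero hs' hs, ?_⟩
  · have := congrFun h 0
    simp [hs] at this
  · funext i
    fin_cases i
    · simp
      field_simp
    · simp
      field_simp
    · simp

theorem eq_zero_of_eval_quad {s s' : ℂ} (hs : s ≠ s') {w : Fin 3 → ℂ}
    (h : MvPolynomial.eval w (quad s) = 0) (h' : MvPolynomial.eval w (quad s') = 0) :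
    w 0 ^ 2 + w 1 ^ 2 = 0 ∧ w 2 = 0 := by
  rw [eval_quad] at h h'
  have hD : w 0 ^ 2 + w 1 ^ 2 = 0 :=
    (mul_eq_zero.1 (show (s - s') * (w 0 ^ 2 + w 1 ^ 2) = 0 by
      linear_combination h' - h)).resolve_left (sub_ne_zero.2 hs)
  refine ⟨hD, ?_⟩
  rw [hD, mul_zero, sub_zero] at h
  exact (pow_eq_zero_iff two_ne_zero).1 h

theorem mk_eq_base {w : Fin 3 → ℂ} (hw : w ≠ 0) (hD : w 0 ^ 2 + w 1 ^ 2 = 0) (hz : w 2 = 0) :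
    Projectivization.mk ℂ w hw = Projectivization.mk ℂ ![1, Complex.I, 0] (base_ne_zero _) ∨
      Projectivization.mk ℂ w hw = Projectivization.mk ℂ ![1, -Complex.I, 0] (base_ne_zero _) := by
  rw [mk_eq_mk, mk_eq_mk]
  have hfac : (w 1 - Complex.I * w 0) * (w 1 + Complex.I * w 0) = 0 := by
    linear_combination hD - w 0 ^ 2 * Complex.I_sq
  have hw0 : w 0 ≠ 0 := by
    intro h
    refine hw (funext fun l => ?_)
    rw [h] at hD
    fin_cases l
    · exact h
    · simpa using hD
    · exact hz
  rcases mul_eq_zero.1 hfac with h | h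
  · refine Or.inl ⟨w 0, hw0, funext fun l => ?_⟩
    fin_cases l
    · simp
    · simp
      linear_combination h
    · simpa using hz
  · refine Or.inr ⟨w 0, hw0, funext fun l => ?_⟩
    fin_cases l
    · simp
    · simp
      linear_combination h
    · simpa using hz

theorem singularPoints_nf {σ : Fin 3 → ℂ} (hσ : Adm σ) : singularPoints (nf σ) =
    {Projectivization.mk ℂ ![1, Complex.I, 0] (base_ne_zero _),
      Projectivization.mk ℂ ![1, -Complex.I, 0] (base_ne_zero _)} := by
  ext p
  induction p using Projectivization.ind with
  | h w hw =>
  have hgrad : grad (nf σ) w = (MvPolynomial.eval w (quad (σ 0))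
      * MvPolynomial.eval w (quad (σ 1))) • grad (quad (σ 2)) w
      + (MvPolynomial.eval w (quad (σ 0)) * MvPolynomial.eval w (quad (σ 2))) •
        grad (quad (σ 1)) w
      + (MvPolynomial.eval w (quad (σ 1)) * MvPolynomial.eval w (quad (σ 2))) •
        grad (quad (σ 0)) w := by
    rw [nf_eq_mul, grad_mul, grad_mul, map_mul]
    module
  rw [mk_mem_singularPoints (isHomogeneous_nf σ), Set.mem_insert_iff, Set.mem_singleton_iff,
    mk_eq_mk, mk_eq_mk]
  constructor
  · rintro ⟨h0, h1⟩
    -- a singular point lies on two of the conics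
    have key : ∀ i j k, i ≠ j → i ≠ k → MvPolynomial.eval w (quad (σ i)) = 0 →
        (MvPolynomial.eval w (quad (σ j)) * MvPolynomial.eval w (quad (σ k))) •
          grad (quad (σ i)) w = 0 → w 0 ^ 2 + w 1 ^ 2 = 0 ∧ w 2 = 0 := by
      intro i j k hij hik hi hg
      have htwo : ∀ l, i ≠ l → MvPolynomial.eval w (quad (σ l)) = 0 →
          w 0 ^ 2 + w 1 ^ 2 = 0 ∧ w 2 = 0 := fun l hil hl =>
        eq_zero_of_eval_quad (fun h => hil (hσ.injective h)) hi hl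
      rcases smul_eq_zero.1 hg with h | h
      · rcases mul_eq_zero.1 h with h | h
        · exact htwo j hij h
        · exact htwo k hik h
      · refine absurd (funext fun l => ?_) hw
        rw [grad_quad] at h
        have hs := hσ.ne_zero i
        have e0 := congrFun h 0
        have e1 := congrFun h 1
        have e2 := congrFun h 2
        simp [hs] at e0 e1 e2
        fin_cases l
        · exact e0
        · exact e1
        · exact e2
    rw [hgrad] at h1
    have hDz : w 0 ^ 2 + w 1 ^ 2 = 0 ∧ w 2 = 0 := by
      rw [nf_eq_mul, map_mul, map_mul, mul_eq_zero, mul_eq_zero] at h0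
      rcases h0 with (h0 | h0) | h0 <;> rw [h0] at h1
      · exact key 0 1 2 (by decide) (by decide) h0 (by simpa using h1)
      · exact key 1 0 2 (by decide) (by decide) h0 (by simpa using h1)
      · exact key 2 0 1 (by decide) (by decide) h0 (by simpa using h1)
    have h := mk_eq_base hw hDz.1 hDz.2
    rwa [mk_eq_mk, mk_eq_mk] at h
  · have hbase : ∀ ε c : ℂ, ε ^ 2 = -1 → w = c • ![1, ε, 0] →
        MvPolynomial.eval w (nf σ) = 0 ∧ grad (nf σ) w = 0 := by
      intro ε c hε hwc
      have h0 : ∀ i, MvPolynomial.eval w (quad (σ i)) = 0 := fun i => by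
        rw [eval_quad, hwc]
        simp
        right
        linear_combination c ^ 2 * hε
      rw [hgrad, nf_eq_mul, map_mul, h0, h0, mul_zero]
      simp [h0]
    rintro (⟨c, -, h⟩ | ⟨c, -, h⟩)
    · exact hbase _ c Complex.I_sq h
    · exact hbase _ c (by rw [neg_sq, Complex.I_sq]) h

theorem hasGermType_j10_nf {σ : Fin 3 → ℂ} (hσ : Adm σ) {ε : ℂ} (hε : ε ^ 2 = -1) :
    HasGermType (nf σ) (Projectivization.mk ℂ ![1, ε, 0] (base_ne_zero ε)) j10NormalForms := by
  have hε0 : ε ≠ 0 := by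
    rintro rfl
    norm_num at hε
  have hind : LinearIndependent ℂ ![![1, ε, 0], ![1, -ε, 0], ![0, 0, 1]] := by
    have : IsUnit (Matrix.of ![![1, ε, 0], ![1, -ε, 0], ![0, 0, 1]]) := by
      rw [Matrix.isUnit_iff_isUnit_det, isUnit_iff_ne_zero, Matrix.det_fin_three]
      simp
      intro h
      apply hε0
      linear_combination (-1 / 2 : ℂ) * h
    exact Matrix.linearIndependent_rows_iff_isUnit.2 this
  refine ⟨_, _, _, hind, rfl, ?_⟩
  have hμ : ∀ i j, i ≠ j → (4 * σ i)⁻¹ ≠ (4 * σ j)⁻¹ := fun i j hij h =>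
    hij (hσ.injective (mul_left_cancel₀ (by norm_num : (4 : ℂ) ≠ 0) (inv_injective h)))
  have h0 := hσ.ne_zero
  obtain ⟨g, hg, he⟩ := exists_j10 (c := -(4 * σ 0) * (4 * σ 1) * (4 * σ 2))
    (by simp [h0]) (hμ 0 1 (by decide)) (hμ 0 2 (by decide)) (hμ 1 2 (by decide))
  refine ⟨g, hg, ?_⟩
  convert he using 1
  rw [localEquation_eq_aeval, nf_eq_mul, map_mul, map_mul]
  have hq : ∀ i, MvPolynomial.aeval (fun l => (![1, ε, 0] : Fin 3 → ℂ) l • (1 : Germ)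
      + (![1, -ε, 0] : Fin 3 → ℂ) l • gx + (![0, 0, 1] : Fin 3 → ℂ) l • gy) (quad (σ i))
      = (-(4 * σ i)) • (gx - (4 * σ i)⁻¹ • gy ^ 2) := by
    intro i
    have h4 : (4 * σ i) * (4 * σ i)⁻¹ = 1 := mul_inv_cancel₀ (by simp [h0])
    rw [aeval_quad]
    simp only [Matrix.cons_val, zero_smul, one_smul, add_zero, zero_add]
    rw [smul_sub, smul_smul, neg_mul, h4]
    have e1 : (1 + gx) ^ 2 + (ε • (1 : Germ) + -ε • gx) ^ 2
        = (4 : ℂ) • gx + (ε ^ 2 + 1) • (1 - gx) ^ 2 := by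
      algebra
    rw [e1, hε]
    algebra
  rw [hq, hq, hq]
  algebra

theorem not_hasGermType_ade_nf (σ : Fin 3 → ℂ) :
    ¬ HasGermType (nf σ) (Projectivization.mk ℂ ![1, Complex.I, 0] (base_ne_zero _))
      adeNormalForms := by
  rintro ⟨v, a, b, hind, hp, hADE⟩
  obtain ⟨c, -, hv⟩ := (mk_eq_mk (hind.ne_zero 0) (base_ne_zero _)).1 hp.symm
  change v = _ at hv
  obtain ⟨z, hz⟩ : ∃ z : Fin 3 → Germ, z = fun i => v i • (1 : Germ) + a i • gx + b i • gy :=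
    ⟨_, rfl⟩
  have hcz : ∀ i, MvPowerSeries.constantCoeff (z i) = v i := fun i => by
    rw [hz]
    simp [Algebra.smul_def, MvPowerSeries.algebraMap_apply]
  have hℓ : z 0 ^ 2 + z 1 ^ 2 ∈ maxIdeal := by
    rw [mem_maxIdeal, map_add, map_pow, map_pow, hcz, hcz, hv]
    simp
    linear_combination c ^ 2 * Complex.I_sq
  have hz2 : z 2 ∈ maxIdeal := by
    rw [mem_maxIdeal, hcz, hv]
    simp
  have hq : ∀ i, MvPolynomial.aeval z (quad (σ i)) ∈ nearIdeal (z 0 ^ 2 + z 1 ^ 2) := fun i => by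
    rw [aeval_quad, Algebra.smul_def]
    refine Ideal.sub_mem _ (Ideal.mem_sup_right (Ideal.pow_mem_pow hz2 2))
      (Ideal.mul_mem_left _ _ (Ideal.mem_sup_left (Ideal.mem_span_singleton_self _)))
  refine not_isADE_of_mem_nearIdeal_pow hℓ ?_ hADE
  rw [localEquation_eq_aeval, ← hz, nf_eq_mul, map_mul, map_mul, pow_succ, pow_two]
  exact Ideal.mul_mem_mul (Ideal.mul_mem_mul (hq 0) (hq 1)) (hq 2)

theorem isNonSimpleEmptySextic_nf {σ : Fin 3 → ℂ} (hσ : Adm σ) :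
    IsNonSimpleEmptySextic (realForm (nf σ)) where
  toIsReducedSextic := isReducedSextic_nf hσ
  empty := by
    intro v hv h0
    have h1 := eval_complexify (realForm (nf σ)) v
    rw [h0, complexify_realForm_nf hσ, eval_nf, Complex.ofReal_zero,
      Finset.prod_eq_zero_iff] at h1
    obtain ⟨i, -, hi⟩ := h1
    have hi' : (((v 2) ^ 2 : ℝ) : ℂ) = σ i * ((v 0 ^ 2 + v 1 ^ 2 : ℝ) : ℂ) := by
      push_cast
      linear_combination hi
    by_cases hD : v 0 ^ 2 + v 1 ^ 2 = 0
    · rw [hD, Complex.ofReal_zero, mul_zero] at hi'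
      have hz : v 2 = 0 := by
        have : v 2 ^ 2 = 0 := by exact_mod_cast hi'
        simpa using this
      have hx : v 0 = 0 := by nlinarith [sq_nonneg (v 0), sq_nonneg (v 1)]
      have hy : v 1 = 0 := by nlinarith [sq_nonneg (v 0), sq_nonneg (v 1)]
      refine hv (funext fun l => ?_)
      fin_cases l
      · exact hx
      · exact hy
      · exact hz
    · refine hσ.ne_ofReal i (v 2 ^ 2 / (v 0 ^ 2 + v 1 ^ 2)) (by positivity) ?_
      have hD' : ((v 0 ^ 2 + v 1 ^ 2 : ℝ) : ℂ) ≠ 0 := Complex.ofReal_ne_zero.2 hD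
      rw [Complex.ofReal_div, hi', mul_div_cancel_right₀ _ hD']
  nonsimple := by
    rw [complexify_realForm_nf hσ]
    refine ⟨_, ?_, not_hasGermType_ade_nf σ⟩
    rw [singularPoints_nf hσ]
    exact Set.mem_insert _ _

theorem splitsIntoTangentConics_nf {σ : Fin 3 → ℂ} (hσ : Adm σ) :
    SplitsIntoTangentConics (realForm (nf σ)) (fun i => quad (σ i))
      (Projectivization.mk ℂ ![1, Complex.I, 0] (base_ne_zero _)) := by
  have hI : (-Complex.I) ^ 2 = -1 := by rw [neg_sq, Complex.I_sq]
  have hconj : conjPoint (Projectivization.mk ℂ ![1, Complex.I, 0] (base_ne_zero _))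
      = Projectivization.mk ℂ ![1, -Complex.I, 0] (base_ne_zero _) := by
    rw [conjPoint_mk]
    simp only [star_base]
  refine ⟨?_, fun i => isConic_quad (hσ.ne_zero i), ?_, fun i j _ => ?_, ?_, ?_, ?_⟩
  · rw [complexify_realForm_nf hσ, nf_eq_mul]
  · rw [hconj]
    exact mk_base_ne
  · rw [hconj]
    exact ⟨areTangentAt_quad Complex.I_sq (hσ.ne_zero i) (hσ.ne_zero j),
      areTangentAt_quad hI (hσ.ne_zero i) (hσ.ne_zero j)⟩
  · rw [complexify_realForm_nf hσ, hconj, singularPoints_nf hσ]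
  · rw [complexify_realForm_nf hσ]
    exact hasGermType_j10_nf hσ Complex.I_sq
  · rw [complexify_realForm_nf hσ, hconj]
    exact hasGermType_j10_nf hσ hI

/-! ### Invariance under real projective transformations -/

section transfer

variable {K : Type*} [Field K] {M N : Matrix (Fin 3) (Fin 3) K}

theorem mulVec_mulVec_of_mul_eq_one (h : M * N = 1) (v : Fin 3 → K) :
    M.mulVec (N.mulVec v) = v := by
  rw [Matrix.mulVec_mulVec, h, Matrix.one_mulVec]

theorem mulVec_ne_zero (h : M * N = 1) {v : Fin 3 → K} (hv : v ≠ 0) : N.mulVec v ≠ 0 := by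
  intro h0
  have := mulVec_mulVec_of_mul_eq_one h v
  rw [h0, Matrix.mulVec_zero] at this
  exact hv this.symm

theorem vecMul_eq_zero_iff (h : M * N = 1) {v : Fin 3 → K} : Matrix.vecMul v M = 0 ↔ v = 0 := by
  refine ⟨fun h0 => ?_, fun h0 => by rw [h0, Matrix.zero_vecMul]⟩
  have := congrArg (fun w => Matrix.vecMul w N) h0
  simpa [Matrix.vecMul_vecMul, h] using this

end transfer

theorem complexMatrix_mul_eq_one {M N : Matrix (Fin 3) (Fin 3) ℝ} (h : M * N = 1) :
    complexMatrix M * complexMatrix N = 1 := by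
  rw [← complexMatrix_mul, h, complexMatrix_one]

theorem star_complexMatrix_mulVec (M : Matrix (Fin 3) (Fin 3) ℝ) (v : Fin 3 → ℂ) :
    star ((complexMatrix M).mulVec v) = (complexMatrix M).mulVec (star v) := by
  funext i
  simp [Matrix.mulVec, dotProduct, complexMatrix]

theorem conjForm_act_complexMatrix (M : Matrix (Fin 3) (Fin 3) ℝ) (Q : MvPolynomial (Fin 3) ℂ) :
    conjForm (act (complexMatrix M) Q) = act (complexMatrix M) (conjForm Q) := by
  rw [conjForm_act]
  congr 2
  ext i j
  simp [complexMatrix]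

theorem conjForm_smul (c : ℂ) (Q : MvPolynomial (Fin 3) ℂ) :
    conjForm (c • Q) = star c • conjForm Q := by
  rw [conjForm, MvPolynomial.smul_eq_C_mul, map_mul, MvPolynomial.map_C,
    MvPolynomial.smul_eq_C_mul]
  rfl

theorem isReducedSextic_act {M N : Matrix (Fin 3) (Fin 3) ℝ} (hMN : M * N = 1)
    {F : MvPolynomial (Fin 3) ℝ} (hF : IsReducedSextic F) : IsReducedSextic (act M F) where
  homogeneous := isHomogeneous_act M hF.homogeneous
  reduced := by
    rw [complexify_act]
    exact squarefree_act (complexMatrix_mul_eq_one hMN)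
      (complexMatrix_mul_eq_one (mul_eq_one_comm.1 hMN)) hF.reduced

theorem mk_mem_singularPoints_act {M N : Matrix (Fin 3) (Fin 3) ℂ} (hMN : M * N = 1)
    {Q : MvPolynomial (Fin 3) ℂ} {n : ℕ} (hQ : Q.IsHomogeneous n) {v : Fin 3 → ℂ} (hv : v ≠ 0) :
    Projectivization.mk ℂ v hv ∈ singularPoints (act M Q) ↔
      Projectivization.mk ℂ (M.mulVec v) (mulVec_ne_zero (mul_eq_one_comm.1 hMN) hv)
        ∈ singularPoints Q := by
  rw [mk_mem_singularPoints (isHomogeneous_act M hQ), mk_mem_singularPoints hQ, eval_act,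
    grad_act, vecMul_eq_zero_iff hMN]

theorem isNonSimpleEmptySextic_act {M N : Matrix (Fin 3) (Fin 3) ℝ} (hMN : M * N = 1)
    {F : MvPolynomial (Fin 3) ℝ} (hF : IsNonSimpleEmptySextic F) :
    IsNonSimpleEmptySextic (act M F) where
  toIsReducedSextic := isReducedSextic_act hMN hF.toIsReducedSextic
  empty := fun v hv => by
    rw [eval_act]
    exact hF.empty _ (mulVec_ne_zero (mul_eq_one_comm.1 hMN) hv)
  nonsimple := by
    obtain ⟨p, hp, hADE⟩ := hF.nonsimple
    have hMN' := complexMatrix_mul_eq_one hMN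
    have hNM' := complexMatrix_mul_eq_one (mul_eq_one_comm.1 hMN)
    induction p using Projectivization.ind with
    | h v hv =>
    have hback := mulVec_mulVec_of_mul_eq_one hMN' v
    rw [complexify_act]
    refine ⟨Projectivization.mk ℂ _ (mulVec_ne_zero hMN' hv), ?_, fun h => hADE ?_⟩
    · rw [mk_mem_singularPoints_act hMN' (isHomogeneous_complexify hF.homogeneous)]
      simp only [hback]
      exact hp
    · have h1 := h.of_act hNM' (mulVec_ne_zero hNM' (mulVec_ne_zero hMN' hv))
      rw [act_act, hMN', act_one] at h1
      simpa only [hback] using h1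

theorem singularPoints_smul {c : ℂ} (hc : c ≠ 0) (Q : MvPolynomial (Fin 3) ℂ) :
    singularPoints (c • Q) = singularPoints Q := by
  ext p
  simp only [singularPoints, Set.mem_ofPred_eq, grad_smul, MvPolynomial.smul_eval, mul_eq_zero,
    smul_eq_zero, hc, false_or]

theorem curve_smul {c : ℂ} (hc : c ≠ 0) (Q : MvPolynomial (Fin 3) ℂ) :
    curve (c • Q) = curve Q := by
  ext p
  simp only [curve, Set.mem_ofPred_eq, MvPolynomial.smul_eval, mul_eq_zero, hc, false_or]

theorem isNonSimpleEmptySextic_smul {c : ℝ} (hc : c ≠ 0)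
    {F : MvPolynomial (Fin 3) ℝ} (hF : IsNonSimpleEmptySextic F) :
    IsNonSimpleEmptySextic (c • F) where
  homogeneous := by
    have := (MvPolynomial.isHomogeneous_C (Fin 3) c).mul hF.homogeneous
    rwa [← MvPolynomial.smul_eq_C_mul, zero_add] at this
  reduced := by
    have hu : IsUnit (MvPolynomial.C (c : ℂ) : MvPolynomial (Fin 3) ℂ) :=
      (Complex.ofReal_ne_zero.2 hc).isUnit.map MvPolynomial.C
    rw [complexify_smul, MvPolynomial.smul_eq_C_mul]
    exact fun a ha => hF.reduced a (hu.dvd_mul_left.1 ha)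
  empty := fun v hv => by
    rw [MvPolynomial.smul_eval]
    exact mul_ne_zero hc (hF.empty v hv)
  nonsimple := by
    have hc' : (c : ℂ) ≠ 0 := Complex.ofReal_ne_zero.2 hc
    obtain ⟨p, hp, hADE⟩ := hF.nonsimple
    rw [complexify_smul]
    refine ⟨p, by rwa [singularPoints_smul hc'], fun h => hADE ?_⟩
    have h1 := h.of_smul (inv_ne_zero hc')
    rwa [smul_smul, inv_mul_cancel₀ hc', one_smul] at h1

/-- The splitting into conics is carried along by real projective transformations. -/
theorem SplitsIntoTangentConics.transfer {F G : MvPolynomial (Fin 3) ℝ}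
    {M N : Matrix (Fin 3) (Fin 3) ℝ} (hMN : M * N = 1) {d : ℝ} (hd : d ≠ 0)
    (hG6 : G.IsHomogeneous 6) (h : complexify F = ((d : ℂ) ^ 3) • act (complexMatrix M) (complexify G))
    {Q : Fin 3 → MvPolynomial (Fin 3) ℂ} {v : Fin 3 → ℂ} {hv : v ≠ 0}
    (hG : SplitsIntoTangentConics G Q (Projectivization.mk ℂ v hv)) :
    SplitsIntoTangentConics F (fun i => (d : ℂ) • act (complexMatrix M) (Q i))
      (Projectivization.mk ℂ ((complexMatrix N).mulVec v)
        (mulVec_ne_zero (complexMatrix_mul_eq_one hMN) hv)) := by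
  have hMN' := complexMatrix_mul_eq_one hMN
  have hNM' := complexMatrix_mul_eq_one (mul_eq_one_comm.1 hMN)
  have hd' : (d : ℂ) ≠ 0 := Complex.ofReal_ne_zero.2 hd
  have hd3 := pow_ne_zero 3 hd'
  have hu : IsUnit (MvPolynomial.C (d : ℂ) : MvPolynomial (Fin 3) ℂ) :=
    hd'.isUnit.map MvPolynomial.C
  have hconj : conjPoint (Projectivization.mk ℂ ((complexMatrix N).mulVec v)
      (mulVec_ne_zero hMN' hv)) = Projectivization.mk ℂ ((complexMatrix N).mulVec (star v))
        (mulVec_ne_zero hMN' (star_ne_zero.2 hv)) := by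
    rw [conjPoint_mk]
    simp only [star_complexMatrix_mulVec]
  have hmk : ∀ (w w' : Fin 3 → ℂ) (hw : w ≠ 0) (hw' : w' ≠ 0),
      Projectivization.mk ℂ w hw = Projectivization.mk ℂ ((complexMatrix N).mulVec w')
        (mulVec_ne_zero hMN' hw') ↔ Projectivization.mk ℂ ((complexMatrix M).mulVec w)
          (mulVec_ne_zero hNM' hw) = Projectivization.mk ℂ w' hw' := by
    intro w w' hw hw'
    rw [mk_eq_mk, mk_eq_mk]
    refine exists_congr fun c => and_congr_right fun _ => ⟨fun e => ?_, fun e => ?_⟩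
    · rw [e, Matrix.mulVec_smul, mulVec_mulVec_of_mul_eq_one hMN']
    · rw [← mulVec_mulVec_of_mul_eq_one hNM' w, e, Matrix.mulVec_smul]
  have htan : ∀ i j w (hw : w ≠ 0), AreTangentAt (Q i) (Q j) (Projectivization.mk ℂ w hw) →
      AreTangentAt ((d : ℂ) • act (complexMatrix M) (Q i)) ((d : ℂ) • act (complexMatrix M) (Q j))
        (Projectivization.mk ℂ ((complexMatrix N).mulVec w) (mulVec_ne_zero hMN' hw)) := by
    intro i j w hw ht
    have hhom : ∀ i, ((d : ℂ) • act (complexMatrix M) (Q i)).IsHomogeneous 2 := fun i => by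
      have := (MvPolynomial.isHomogeneous_C (Fin 3) (d : ℂ)).mul
        (isHomogeneous_act (complexMatrix M) (hG.conic i).1)
      rwa [← MvPolynomial.smul_eq_C_mul, zero_add] at this
    rw [areTangentAt_mk (hG.conic i).1 (hG.conic j).1] at ht
    rw [areTangentAt_mk (hhom i) (hhom j)]
    simp only [MvPolynomial.smul_eval, eval_act, grad_smul, grad_act,
      mulVec_mulVec_of_mul_eq_one hMN']
    obtain ⟨e1, e2, e3, c, hc, e4⟩ := ht
    refine ⟨by rw [e1, mul_zero], by rw [e2, mul_zero], ?_, c, hc, ?_⟩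
    · rw [Ne, smul_eq_zero, vecMul_eq_zero_iff hMN']
      exact not_or.2 ⟨hd', e3⟩
    · rw [e4, Matrix.smul_vecMul, smul_comm]
  refine ⟨?_, fun i => ⟨?_, ?_⟩, ?_, fun i j hij => ?_, ?_, ?_, ?_⟩
  · rw [h, hG.eq_prod, map_mul, map_mul]
    simp only [MvPolynomial.smul_eq_C_mul, map_pow]
    ring
  · have := (MvPolynomial.isHomogeneous_C (Fin 3) (d : ℂ)).mul
      (isHomogeneous_act (complexMatrix M) (hG.conic i).1)
    rwa [← MvPolynomial.smul_eq_C_mul, zero_add] at this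
  · rw [MvPolynomial.smul_eq_C_mul, irreducible_isUnit_mul hu]
    exact irreducible_act hMN' hNM' (hG.conic i).2
  · intro he
    rw [hconj, hmk _ _ _ hv] at he
    refine hG.nonreal ?_
    rw [conjPoint_mk, ← he]
    simp only [mulVec_mulVec_of_mul_eq_one hMN']
  · rw [hconj]
    have := hG.tangent i j hij
    rw [conjPoint_mk] at this
    exact ⟨htan i j _ _ this.1, htan i j _ _ this.2⟩
  · ext p
    induction p using Projectivization.ind with
    | h w hw =>
    rw [h, singularPoints_smul hd3, mk_mem_singularPoints_act hMN' (isHomogeneous_complexify hG6),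
      hG.singular, hconj, Set.mem_insert_iff, Set.mem_singleton_iff, Set.mem_insert_iff,
      Set.mem_singleton_iff, hmk, hmk, conjPoint_mk]
  · rw [h]
    exact (hG.j10.of_act hMN' _).of_smul hd3
  · have h1 := hG.j10_conj
    rw [conjPoint_mk] at h1
    rw [h, hconj]
    exact (h1.of_act hMN' _).of_smul hd3

theorem exists_cube_root (c : ℝ) : ∃ d : ℝ, d ^ 3 = c := by
  rcases le_total 0 c with hc | hc
  · exact ⟨c ^ ((3 : ℕ) : ℝ)⁻¹, Real.rpow_inv_natCast_pow hc (by norm_num)⟩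
  · refine ⟨-((-c) ^ ((3 : ℕ) : ℝ)⁻¹), ?_⟩
    rw [Odd.neg_pow (by decide), Real.rpow_inv_natCast_pow (by linarith) (by norm_num), neg_neg]

theorem adm_comp {σ : Fin 3 → ℂ} (hσ : Adm σ) (e : Equiv.Perm (Fin 3)) : Adm (σ ∘ e) where
  injective := hσ.injective.comp e.injective
  conj := fun i => by
    obtain ⟨j, hj⟩ := hσ.conj (e i)
    exact ⟨e.symm j, by simpa using hj⟩
  ne_ofReal := fun i => hσ.ne_ofReal (e i)

theorem nf_comp (σ : Fin 3 → ℂ) (e : Equiv.Perm (Fin 3)) : nf (σ ∘ e) = nf σ :=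
  Equiv.prod_comp e fun i => quad (σ i)

/-- An involution of three elements is trivial or a transposition. -/
theorem involution_fin_three : ∀ f : Fin 3 → Fin 3, (∀ i, f (f i) = i) →
    (∀ i, f i = i) ∨ ∃ e : Equiv.Perm (Fin 3), f (e 0) = e 0 ∧ f (e 1) = e 2 ∧ f (e 1) ≠ e 1 := by
  decide

theorem Adm.all_real_or_one_real {σ : Fin 3 → ℂ} (hσ : Adm σ) : (∀ i, star (σ i) = σ i) ∨
    ∃ e : Equiv.Perm (Fin 3), star (σ (e 0)) = σ (e 0) ∧ star (σ (e 1)) = σ (e 2) ∧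
      star (σ (e 1)) ≠ σ (e 1) := by
  choose f hf using hσ.conj
  have hff : ∀ i, f (f i) = i := fun i => hσ.injective (by rw [← hf, ← hf, star_star])
  rcases involution_fin_three f hff with h | ⟨e, h0, h1, h2⟩
  · exact Or.inl fun i => by rw [hf, h]
  · refine Or.inr ⟨e, by rw [hf, h0], by rw [hf, h1], ?_⟩
    rw [hf]
    exact fun h => h2 (hσ.injective h)

theorem smul_act_complexMatrix_injective {M N : Matrix (Fin 3) (Fin 3) ℝ} (hMN : M * N = 1)
    {d : ℝ} (hd : d ≠ 0) :
    Function.Injective fun Q => (d : ℂ) • act (complexMatrix M) Q := by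
  intro P Q h
  have h1 := smul_right_injective _ (Complex.ofReal_ne_zero.2 hd) h
  have h2 := congrArg (act (complexMatrix N)) h1
  rwa [act_act, act_act, complexMatrix_mul_eq_one hMN, act_one, act_one] at h2

/-- The sextics that are projectively equivalent to a given normal form. -/
structure HasNormalForm (F : MvPolynomial (Fin 3) ℝ) (σ : Fin 3 → ℂ) : Prop where
  adm : Adm σ
  exists_eq : ∃ (M N : Matrix (Fin 3) (Fin 3) ℝ) (d : ℝ), M * N = 1 ∧ d ≠ 0 ∧
    F = (d ^ 3) • act M (realForm (nf σ))

theorem exists_hasNormalForm {F : MvPolynomial (Fin 3) ℝ} (hF : IsNonSimpleEmptySextic F) :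
    ∃ σ, HasNormalForm F σ := by
  obtain ⟨g, σ, c, hg, hσ, hc, h⟩ := exists_nf hF
  obtain ⟨d, rfl⟩ := exists_cube_root c
  have hg' := isUnit_iff_ne_zero.2 hg
  refine ⟨σ, hσ, g⁻¹, g, d, Matrix.nonsing_inv_mul _ hg', fun h0 => hc (by simp [h0]), ?_⟩
  have h1 : act g F = (d ^ 3) • realForm (nf σ) := complexify_injective (by
    rw [h, complexify_smul, complexify_realForm_nf hσ, MvPolynomial.smul_eq_C_mul])
  rw [← map_smul, ← h1, act_act, Matrix.mul_nonsing_inv _ hg', act_one]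

theorem HasNormalForm.comp {F : MvPolynomial (Fin 3) ℝ} {σ : Fin 3 → ℂ} (h : HasNormalForm F σ)
    (e : Equiv.Perm (Fin 3)) : HasNormalForm F (σ ∘ e) where
  adm := adm_comp h.adm e
  exists_eq := by
    rw [nf_comp]
    exact h.exists_eq

theorem HasNormalForm.splits {F : MvPolynomial (Fin 3) ℝ} {σ : Fin 3 → ℂ}
    (h : HasNormalForm F σ) : ∃ Q O, SplitsIntoTangentConics F Q O ∧
      (∀ i j, star (σ i) = σ j → conjForm (Q i) = Q j) ∧
      (∀ i, star (σ i) ≠ σ i → conjForm (Q i) ≠ Q i) := by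
  obtain ⟨M, N, d, hMN, hd, hF⟩ := h.exists_eq
  have hcF : complexify F
      = ((d : ℂ) ^ 3) • act (complexMatrix M) (complexify (realForm (nf σ))) := by
    rw [hF, complexify_smul, complexify_act, Complex.ofReal_pow]
  have hQ : ∀ i, conjForm ((d : ℂ) • act (complexMatrix M) (quad (σ i)))
      = (d : ℂ) • act (complexMatrix M) (quad (star (σ i))) := fun i => by
    rw [conjForm_smul, conjForm_act_complexMatrix, conjForm_quad]
    congr 1
    exact Complex.conj_ofReal d
  refine ⟨_, _, (splitsIntoTangentConics_nf h.adm).transfer hMN hd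
    (isReducedSextic_nf h.adm).homogeneous hcF, fun i j hij => ?_, fun i hi he => hi ?_⟩
  · rw [hQ, hij]
  · rw [hQ] at he
    exact eq_of_quad_dvd (smul_act_complexMatrix_injective hMN hd he).dvd

/-- A splitting into real conics is incompatible with a nonreal parameter of the normal form,
because the irreducible factors are unique. -/
theorem HasNormalForm.star_eq_of_hasThreeRealConics {F : MvPolynomial (Fin 3) ℝ} {σ : Fin 3 → ℂ}
    (h : HasNormalForm F σ) (h3 : HasThreeRealConics F) (i : Fin 3) : star (σ i) = σ i := by
  obtain ⟨M, N, d, hMN, hd, hF⟩ := h.exists_eq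
  obtain ⟨Q, O, hQ, hreal⟩ := h3
  have hMN' := complexMatrix_mul_eq_one hMN
  have hNM' := complexMatrix_mul_eq_one (mul_eq_one_comm.1 hMN)
  have hprod : ((d ^ 3 : ℝ) : ℂ) • nf σ = act (complexMatrix N) (Q 0) * act (complexMatrix N) (Q 1)
      * act (complexMatrix N) (Q 2) := by
    rw [← map_mul, ← map_mul, ← hQ.eq_prod, hF, complexify_smul, complexify_act,
      complexify_realForm_nf h.adm, map_smul, act_act, hMN', act_one]
  have hprime := (irreducible_quad (h.adm.ne_zero i)).prime
  have hdvd : quad (σ i) ∣ act (complexMatrix N) (Q 0) * act (complexMatrix N) (Q 1)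
      * act (complexMatrix N) (Q 2) := by
    rw [← hprod]
    exact dvd_smul_of_dvd _ (Finset.dvd_prod_of_mem _ (Finset.mem_univ i))
  obtain ⟨k, hk⟩ : ∃ k, quad (σ i) ∣ act (complexMatrix N) (Q k) := by
    rcases hprime.dvd_or_dvd hdvd with h1 | h1
    · rcases hprime.dvd_or_dvd h1 with h1 | h1
      · exact ⟨0, h1⟩
      · exact ⟨1, h1⟩
    · exact ⟨2, h1⟩
  have hassoc := (irreducible_quad (h.adm.ne_zero i)).associated_of_dvd
    (irreducible_act hNM' hMN' (hQ.conic k).2) hk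
  have hk' : quad (star (σ i)) ∣ act (complexMatrix N) (Q k) := by
    have h1 := map_dvd (MvPolynomial.map (σ := Fin 3) (starRingEnd ℂ)) hk
    change conjForm _ ∣ conjForm _ at h1
    rwa [conjForm_quad, conjForm_act_complexMatrix, hreal k] at h1
  exact eq_of_quad_dvd (hassoc.dvd_iff_dvd_right.2 hk')

theorem HasNormalForm.hasThreeRealConics_iff {F : MvPolynomial (Fin 3) ℝ} {σ : Fin 3 → ℂ}
    (h : HasNormalForm F σ) : HasThreeRealConics F ↔ ∀ i, star (σ i) = σ i := by
  refine ⟨h.star_eq_of_hasThreeRealConics, fun hr => ?_⟩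
  obtain ⟨Q, O, hQ, h1, -⟩ := h.splits
  exact ⟨Q, O, hQ, fun i => h1 i i (hr i)⟩

theorem exists_splitting {F : MvPolynomial (Fin 3) ℝ} (hF : IsNonSimpleEmptySextic F) :
    ∃ Q O, SplitsIntoTangentConics F Q O ∧ (AllConicsReal Q ∨ OneConicReal Q) := by
  obtain ⟨σ, hσ⟩ := exists_hasNormalForm hF
  rcases hσ.adm.all_real_or_one_real with h | ⟨e, h0, h1, h2⟩
  · obtain ⟨Q, O, hQ, hc, -⟩ := hσ.splits
    exact ⟨Q, O, hQ, Or.inl fun i => hc i i (h i)⟩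
  · obtain ⟨Q, O, hQ, hc, hn⟩ := (hσ.comp e).splits
    exact ⟨Q, O, hQ, Or.inr ⟨hc 0 0 h0, hc 1 2 h1, hn 1 h2⟩⟩

/-! ### Isotopies of the projective plane -/

/-- The projection of the punctured space to the projective plane. -/
noncomputable def proj (v : {v : Fin 3 → ℂ // v ≠ 0}) : CP2 := Projectivization.mk ℂ v.1 v.2

theorem isOpenQuotientMap_proj : IsOpenQuotientMap proj where
  surjective p := by
    induction p using Projectivization.ind with
    | h v hv => exact ⟨⟨v, hv⟩, rfl⟩
  continuous := continuous_quotient_mk'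
  isOpenMap := by
    intro U hU
    have h1 : IsOpen (proj ⁻¹' (proj '' U)) := by
      have h2 : proj ⁻¹' (proj '' U) = ⋃ c : ℂˣ,
          (fun v : {v : Fin 3 → ℂ // v ≠ 0} =>
            (⟨(c : ℂ) • v.1, smul_ne_zero c.ne_zero v.2⟩ : {v : Fin 3 → ℂ // v ≠ 0})) ⁻¹' U := by
        ext v
        simp only [Set.mem_preimage, Set.mem_image, Set.mem_iUnion]
        constructor
        · rintro ⟨w, hw, h⟩
          obtain ⟨c, hc, e⟩ := (mk_eq_mk w.2 v.2).1 h
          refine ⟨Units.mk0 c hc, ?_⟩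
          convert hw using 1
          exact Subtype.ext e.symm
        · rintro ⟨c, hc⟩
          exact ⟨_, hc, (mk_eq_mk _ v.2).2 ⟨c, c.ne_zero, rfl⟩⟩
      rw [h2]
      refine isOpen_iUnion fun c => hU.preimage ?_
      exact (continuous_subtype_val.const_smul (c : ℂ)).subtype_mk _
    exact h1

theorem isClosed_curve {Q : MvPolynomial (Fin 3) ℂ} {n : ℕ} (hQ : Q.IsHomogeneous n) :
    IsClosed (curve Q) := by
  rw [← isOpenQuotientMap_proj.isQuotientMap.isClosed_preimage]
  have : proj ⁻¹' curve Q = {v | MvPolynomial.eval v.1 Q = 0} := by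
    ext v
    exact mk_mem_curve hQ v.2
  rw [this]
  refine isClosed_eq ?_ continuous_const
  exact (MvPolynomial.continuous_eval Q).comp continuous_subtype_val

/-- A continuous family of homogeneous maps of the space, with the inverse maps. -/
structure IsHomogeneousIsotopy (T S : unitInterval → (Fin 3 → ℂ) → (Fin 3 → ℂ)) : Prop where
  continuous : Continuous fun q : unitInterval × (Fin 3 → ℂ) => T q.1 q.2
  continuous_inv : Continuous fun q : unitInterval × (Fin 3 → ℂ) => S q.1 q.2
  smul : ∀ t (c : ℂ) v, T t (c • v) = c • T t v
  smul_inv : ∀ t (c : ℂ) v, S t (c • v) = c • S t v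
  left_inv : ∀ t v, S t (T t v) = v
  right_inv : ∀ t v, T t (S t v) = v

theorem IsHomogeneousIsotopy.symm {T S : unitInterval → (Fin 3 → ℂ) → (Fin 3 → ℂ)}
    (h : IsHomogeneousIsotopy T S) : IsHomogeneousIsotopy S T :=
  ⟨h.continuous_inv, h.continuous, h.smul_inv, h.smul, h.right_inv, h.left_inv⟩

theorem IsHomogeneousIsotopy.ne_zero {T S : unitInterval → (Fin 3 → ℂ) → (Fin 3 → ℂ)}
    (h : IsHomogeneousIsotopy T S) (t : unitInterval) {v : Fin 3 → ℂ} (hv : v ≠ 0) :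
    T t v ≠ 0 := by
  intro h0
  have h1 := h.left_inv t v
  have h2 := h.smul_inv t 0 0
  rw [zero_smul, zero_smul] at h2
  rw [h0, h2] at h1
  exact hv h1.symm

/-- A homogeneous isotopy induces a continuous family of maps of the projective plane. Joint
continuity in the time and the point holds because the projection is an open quotient map. -/
theorem IsHomogeneousIsotopy.exists_descent {T S : unitInterval → (Fin 3 → ℂ) → (Fin 3 → ℂ)}
    (h : IsHomogeneousIsotopy T S) : ∃ f : unitInterval → CP2 → CP2,
      Continuous (fun q : unitInterval × CP2 => f q.1 q.2) ∧
      ∀ t v (hv : v ≠ 0), f t (Projectivization.mk ℂ v hv)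
        = Projectivization.mk ℂ (T t v) (h.ne_zero t hv) := by
  refine ⟨fun t => Projectivization.lift
    (fun v => Projectivization.mk ℂ (T t v.1) (h.ne_zero t v.2)) ?_, ?_, fun t v hv => rfl⟩
  · rintro v w c hvw
    have hc : c ≠ 0 := by
      rintro rfl
      exact v.2 (by rw [hvw, zero_smul])
    exact (mk_eq_mk _ _).2 ⟨c, hc, by rw [hvw, h.smul]⟩
  · rw [((IsOpenQuotientMap.id (X := unitInterval)).prodMap
      isOpenQuotientMap_proj).isQuotientMap.continuous_iff]
    refine isOpenQuotientMap_proj.continuous.comp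
      (f := fun q : unitInterval × {v : Fin 3 → ℂ // v ≠ 0} =>
        (⟨T q.1 q.2.1, h.ne_zero q.1 q.2.2⟩ : {v : Fin 3 → ℂ // v ≠ 0})) ?_
    refine Continuous.subtype_mk ?_ _
    exact h.continuous.comp (continuous_fst.prodMk (continuous_subtype_val.comp continuous_snd))

theorem IsHomogeneousIsotopy.exists_homeomorph {T S : unitInterval → (Fin 3 → ℂ) → (Fin 3 → ℂ)}
    (h : IsHomogeneousIsotopy T S) : ∃ H : unitInterval → CP2 ≃ₜ CP2,
      Continuous (fun q : unitInterval × CP2 => H q.1 q.2) ∧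
      ∀ t v (hv : v ≠ 0), H t (Projectivization.mk ℂ v hv)
        = Projectivization.mk ℂ (T t v) (h.ne_zero t hv) := by
  obtain ⟨f, hf, hfT⟩ := h.exists_descent
  obtain ⟨g, hg, hgS⟩ := h.symm.exists_descent
  refine ⟨fun t => ⟨⟨f t, g t, fun p => ?_, fun p => ?_⟩, ?_, ?_⟩, hf, hfT⟩
  · induction p using Projectivization.ind with
    | h v hv => simp only [hfT, hgS, h.left_inv]
  · induction p using Projectivization.ind with
    | h v hv => simp only [hfT, hgS, h.right_inv]
  · exact hf.comp (continuous_const.prodMk continuous_id)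
  · exact hg.comp (continuous_const.prodMk continuous_id)

/-- A path of sextics that is followed by a real homogeneous isotopy is a deformation. -/
theorem IsHomogeneousIsotopy.equisingularDeformation
    {T S : unitInterval → (Fin 3 → ℂ) → (Fin 3 → ℂ)} (h : IsHomogeneousIsotopy T S)
    {Φ : unitInterval → MvPolynomial (Fin 3) ℝ} (hΦ : ∀ t, IsReducedSextic (Φ t))
    (hcont : ∀ m, Continuous fun t => MvPolynomial.coeff m (Φ t)) (h0 : ∀ v, T 0 v = v)
    (hstar : ∀ t v, T t (star v) = star (T t v))
    (hcurve : ∀ t v, MvPolynomial.eval (T t v) (complexify (Φ t)) = 0 ↔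
      MvPolynomial.eval v (complexify (Φ 0)) = 0) :
    EquisingularDeformation (Φ 0) (Φ 1) := by
  obtain ⟨H, hH, hHT⟩ := h.exists_homeomorph
  refine ⟨Φ, hΦ, hcont, rfl, ⟨1, one_ne_zero, (one_smul _ _).symm⟩, H, hH, fun p => ?_,
    fun t p => ?_, fun t => ?_⟩
  · induction p using Projectivization.ind with
    | h v hv => simp only [hHT, h0]
  · induction p using Projectivization.ind with
    | h v hv => simp only [hHT, conjPoint_mk, hstar]
  · ext p
    obtain ⟨q, rfl⟩ := (H t).surjective p
    rw [(H t).injective.mem_set_image]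
    induction q using Projectivization.ind with
    | h v hv =>
    rw [hHT, mk_mem_curve (isHomogeneous_complexify (hΦ 0).homogeneous),
      mk_mem_curve (isHomogeneous_complexify (hΦ t).homogeneous), hcurve]

theorem family_eq_of_deformation {F G : NonSimpleEmptySextic}
    (h : EquisingularDeformation F.1 G.1) : family F = family G :=
  Quot.sound h

/-- A form and its multiples define the same curve. -/
theorem family_smul {F : MvPolynomial (Fin 3) ℝ} (hF : IsNonSimpleEmptySextic F) {c : ℝ}
    (hc : c ≠ 0) :
    family ⟨c • F, isNonSimpleEmptySextic_smul hc hF⟩ = family ⟨F, hF⟩ := by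
  refine family_eq_of_deformation ⟨fun _ => c • F,
    fun _ => (isNonSimpleEmptySextic_smul hc hF).toIsReducedSextic, fun m => continuous_const, rfl,
    ⟨c, hc, rfl⟩, fun _ => Homeomorph.refl _, continuous_snd, fun p => rfl, fun t p => rfl,
    fun t => ?_⟩
  exact Set.image_id _

/-! ### Projective transformations are deformations -/

theorem continuous_coeff_act {M : unitInterval → Matrix (Fin 3) (Fin 3) ℝ} (hM : Continuous M)
    (F : MvPolynomial (Fin 3) ℝ) (m : Fin 3 →₀ ℕ) :
    Continuous fun t => MvPolynomial.coeff m (act (M t) F) := by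
  classical
  induction F using MvPolynomial.induction_on generalizing m with
  | C a => simpa only [act_C] using continuous_const
  | add p q hp hq =>
    simp only [map_add, MvPolynomial.coeff_add]
    exact (hp m).add (hq m)
  | mul_X p i hp =>
    have h1 : ∀ t, MvPolynomial.coeff m (act (M t) (p * MvPolynomial.X i))
        = ∑ j, M t i j * MvPolynomial.coeff m (act (M t) p * MvPolynomial.X j) := by
      intro t
      rw [map_mul, act_X, Finset.mul_sum, MvPolynomial.coeff_sum]
      refine Finset.sum_congr rfl fun j _ => ?_
      rw [← MvPolynomial.coeff_C_mul]
      congr 1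
      ring
    simp only [h1, MvPolynomial.coeff_mul_X']
    refine continuous_finsetSum _ fun j _ => (hM.matrix_elem i j).mul ?_
    split_ifs
    · exact hp _
    · exact continuous_const

theorem equisingularDeformation_act {M N : unitInterval → Matrix (Fin 3) (Fin 3) ℝ}
    (hM : Continuous M) (hN : Continuous N) (hMN : ∀ t, M t * N t = 1) (h0 : M 0 = 1)
    {F : MvPolynomial (Fin 3) ℝ} (hF : IsReducedSextic F) :
    EquisingularDeformation F (act (M 1) F) := by
  have hMN' := fun t => complexMatrix_mul_eq_one (hMN t)
  have hNM' := fun t => complexMatrix_mul_eq_one (mul_eq_one_comm.1 (hMN t))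
  have hcont : ∀ M : unitInterval → Matrix (Fin 3) (Fin 3) ℝ, Continuous M →
      Continuous fun q : unitInterval × (Fin 3 → ℂ) => (complexMatrix (M q.1)).mulVec q.2 := by
    intro M hM
    refine Continuous.matrix_mulVec (Continuous.matrix_map (hM.comp continuous_fst) ?_)
      continuous_snd
    exact Complex.continuous_ofReal
  have hiso : IsHomogeneousIsotopy (fun t => (complexMatrix (N t)).mulVec)
      (fun t => (complexMatrix (M t)).mulVec) :=
    ⟨hcont N hN, hcont M hM, fun t c v => Matrix.mulVec_smul _ _ _,
      fun t c v => Matrix.mulVec_smul _ _ _, fun t v => mulVec_mulVec_of_mul_eq_one (hMN' t) v,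
      fun t v => mulVec_mulVec_of_mul_eq_one (hNM' t) v⟩
  have h := hiso.equisingularDeformation (Φ := fun t => act (M t) F)
    (fun t => isReducedSextic_act (hMN t) hF) (continuous_coeff_act hM F) (fun v => ?_)
    (fun t v => (star_complexMatrix_mulVec _ _).symm) (fun t v => ?_)
  · rwa [h0, act_one] at h
  · have h1 := hMN 0
    rw [h0, one_mul] at h1
    rw [h1, complexMatrix_one, Matrix.one_mulVec]
  · rw [complexify_act, eval_act, mulVec_mulVec_of_mul_eq_one (hMN' t), h0, act_one]

/-- The substitution `M` does not change the deformation family. -/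
def PreservesFamilies (M : Matrix (Fin 3) (Fin 3) ℝ) : Prop :=
  ∀ (F : MvPolynomial (Fin 3) ℝ) (hF : IsNonSimpleEmptySextic F)
    (hF' : IsNonSimpleEmptySextic (act M F)), family ⟨act M F, hF'⟩ = family ⟨F, hF⟩

theorem preservesFamilies_of_path {M N : unitInterval → Matrix (Fin 3) (Fin 3) ℝ}
    (hM : Continuous M) (hN : Continuous N) (hMN : ∀ t, M t * N t = 1) (h0 : M 0 = 1) :
    PreservesFamilies (M 1) := fun _ hF _ => Eq.symm <| family_eq_of_deformation <|
  equisingularDeformation_act hM hN hMN h0 hF.toIsReducedSextic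

theorem PreservesFamilies.mul {A B : Matrix (Fin 3) (Fin 3) ℝ} (hdet : A.det ≠ 0)
    (hA : PreservesFamilies A) (hB : PreservesFamilies B) : PreservesFamilies (A * B) := by
  intro F hF hF'
  have h1 := isNonSimpleEmptySextic_act (Matrix.mul_nonsing_inv A (isUnit_iff_ne_zero.2 hdet)) hF
  have e : act (A * B) F = act B (act A F) := (act_act _ _ _).symm
  simp only [e] at hF' ⊢
  rw [hB _ h1 hF', hA F hF h1]

theorem PreservesFamilies.neg {A : Matrix (Fin 3) (Fin 3) ℝ} (hA : PreservesFamilies A) :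
    PreservesFamilies (-A) := by
  intro F hF hF'
  have e : act (-A) F = act A F := by
    refine complexify_injective (MvPolynomial.funext fun v => ?_)
    have hneg : complexMatrix (-A) = -complexMatrix A := by
      ext i j
      simp [complexMatrix]
    rw [complexify_act, complexify_act, eval_act, eval_act, hneg, Matrix.neg_mulVec,
      ← neg_one_smul ℂ, eval_smul_of_isHomogeneous (isHomogeneous_complexify hF.homogeneous)]
    norm_num
  simp only [e] at hF' ⊢
  exact hA F hF hF'

theorem preservesFamilies_transvection {i j : Fin 3} (hij : i ≠ j) (c : ℝ) :
    PreservesFamilies (Matrix.transvection i j c) := by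
  have hcont : ∀ f : unitInterval → ℝ, Continuous f →
      Continuous fun t => Matrix.transvection i j (f t) := by
    intro f hf
    refine continuous_matrix fun a b => ?_
    simp only [Matrix.transvection, Matrix.add_apply, Matrix.single, Matrix.of_apply]
    refine continuous_const.add ?_
    split_ifs
    · exact hf
    · exact continuous_const
  have h := preservesFamilies_of_path
    (M := fun t => Matrix.transvection i j ((t : ℝ) * c))
    (N := fun t => Matrix.transvection i j (-((t : ℝ) * c)))
    (hcont _ (by fun_prop)) (hcont _ (by fun_prop))
    (fun t => by rw [Matrix.transvection_mul_transvection_same i j hij]; simp) (by simp)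
  simpa using h

theorem preservesFamilies_diagonal_of_pos {d : Fin 3 → ℝ} (hd : ∀ i, 0 < d i) :
    PreservesFamilies (Matrix.diagonal d) := by
  have hpos : ∀ (t : unitInterval) i, (0 : ℝ) < 1 + t * (d i - 1) := by
    intro t i
    have h0 := t.2.1
    have h1 := t.2.2
    nlinarith [hd i, mul_nonneg h0 (hd i).le]
  have h := preservesFamilies_of_path
    (M := fun t => Matrix.diagonal fun i => 1 + (t : ℝ) * (d i - 1))
    (N := fun t => Matrix.diagonal fun i => (1 + (t : ℝ) * (d i - 1))⁻¹)
    (Continuous.matrix_diagonal (by fun_prop))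
    (Continuous.matrix_diagonal (continuous_pi fun i =>
      Continuous.inv₀ (by fun_prop) fun t => (hpos t i).ne'))
    (fun t => by
      rw [Matrix.diagonal_mul_diagonal, ← Matrix.diagonal_one]
      congr 1
      funext i
      exact mul_inv_cancel₀ (hpos t i).ne') (by simp)
  simpa using h

theorem transvection_product_sq : ∀ i j : Fin 3, i ≠ j →
    (Matrix.transvection i j (1 : ℝ) * Matrix.transvection j i (-1) * Matrix.transvection i j 1)
      * (Matrix.transvection i j 1 * Matrix.transvection j i (-1) * Matrix.transvection i j 1)
      = Matrix.diagonal fun k => if k = i ∨ k = j then -1 else 1 := by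
  intro i j hij
  ext a b
  fin_cases i <;> fin_cases j <;> first | exact absurd rfl hij | skip
  all_goals
    fin_cases a <;> fin_cases b <;>
    simp [Matrix.transvection, Matrix.mul_apply, Fin.sum_univ_three, Matrix.single,
      Matrix.one_apply]

/-- The rotation by the angle `π` in the coordinates `i` and `j` is the square of a rotation by a
right angle, which is a product of three transvections. -/
theorem preservesFamilies_rotation {i j : Fin 3} (hij : i ≠ j) :
    PreservesFamilies (Matrix.diagonal fun k => if k = i ∨ k = j then (-1 : ℝ) else 1) := by
  have h1 := preservesFamilies_transvection hij 1
  have h2 := preservesFamilies_transvection hij.symm (-1)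
  have d1 := Matrix.det_transvection_of_ne i j hij (1 : ℝ)
  have d2 := Matrix.det_transvection_of_ne j i hij.symm (-1 : ℝ)
  have h3 := (h1.mul (by rw [d1]; norm_num) h2).mul
    (by rw [Matrix.det_mul, d1, d2]; norm_num) h1
  rw [← transvection_product_sq i j hij]
  exact h3.mul (by rw [Matrix.det_mul, Matrix.det_mul, d1, d2]; norm_num) h3

theorem preservesFamilies_diagonal_sign {s : Fin 3 → ℝ} (hs : ∀ i, s i = 1 ∨ s i = -1) :
    PreservesFamilies (Matrix.diagonal s) := by
  have hone : PreservesFamilies (Matrix.diagonal fun _ => (1 : ℝ)) :=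
    preservesFamilies_diagonal_of_pos fun _ => one_pos
  have h01 := preservesFamilies_rotation (i := 0) (j := 1) (by decide)
  have h02 := preservesFamilies_rotation (i := 0) (j := 2) (by decide)
  have h12 := preservesFamilies_rotation (i := 1) (j := 2) (by decide)
  have key : ∀ r : Fin 3 → ℝ, PreservesFamilies (Matrix.diagonal r) →
      ((∀ i, s i = r i) ∨ ∀ i, s i = -r i) → PreservesFamilies (Matrix.diagonal s) := by
    rintro r hr (h | h)
    · rwa [funext h]
    · have : Matrix.diagonal s = -Matrix.diagonal r := by
        rw [Matrix.diagonal_neg]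
        congr 1
        exact funext h
      rw [this]
      exact hr.neg
  rcases hs 0 with h0 | h0 <;> rcases hs 1 with h1 | h1 <;> rcases hs 2 with h2 | h2
  · exact key _ hone (Or.inl fun i => by fin_cases i <;> simp [h0, h1, h2])
  · exact key _ h01 (Or.inr fun i => by fin_cases i <;> simp [h0, h1, h2])
  · exact key _ h02 (Or.inr fun i => by fin_cases i <;> simp [h0, h1, h2])
  · exact key _ h12 (Or.inl fun i => by fin_cases i <;> simp [h0, h1, h2])
  · exact key _ h12 (Or.inr fun i => by fin_cases i <;> simp [h0, h1, h2])
  · exact key _ h02 (Or.inl fun i => by fin_cases i <;> simp [h0, h1, h2])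
  · exact key _ h01 (Or.inl fun i => by fin_cases i <;> simp [h0, h1, h2])
  · exact key _ hone (Or.inr fun i => by fin_cases i <;> simp [h0, h1, h2])

theorem preservesFamilies_of_det_ne_zero {M : Matrix (Fin 3) (Fin 3) ℝ} (hM : M.det ≠ 0) :
    PreservesFamilies M := by
  refine Matrix.diagonal_transvection_induction_of_det_ne_zero _ M hM (fun D hD => ?_)
    (fun t => preservesFamilies_transvection t.hij t.c) fun A B hA _ => PreservesFamilies.mul hA
  rw [Matrix.det_diagonal, Finset.prod_ne_zero_iff] at hD
  have h1 : Matrix.diagonal D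
      = Matrix.diagonal (fun i => |D i|) * Matrix.diagonal fun i => D i / |D i| := by
    rw [Matrix.diagonal_mul_diagonal]
    congr 1
    funext i
    rw [mul_div_cancel₀ _ (abs_ne_zero.2 (hD i (Finset.mem_univ i)))]
  rw [h1]
  refine PreservesFamilies.mul ?_
    (preservesFamilies_diagonal_of_pos fun i => abs_pos.2 (hD i (Finset.mem_univ i)))
    (preservesFamilies_diagonal_sign fun i => ?_)
  · rw [Matrix.det_diagonal, Finset.prod_ne_zero_iff]
    exact fun i _ => abs_ne_zero.2 (hD i (Finset.mem_univ i))
  · have hi := hD i (Finset.mem_univ i)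
    rcases abs_choice (D i) with h | h <;> rw [h]
    · exact Or.inl (div_self hi)
    · exact Or.inr (by rw [div_neg, div_self hi])

/-- The family of a normal form. -/
noncomputable def normalFamily {σ : Fin 3 → ℂ} (hσ : Adm σ) : DeformationFamily :=
  family ⟨realForm (nf σ), isNonSimpleEmptySextic_nf hσ⟩

theorem HasNormalForm.family_eq {F : MvPolynomial (Fin 3) ℝ} {σ : Fin 3 → ℂ}
    (h : HasNormalForm F σ) (hF : IsNonSimpleEmptySextic F) :
    family ⟨F, hF⟩ = normalFamily h.adm := by
  obtain ⟨M, N, d, hMN, hd, rfl⟩ := h.exists_eq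
  have h1 := isNonSimpleEmptySextic_act hMN (isNonSimpleEmptySextic_nf h.adm)
  rw [family_smul h1 (pow_ne_zero 3 hd)]
  refine preservesFamilies_of_det_ne_zero (fun h0 => ?_) _ _ h1
  have := congrArg Matrix.det hMN
  rw [Matrix.det_mul, h0, zero_mul, Matrix.det_one] at this
  exact zero_ne_one this

/-! ### Deformations of the parameters of the normal forms -/

/-- A continuous family of functions that can be used to stretch the coordinate `z` of the plane:
`z` is multiplied by the square root of `K t (x² + y²) (z²)`. -/
structure IsStretch (K : unitInterval → ℂ → ℂ → ℂ) : Prop where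
  hom : ∀ t c p q, c ≠ 0 → K t (c * p) (c * q) = K t p q
  conj : ∀ t p q, K t (star p) (star q) = star (K t p q)
  slit : ∀ t p q, q ≠ 0 → K t p q ∈ Complex.slitPlane
  cont : ∀ t p q, q ≠ 0 →
    ContinuousAt (fun x : unitInterval × ℂ × ℂ => K x.1 x.2.1 x.2.2) (t, p, q)
  bdd : ∃ B, ∀ t p q, ‖K t p q‖ ≤ B

/-- The homeomorphism of the space given by a stretch. -/
noncomputable def stretch (K : unitInterval → ℂ → ℂ → ℂ) (t : unitInterval) (v : Fin 3 → ℂ) :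
    Fin 3 → ℂ :=
  ![v 0, v 1, v 2 * K t (v 0 ^ 2 + v 1 ^ 2) (v 2 ^ 2) ^ (((2 : ℕ) : ℂ)⁻¹)]

section stretch

variable {K L : unitInterval → ℂ → ℂ → ℂ}

theorem stretch_sq (t : unitInterval) (v : Fin 3 → ℂ) :
    stretch K t v 2 ^ 2 = v 2 ^ 2 * K t (v 0 ^ 2 + v 1 ^ 2) (v 2 ^ 2) := by
  have h : stretch K t v 2 = v 2 * K t (v 0 ^ 2 + v 1 ^ 2) (v 2 ^ 2) ^ (((2 : ℕ) : ℂ)⁻¹) := rfl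
  rw [h, mul_pow, Complex.cpow_nat_inv_pow _ two_ne_zero]

theorem IsStretch.stretch_smul (hK : IsStretch K) (t : unitInterval) (c : ℂ) (v : Fin 3 → ℂ) :
    stretch K t (c • v) = c • stretch K t v := by
  by_cases hc : c = 0
  · subst hc
    funext i
    fin_cases i <;> simp [stretch]
  · have h : K t ((c * v 0) ^ 2 + (c * v 1) ^ 2) ((c * v 2) ^ 2)
        = K t (v 0 ^ 2 + v 1 ^ 2) (v 2 ^ 2) := by
      rw [← hK.hom t (c ^ 2) (v 0 ^ 2 + v 1 ^ 2) (v 2 ^ 2) (pow_ne_zero 2 hc)]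
      congr 1 <;> ring
    funext i
    fin_cases i <;> simp [stretch, h, mul_assoc]

theorem IsStretch.stretch_star (hK : IsStretch K) (t : unitInterval) (v : Fin 3 → ℂ) :
    stretch K t (star v) = star (stretch K t v) := by
  funext i
  fin_cases i
  · rfl
  · rfl
  · change star (v 2) * K t (star (v 0) ^ 2 + star (v 1) ^ 2) (star (v 2) ^ 2)
      ^ (((2 : ℕ) : ℂ)⁻¹) = star (v 2 * K t (v 0 ^ 2 + v 1 ^ 2) (v 2 ^ 2) ^ (((2 : ℕ) : ℂ)⁻¹))
    rw [star_mul', ← star_pow, ← star_pow, ← star_pow, ← star_add, hK.conj]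
    by_cases hz : v 2 = 0
    · simp [hz]
    · have h := Complex.cpow_conj (K t (v 0 ^ 2 + v 1 ^ 2) (v 2 ^ 2)) (((2 : ℕ) : ℂ)⁻¹)
        (Complex.mem_slitPlane_iff_arg.1 (hK.slit t _ _ (pow_ne_zero 2 hz))).1
      have h2 : (starRingEnd ℂ) (((2 : ℕ) : ℂ)⁻¹) = ((2 : ℕ) : ℂ)⁻¹ := by
        rw [map_inv₀, map_natCast]
      rw [h2] at h
      rw [h]
      simp

theorem IsStretch.stretch_stretch (hK : IsStretch K)
    (hKL : ∀ t p q, q ≠ 0 → L t p (q * K t p q) = (K t p q)⁻¹) (t : unitInterval)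
    (v : Fin 3 → ℂ) : stretch L t (stretch K t v) = v := by
  funext i
  fin_cases i
  · rfl
  · rfl
  · change stretch K t v 2 * L t (v 0 ^ 2 + v 1 ^ 2) (stretch K t v 2 ^ 2) ^ (((2 : ℕ) : ℂ)⁻¹)
      = v 2
    rw [stretch_sq]
    change v 2 * K t (v 0 ^ 2 + v 1 ^ 2) (v 2 ^ 2) ^ (((2 : ℕ) : ℂ)⁻¹) * _ = _
    by_cases hz : v 2 = 0
    · simp [hz]
    · have hz2 := pow_ne_zero 2 hz
      have hs := hK.slit t (v 0 ^ 2 + v 1 ^ 2) _ hz2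
      rw [hKL _ _ _ hz2, Complex.inv_cpow _ _ (Complex.mem_slitPlane_iff_arg.1 hs).1, mul_assoc,
        mul_inv_cancel₀, mul_one]
      rw [Ne, Complex.cpow_eq_zero_iff]
      exact fun h => Complex.slitPlane_ne_zero hs h.1

theorem IsStretch.continuous_stretch (hK : IsStretch K) :
    Continuous fun q : unitInterval × (Fin 3 → ℂ) => stretch K q.1 q.2 := by
  have hcomp : ∀ i, Continuous fun q : unitInterval × (Fin 3 → ℂ) => q.2 i := fun i =>
    (continuous_apply i).comp continuous_snd
  refine continuous_pi fun i => ?_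
  fin_cases i
  · exact hcomp 0
  · exact hcomp 1
  · change Continuous fun q : unitInterval × (Fin 3 → ℂ) =>
      q.2 2 * K q.1 (q.2 0 ^ 2 + q.2 1 ^ 2) (q.2 2 ^ 2) ^ (((2 : ℕ) : ℂ)⁻¹)
    rw [continuous_iff_continuousAt]
    rintro ⟨t, v⟩
    by_cases hz : v 2 = 0
    · -- the factor is bounded
      obtain ⟨B, hB⟩ := hK.bdd
      have hB' : ∀ t p q, ‖K t p q ^ (((2 : ℕ) : ℂ)⁻¹)‖ ≤ B + 1 := by
        intro t p q
        have h1 : ‖K t p q ^ (((2 : ℕ) : ℂ)⁻¹)‖ ^ 2 ≤ B := by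
          rw [← norm_pow, Complex.cpow_nat_inv_pow _ two_ne_zero]
          exact hB t p q
        nlinarith [sq_nonneg (‖K t p q ^ (((2 : ℕ) : ℂ)⁻¹)‖ - 1)]
      rw [ContinuousAt]
      simp only [hz, zero_mul]
      refine squeeze_zero_norm (a := fun q : unitInterval × (Fin 3 → ℂ) => ‖q.2 2‖ * (B + 1))
        (fun q => ?_) ?_
      · rw [norm_mul]
        exact mul_le_mul_of_nonneg_left (hB' _ _ _) (norm_nonneg _)
      · have h1 : Continuous fun q : unitInterval × (Fin 3 → ℂ) => ‖q.2 2‖ * (B + 1) :=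
          (hcomp 2).norm.mul continuous_const
        have h2 := h1.tendsto (t, v)
        simpa [hz] using h2
    · have hz2 := pow_ne_zero 2 hz
      refine (hcomp 2).continuousAt.mul ?_
      refine ContinuousAt.cpow ?_ continuousAt_const (hK.slit t _ _ hz2)
      have h1 : Continuous fun q : unitInterval × (Fin 3 → ℂ) =>
          (q.1, q.2 0 ^ 2 + q.2 1 ^ 2, q.2 2 ^ 2) :=
        continuous_fst.prodMk ((((hcomp 0).pow 2).add ((hcomp 1).pow 2)).prodMk ((hcomp 2).pow 2))
      exact ContinuousAt.comp (f := fun q : unitInterval × (Fin 3 → ℂ) =>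
          (q.1, q.2 0 ^ 2 + q.2 1 ^ 2, q.2 2 ^ 2)) (x := (t, v)) (hK.cont t _ _ hz2)
        h1.continuousAt

theorem IsStretch.adm (hK : IsStretch K) (hL : IsStretch L)
    (hKL : ∀ t p q, q ≠ 0 → L t p (q * K t p q) = (K t p q)⁻¹) {σ : Fin 3 → ℂ} (hσ : Adm σ)
    (t : unitInterval) : Adm fun i => σ i * K t 1 (σ i) := by
  have hK0 : ∀ i, K t 1 (σ i) ≠ 0 := fun i =>
    Complex.slitPlane_ne_zero (hK.slit t 1 _ (hσ.ne_zero i))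
  have hback : ∀ i, σ i * K t 1 (σ i) * L t 1 (σ i * K t 1 (σ i)) = σ i := fun i => by
    rw [hKL _ _ _ (hσ.ne_zero i), mul_assoc, mul_inv_cancel₀ (hK0 i), mul_one]
  refine ⟨fun i j hij => hσ.injective ?_, fun i => ?_, fun i r hr hi => ?_⟩
  · rw [← hback i, ← hback j]
    rw [hij]
  · obtain ⟨j, hj⟩ := hσ.conj i
    refine ⟨j, ?_⟩
    have := hK.conj t 1 (σ i)
    rw [star_one] at this
    rw [star_mul', hj, ← this, hj]
  · have h1 := hback i
    rw [hi] at h1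
    have hr0 : (r : ℂ) ≠ 0 := by
      rw [← hi]
      exact mul_ne_zero (hσ.ne_zero i) (hK0 i)
    -- on the positive half-line the inverse stretch is real, hence positive
    have hreal := hL.conj t 1 r
    have hrr : star (r : ℂ) = r := Complex.conj_ofReal r
    rw [star_one, hrr] at hreal
    have hre : ((L t 1 r).re : ℂ) = L t 1 r := Complex.conj_eq_iff_re.1 hreal.symm
    have hpos : 0 < (L t 1 r).re := by
      have := hL.slit t 1 r hr0
      rw [← hre] at this
      exact Complex.ofReal_mem_slitPlane.1 this
    refine hσ.ne_ofReal i (r * (L t 1 r).re) (mul_nonneg hr hpos.le) ?_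
    rw [Complex.ofReal_mul, hre, h1]

theorem eq_mul_iff_stretch (hK : IsStretch K) (hL : IsStretch L)
    (hKL : ∀ t p q, q ≠ 0 → L t p (q * K t p q) = (K t p q)⁻¹) (t : unitInterval) {s : ℂ}
    (hs : s ≠ 0) (p q : ℂ) : q * K t p q = s * K t 1 s * p ↔ q = s * p := by
  have hKs : K t 1 s ≠ 0 := Complex.slitPlane_ne_zero (hK.slit t 1 _ hs)
  by_cases hq : q = 0
  · subst hq
    simp [hs, hKs, eq_comm]
  have hKq : K t p q ≠ 0 := Complex.slitPlane_ne_zero (hK.slit t p _ hq)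
  constructor
  · intro h
    have hp : p ≠ 0 := by
      rintro rfl
      rw [mul_zero] at h
      exact mul_ne_zero hq hKq h
    have h1 := hKL t p q hq
    have h2 := hL.hom t p 1 (s * K t 1 s) hp
    rw [mul_one, mul_comm p, ← h, h1, hKL t 1 s hs] at h2
    rw [inv_injective h2] at h
    exact mul_right_cancel₀ hKs (by rw [h]; ring)
  · intro h
    have hp : p ≠ 0 := by
      rintro rfl
      exact hq (by rw [h, mul_zero])
    have h2 := hK.hom t p 1 s hp
    rw [mul_one, mul_comm p, ← h] at h2
    rw [h2, h]
    ring

theorem continuous_coeff_nf {τ : unitInterval → Fin 3 → ℂ} (hτ : ∀ i, Continuous fun t => τ t i)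
    (m : Fin 3 →₀ ℕ) : Continuous fun t => MvPolynomial.coeff m (nf (τ t)) := by
  classical
  have hmul : ∀ P Q : unitInterval → MvPolynomial (Fin 3) ℂ,
      (∀ m, Continuous fun t => MvPolynomial.coeff m (P t)) →
      (∀ m, Continuous fun t => MvPolynomial.coeff m (Q t)) →
      ∀ m, Continuous fun t => MvPolynomial.coeff m (P t * Q t) := by
    intro P Q hP hQ m
    simp only [MvPolynomial.coeff_mul]
    exact continuous_finsetSum _ fun x _ => (hP _).mul (hQ _)
  have hquad : ∀ i m, Continuous fun t => MvPolynomial.coeff m (quad (τ t i)) := by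
    intro i m
    simp only [quad, MvPolynomial.coeff_sub, MvPolynomial.coeff_C_mul]
    exact continuous_const.sub ((hτ i).mul continuous_const)
  simp only [nf_eq_mul]
  exact hmul _ _ (hmul _ _ (hquad 0) (hquad 1)) (hquad 2) m

/-- A stretch moves the parameters of a normal form within the deformation family. -/
theorem IsStretch.normalFamily_eq (hK : IsStretch K) (hL : IsStretch L)
    (hKL : ∀ t p q, q ≠ 0 → L t p (q * K t p q) = (K t p q)⁻¹)
    (hLK : ∀ t p q, q ≠ 0 → K t p (q * L t p q) = (L t p q)⁻¹) (h0 : ∀ p q, K 0 p q = 1)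
    {σ τ : Fin 3 → ℂ} (hσ : Adm σ) (hτ : ∀ i, τ i = σ i * K 1 1 (σ i)) :
    ∃ hτ' : Adm τ, normalFamily hσ = normalFamily hτ' := by
  have hadm := hK.adm hL hKL hσ
  have hiso : IsHomogeneousIsotopy (stretch K) (stretch L) :=
    ⟨hK.continuous_stretch, hL.continuous_stretch, hK.stretch_smul, hL.stretch_smul,
      hK.stretch_stretch hKL, hL.stretch_stretch hLK⟩
  have e0 : (fun i => σ i * K 0 1 (σ i)) = σ := by
    funext i
    rw [h0, mul_one]
  have e1 : (fun i => σ i * K 1 1 (σ i)) = τ := funext fun i => (hτ i).symm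
  have hdef := hiso.equisingularDeformation
    (Φ := fun t => realForm (nf fun i => σ i * K t 1 (σ i)))
    (fun t => isReducedSextic_nf (hadm t)) (fun m => ?_) (fun v => ?_) hK.stretch_star
    (fun t v => ?_)
  · simp only [e0, e1] at hdef
    exact ⟨e1 ▸ hadm 1, family_eq_of_deformation hdef⟩
  · simp only [coeff_realForm]
    refine Complex.continuous_re.comp (continuous_coeff_nf (fun i => ?_) m)
    refine continuous_const.mul (continuous_iff_continuousAt.2 fun t => ?_)
    exact ContinuousAt.comp (f := fun t : unitInterval => (t, (1 : ℂ), σ i))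
      (hK.cont t 1 (σ i) (hσ.ne_zero i)) (by fun_prop)
  · funext i
    fin_cases i <;> simp [stretch, h0]
  · rw [complexify_realForm_nf (hadm t), complexify_realForm_nf (hadm 0), e0, eval_nf, eval_nf,
      Finset.prod_eq_zero_iff, Finset.prod_eq_zero_iff]
    refine exists_congr fun i => and_congr_right fun _ => ?_
    rw [sub_eq_zero, sub_eq_zero, stretch_sq]
    exact eq_mul_iff_stretch hK hL hKL t (hσ.ne_zero i) _ _

end stretch

/-- The radial stretch: on the line with the coordinate `s = q / p` it keeps the disk `‖s‖ ≤ s₀` and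
multiplies the distances to this disk by `m`. -/
noncomputable def radial (m : unitInterval → ℝ) (s₀ : ℝ) (t : unitInterval) (p q : ℂ) : ℂ :=
  ((1 + (m t - 1) * (max (‖q‖ - s₀ * ‖p‖) 0 / ‖q‖) : ℝ) : ℂ)

theorem radial_ratio_mem {s₀ : ℝ} (hs : 0 ≤ s₀) (p q : ℂ) :
    0 ≤ max (‖q‖ - s₀ * ‖p‖) 0 / ‖q‖ ∧ max (‖q‖ - s₀ * ‖p‖) 0 / ‖q‖ ≤ 1 := by
  have h1 := norm_nonneg q
  have h2 := mul_nonneg hs (norm_nonneg p)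
  refine ⟨by positivity, div_le_one_of_le₀ (max_le (by linarith) h1) h1⟩

theorem radial_factor_pos {s₀ m : ℝ} (hs : 0 ≤ s₀) (hm : 0 < m) (p q : ℂ) :
    0 < 1 + (m - 1) * (max (‖q‖ - s₀ * ‖p‖) 0 / ‖q‖) := by
  obtain ⟨h1, h2⟩ := radial_ratio_mem hs p q
  rcases h1.eq_or_lt with h | h
  · rw [← h]
    norm_num
  · nlinarith [mul_pos hm h]

theorem isStretch_radial {m : unitInterval → ℝ} (hm : Continuous m) (hpos : ∀ t, 0 < m t) {s₀ : ℝ}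
    (hs : 0 ≤ s₀) : IsStretch (radial m s₀) where
  hom t c p q hc := by
    have hc' : 0 < ‖c‖ := norm_pos_iff.2 hc
    have h1 : max (‖c‖ * ‖q‖ - s₀ * (‖c‖ * ‖p‖)) 0 = ‖c‖ * max (‖q‖ - s₀ * ‖p‖) 0 := by
      rw [mul_max_of_nonneg _ _ hc'.le, mul_zero]
      congr 1
      ring
    rw [radial, radial, norm_mul, norm_mul, h1, mul_div_mul_left _ _ hc'.ne']
  conj t p q := by
    have h1 : ∀ z : ℂ, ‖star z‖ = ‖z‖ := fun z => Complex.norm_conj z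
    rw [radial, radial, h1, h1]
    exact (Complex.conj_ofReal _).symm
  slit t p q _ := Complex.ofReal_mem_slitPlane.2 (radial_factor_pos hs (hpos t) p q)
  cont t p q hq := by
    refine Complex.continuous_ofReal.continuousAt.comp ?_
    refine continuousAt_const.add (((hm.comp continuous_fst).sub continuous_const).continuousAt.mul
      (ContinuousAt.div ?_ ?_ (norm_ne_zero_iff.2 hq)))
    · exact Continuous.continuousAt (by fun_prop)
    · exact Continuous.continuousAt (by fun_prop)
  bdd := by
    obtain ⟨B, hB⟩ := isCompact_univ.exists_bound_of_continuousOn hm.continuousOn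
    refine ⟨B + 2, fun t p q => ?_⟩
    obtain ⟨h1, h2⟩ := radial_ratio_mem hs p q
    have h3 := radial_factor_pos hs (hpos t) p q
    have h4 := hB t (Set.mem_univ t)
    rw [Real.norm_eq_abs, abs_of_pos (hpos t)] at h4
    rw [radial, Complex.norm_real, Real.norm_eq_abs, abs_of_pos h3]
    nlinarith [hpos t, mul_le_mul_of_nonneg_left h2 (hpos t).le]

theorem radial_inv {m : unitInterval → ℝ} (hpos : ∀ t, 0 < m t) {s₀ : ℝ} (hs : 0 ≤ s₀)
    (t : unitInterval) (p : ℂ) {q : ℂ} (hq : q ≠ 0) :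
    radial (fun t => (m t)⁻¹) s₀ t p (q * radial m s₀ t p q) = (radial m s₀ t p q)⁻¹ := by
  have h3 := radial_factor_pos hs (hpos t) p q
  have hq' : 0 < ‖q‖ := norm_pos_iff.2 hq
  have hm := hpos t
  obtain ⟨k, hk⟩ : ∃ k, k = 1 + (m t - 1) * (max (‖q‖ - s₀ * ‖p‖) 0 / ‖q‖) := ⟨_, rfl⟩
  have hrad : radial m s₀ t p q = (k : ℂ) := by rw [hk, radial]
  rw [← hk] at h3
  have hnorm : ‖q * (k : ℂ)‖ = ‖q‖ * k := by
    rw [norm_mul, Complex.norm_real, Real.norm_eq_abs, abs_of_pos h3]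
  have hqk : ‖q‖ * k = ‖q‖ + (m t - 1) * max (‖q‖ - s₀ * ‖p‖) 0 := by
    rw [hk]
    field_simp
  rw [hrad, radial, hnorm, ← Complex.ofReal_inv]
  congr 1
  have hmax : max (‖q‖ * k - s₀ * ‖p‖) 0 = m t * max (‖q‖ - s₀ * ‖p‖) 0 := by
    rw [hqk]
    rcases le_total (‖q‖ - s₀ * ‖p‖) 0 with h | h
    · rw [max_eq_right h, mul_zero, mul_zero, add_zero, max_eq_right h]
    · rw [max_eq_left h]
      have h5 : ‖q‖ + (m t - 1) * (‖q‖ - s₀ * ‖p‖) - s₀ * ‖p‖ = m t * (‖q‖ - s₀ * ‖p‖) := by ring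
      rw [h5, max_eq_left (mul_nonneg hm.le h)]
  rw [hmax]
  have hk0 := h3.ne'
  have hm0 := hm.ne'
  have hq0 := hq'.ne'
  have hd : (m t - 1) * max (‖q‖ - s₀ * ‖p‖) 0 = ‖q‖ * k - ‖q‖ := by linarith
  field_simp
  linear_combination (-1 : ℝ) * hd

/-- The points of the disk `‖s‖ ≤ s₀` stay, the other points move along the rays. -/
theorem exists_normalFamily_radial {s₀ m : ℝ} (hs : 0 ≤ s₀) (hm : 0 < m) {σ τ : Fin 3 → ℂ}
    (hσ : Adm σ)
    (hτ : ∀ i, τ i = σ i * ((1 + (m - 1) * (max (‖σ i‖ - s₀) 0 / ‖σ i‖) : ℝ) : ℂ)) :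
    ∃ hτ' : Adm τ, normalFamily hσ = normalFamily hτ' := by
  have hpos : ∀ t : unitInterval, 0 < 1 + (t : ℝ) * (m - 1) := fun t => by
    have h0 := t.2.1
    have h1 := t.2.2
    nlinarith [mul_nonneg h0 hm.le]
  have hcont : Continuous fun t : unitInterval => 1 + (t : ℝ) * (m - 1) := by fun_prop
  have hcinv : Continuous fun t : unitInterval => (1 + (t : ℝ) * (m - 1))⁻¹ :=
    hcont.inv₀ fun t => (hpos t).ne'
  have hinv : ∀ t : unitInterval, 0 < (1 + (t : ℝ) * (m - 1))⁻¹ := fun t => inv_pos.2 (hpos t)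
  refine (isStretch_radial hcont hpos hs).normalFamily_eq
    (isStretch_radial hcinv hinv hs)
    (fun t p q hq => radial_inv hpos hs t p hq) (fun t p q hq => ?_) (fun p q => ?_) hσ
    fun i => ?_
  · have := radial_inv hinv hs t p hq
    simpa only [inv_inv] using this
  · simp [radial]
  · rw [hτ]
    simp [radial]

/-- The horizontal shear: on the line with the coordinate `s = q / p` it translates `s` by the real
number `a · min (|Im s|, 1)`. -/
noncomputable def shear (a : unitInterval → ℝ) (t : unitInterval) (p q : ℂ) : ℂ :=
  1 + ((a t * min |(q * star p).im| (‖p‖ ^ 2) : ℝ) : ℂ) / (q * star p)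

theorem norm_shear_sub_one_le (a : unitInterval → ℝ) (t : unitInterval) (p q : ℂ) :
    ‖shear a t p q - 1‖ ≤ |a t| ∧ ‖shear a t p q - 1‖ ≤ |a t| * ‖p‖ / ‖q‖ := by
  have h1 : ‖shear a t p q - 1‖
      = |a t| * min |(q * star p).im| (‖p‖ ^ 2) / (‖q‖ * ‖p‖) := by
    have h0 : 0 ≤ min |(q * star p).im| (‖p‖ ^ 2) := le_min (abs_nonneg _) (sq_nonneg _)
    rw [shear, add_sub_cancel_left, norm_div, Complex.norm_real, Real.norm_eq_abs, abs_mul,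
      abs_of_nonneg h0, norm_mul, norm_star]
  have h2 : |(q * star p).im| ≤ ‖q‖ * ‖p‖ := by
    have := Complex.abs_im_le_norm (q * star p)
    rwa [norm_mul, norm_star] at this
  rw [h1]
  have ha := abs_nonneg (a t)
  rcases (norm_nonneg p).eq_or_lt with hp | hp
  · rw [← hp]
    simp
  rcases (norm_nonneg q).eq_or_lt with hq | hq
  · rw [← hq]
    simp
  have hpq := mul_pos hq hp
  constructor
  · rw [div_le_iff₀ hpq]
    exact mul_le_mul_of_nonneg_left ((min_le_left _ _).trans h2) ha
  · rw [div_le_div_iff₀ hpq hq]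
    have := mul_le_mul_of_nonneg_left (min_le_right |(q * star p).im| (‖p‖ ^ 2)) ha
    nlinarith [mul_le_mul_of_nonneg_right this hq.le]

theorem shear_zero_left (a : unitInterval → ℝ) (t : unitInterval) (q : ℂ) :
    shear a t 0 q = 1 := by
  simp [shear]

theorem shear_mem_slitPlane (a : unitInterval → ℝ) (t : unitInterval) (p q : ℂ) :
    shear a t p q ∈ Complex.slitPlane := by
  obtain ⟨w, hw⟩ : ∃ w, w = q * star p := ⟨_, rfl⟩
  obtain ⟨b, hb⟩ : ∃ b, b = a t * min |(q * star p).im| (‖p‖ ^ 2) := ⟨_, rfl⟩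
  rw [shear, ← hb, ← hw]
  by_cases hb0 : b = 0
  · rw [hb0]
    simp
  have hwim : w.im ≠ 0 := by
    intro h
    rw [hw] at h
    rw [hb, h, abs_zero, min_eq_left (sq_nonneg _), mul_zero] at hb0
    exact hb0 rfl
  have hw0 : Complex.normSq w ≠ 0 := by
    rw [Ne, Complex.normSq_eq_zero]
    rintro rfl
    exact hwim rfl
  rw [Complex.mem_slitPlane_iff]
  right
  simp only [Complex.add_im, Complex.one_im, Complex.div_im, Complex.ofReal_im, Complex.ofReal_re]
  simp [hb0, hwim, hw0]

theorem isStretch_shear {a : unitInterval → ℝ} (ha : Continuous a) : IsStretch (shear a) where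
  hom t c p q hc := by
    have h1 : c * q * star (c * p) = ((‖c‖ ^ 2 : ℝ) : ℂ) * (q * star p) := by
      rw [star_mul']
      have : c * star c = ((‖c‖ ^ 2 : ℝ) : ℂ) := by
        rw [Complex.ofReal_pow]
        exact Complex.mul_conj' c
      linear_combination (q * star p) * this
    have hc2 : (0 : ℝ) < ‖c‖ ^ 2 := pow_pos (norm_pos_iff.2 hc) 2
    have hc2' : ((‖c‖ ^ 2 : ℝ) : ℂ) ≠ 0 := Complex.ofReal_ne_zero.2 hc2.ne'
    have h2 : min |(c * q * star (c * p)).im| (‖c * p‖ ^ 2)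
        = ‖c‖ ^ 2 * min |(q * star p).im| (‖p‖ ^ 2) := by
      rw [h1, Complex.im_ofReal_mul, abs_mul, abs_of_pos hc2, norm_mul, mul_pow,
        mul_min_of_nonneg _ _ hc2.le]
    rw [shear, shear, h2, h1, mul_left_comm, Complex.ofReal_mul (‖c‖ ^ 2),
      mul_div_mul_left _ _ hc2']
  conj t p q := by
    have h1 : star q * star (star p) = star (q * star p) := by rw [star_mul']
    have h2 : (star (q * star p)).im = -(q * star p).im := Complex.conj_im _
    rw [shear, shear, h1, h2, abs_neg, norm_star, star_add, star_one, star_div₀]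
    congr 2
    exact (Complex.conj_ofReal _).symm
  slit t p q _ := shear_mem_slitPlane a t p q
  cont t p q hq := by
    by_cases hp : p = 0
    · subst hp
      rw [ContinuousAt, shear_zero_left, ← tendsto_sub_nhds_zero_iff]
      refine squeeze_zero_norm (a := fun x : unitInterval × ℂ × ℂ => |a x.1| * ‖x.2.1‖ / ‖x.2.2‖)
        (fun x => (norm_shear_sub_one_le a _ _ _).2) ?_
      have h1 : ContinuousAt (fun x : unitInterval × ℂ × ℂ => |a x.1| * ‖x.2.1‖ / ‖x.2.2‖)
          (t, 0, q) := by
        refine ContinuousAt.div ?_ ?_ (norm_ne_zero_iff.2 hq)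
        · exact Continuous.continuousAt (by fun_prop)
        · exact Continuous.continuousAt (by fun_prop)
      have h2 := h1.tendsto
      simpa using h2
    · have hstar : Continuous fun x : unitInterval × ℂ × ℂ => x.2.2 * star x.2.1 := by fun_prop
      refine continuousAt_const.add (ContinuousAt.div ?_ hstar.continuousAt
        (mul_ne_zero hq (star_ne_zero.2 hp)))
      refine Continuous.continuousAt (Complex.continuous_ofReal.comp ?_)
      refine (ha.comp continuous_fst).mul (Continuous.min ?_ (by fun_prop))
      exact (Complex.continuous_im.comp hstar).abs
  bdd := by
    obtain ⟨B, hB⟩ := isCompact_univ.exists_bound_of_continuousOn ha.continuousOn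
    refine ⟨B + 1, fun t p q => ?_⟩
    have h1 := (norm_shear_sub_one_le a t p q).1
    have h2 := hB t (Set.mem_univ t)
    rw [Real.norm_eq_abs] at h2
    have h3 := norm_add_le (shear a t p q - 1) 1
    rw [sub_add_cancel, norm_one] at h3
    linarith

theorem shear_inv (a : unitInterval → ℝ) (t : unitInterval) (p : ℂ) {q : ℂ} (hq : q ≠ 0) :
    shear (fun t => -a t) t p (q * shear a t p q) = (shear a t p q)⁻¹ := by
  by_cases hp : p = 0
  · rw [hp, shear_zero_left, shear_zero_left, inv_one]
  have hw : q * star p ≠ 0 := mul_ne_zero hq (star_ne_zero.2 hp)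
  have hk := Complex.slitPlane_ne_zero (shear_mem_slitPlane a t p q)
  obtain ⟨b, hb⟩ : ∃ b, b = a t * min |(q * star p).im| (‖p‖ ^ 2) := ⟨_, rfl⟩
  have h1 : q * shear a t p q * star p = q * star p + (b : ℂ) := by
    rw [shear, ← hb, mul_right_comm, mul_add, mul_one, mul_div_cancel₀ _ hw]
  have h2 : (q * shear a t p q * star p).im = (q * star p).im := by
    rw [h1, Complex.add_im, Complex.ofReal_im, add_zero]
  have h3 : q * shear a t p q * star p ≠ 0 :=
    mul_ne_zero (mul_ne_zero hq hk) (star_ne_zero.2 hp)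
  have h4 : shear (fun t => -a t) t p (q * shear a t p q)
      = 1 + ((-b : ℝ) : ℂ) / (q * shear a t p q * star p) := by
    rw [shear, h2, neg_mul, ← hb]
  have h5 : ((-b : ℝ) : ℂ) = q * star p - q * shear a t p q * star p := by
    rw [h1, Complex.ofReal_neg]
    ring
  rw [h4, h5]
  refine eq_inv_of_mul_eq_one_left ?_
  rw [sub_div, div_self h3, add_sub_cancel, mul_right_comm q, div_mul_eq_mul_div,
    div_self (mul_ne_zero hw hk)]

theorem exists_normalFamily_shear (a : ℝ) {σ τ : Fin 3 → ℂ} (hσ : Adm σ)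
    (hτ : ∀ i, τ i = σ i + ((a * min |(σ i).im| 1 : ℝ) : ℂ)) :
    ∃ hτ' : Adm τ, normalFamily hσ = normalFamily hτ' := by
  have hcont : Continuous fun t : unitInterval => (t : ℝ) * a := by fun_prop
  have hneg : Continuous fun t : unitInterval => -((t : ℝ) * a) := hcont.neg
  refine (isStretch_shear hcont).normalFamily_eq (isStretch_shear hneg)
    (fun t p q hq => shear_inv _ t p hq) (fun t p q hq => ?_) (fun p q => ?_) hσ fun i => ?_
  · have := shear_inv (fun t : unitInterval => -((t : ℝ) * a)) t p hq
    simpa only [neg_neg] using this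
  · simp [shear]
  · have h0 := hσ.ne_zero i
    rw [hτ]
    simp only [shear, star_one, mul_one, norm_one, one_pow]
    rw [mul_add, mul_div_cancel₀ _ h0]
    simp

/-! ### An invariant of the deformation families -/

/-- Outside of two conjugate points (or one real point), the set splits into three disjoint nonempty
closed parts, each invariant under the real structure. -/
def SplitsIntoRealParts (C : Set CP2) : Prop :=
  ∃ (P : CP2) (A : Fin 3 → Set CP2), (∀ i, IsClosed (A i)) ∧
    (∀ i, ∀ p ∈ A i, conjPoint p ∈ A i) ∧ (∀ i, ∃ p ∈ A i, p ∉ ({P, conjPoint P} : Set CP2)) ∧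
    (∀ i j, i ≠ j → A i ∩ A j ⊆ {P, conjPoint P}) ∧ C = ⋃ i, A i

theorem SplitsIntoRealParts.image {C : Set CP2} (h : SplitsIntoRealParts C) (H : CP2 ≃ₜ CP2)
    (hH : ∀ p, H (conjPoint p) = conjPoint (H p)) : SplitsIntoRealParts (H '' C) := by
  obtain ⟨P, A, h1, h2, h3, h4, h5⟩ := h
  have hmem : ∀ p, H p ∈ ({H P, conjPoint (H P)} : Set CP2) ↔ p ∈ ({P, conjPoint P} : Set CP2) := by
    intro p
    rw [← hH, Set.mem_insert_iff, Set.mem_singleton_iff, Set.mem_insert_iff,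
      Set.mem_singleton_iff, H.injective.eq_iff, H.injective.eq_iff]
  refine ⟨H P, fun i => H '' A i, fun i => H.isClosedMap _ (h1 i), ?_, fun i => ?_,
    fun i j hij => ?_, ?_⟩
  · rintro i _ ⟨p, hp, rfl⟩
    exact ⟨_, h2 i p hp, hH p⟩
  · obtain ⟨p, hp, hpP⟩ := h3 i
    exact ⟨H p, ⟨p, hp, rfl⟩, fun h => hpP ((hmem p).1 h)⟩
  · rw [← Set.image_inter H.injective]
    rintro _ ⟨p, hp, rfl⟩
    exact (hmem p).2 (h4 i j hij hp)
  · rw [h5, Set.image_iUnion]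

theorem splitsIntoRealParts_iff_of_deformation {F G : MvPolynomial (Fin 3) ℝ}
    (h : EquisingularDeformation F G) : SplitsIntoRealParts (curve (complexify F)) ↔
      SplitsIntoRealParts (curve (complexify G)) := by
  obtain ⟨Φ, -, -, -, ⟨c, hc, h1⟩, H, -, -, hH, hcurve⟩ := h
  have e : curve (complexify G) = H 1 '' curve (complexify F) := by
    rw [hcurve 1, h1, complexify_smul, curve_smul (Complex.ofReal_ne_zero.2 hc)]
  rw [e]
  refine ⟨fun h => h.image (H 1) (hH 1), fun h => ?_⟩
  have h2 := h.image (H 1).symm fun p => by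
    rw [Homeomorph.symm_apply_eq, hH, Homeomorph.apply_symm_apply]
  rwa [← Set.image_comp, (H 1).symm_comp_self, Set.image_id] at h2

theorem splitsIntoRealParts_iff_of_family_eq {F G : NonSimpleEmptySextic}
    (h : family F = family G) : SplitsIntoRealParts (curve (complexify F.1)) ↔
      SplitsIntoRealParts (curve (complexify G.1)) := by
  let inv : DeformationFamily → Prop := Quot.lift
    (fun F : NonSimpleEmptySextic => SplitsIntoRealParts (curve (complexify F.1)))
    fun F G h => propext (splitsIntoRealParts_iff_of_deformation h)
  exact iff_of_eq (congrArg inv h)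

theorem mem_curve_nf {σ : Fin 3 → ℂ} (p : CP2) : p ∈ curve (nf σ) ↔ ∃ i, p ∈ curve (quad (σ i)) := by
  simp only [curve, Set.mem_ofPred_eq, nf, map_prod, Finset.prod_eq_zero_iff, Finset.mem_univ,
    true_and]

theorem conjPoint_mem_curve_quad {s : ℂ} {p : CP2} (hp : p ∈ curve (quad s)) :
    conjPoint p ∈ curve (quad (star s)) := by
  induction p using Projectivization.ind with
  | h v hv =>
  rw [mk_mem_curve (isHomogeneous_quad s)] at hp
  rw [conjPoint_mk, mk_mem_curve (isHomogeneous_quad _), ← conjForm_quad, eval_conjForm, hp,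
    star_zero]

/-- The three parts are the conics; they meet only at the two common points. -/
theorem splitsIntoRealParts_nf {σ : Fin 3 → ℂ} (hσ : Adm σ) (hr : ∀ i, star (σ i) = σ i) :
    SplitsIntoRealParts (curve (nf σ)) := by
  have hconj : conjPoint (Projectivization.mk ℂ ![1, Complex.I, 0] (base_ne_zero _))
      = Projectivization.mk ℂ ![1, -Complex.I, 0] (base_ne_zero _) := by
    rw [conjPoint_mk]
    simp only [star_base]
  refine ⟨Projectivization.mk ℂ ![1, Complex.I, 0] (base_ne_zero _), fun i => curve (quad (σ i)),
    fun i => isClosed_curve (isHomogeneous_quad _), fun i p hp => ?_, fun i => ?_,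
    fun i j hij => ?_, ?_⟩
  · have := conjPoint_mem_curve_quad hp
    rwa [hr] at this
  · obtain ⟨z, hz⟩ := IsAlgClosed.exists_pow_nat_eq (σ i) (n := 2) (by norm_num)
    have hv : (![1, 0, z] : Fin 3 → ℂ) ≠ 0 := fun h => by simpa using congrFun h 0
    refine ⟨Projectivization.mk ℂ _ hv, ?_, ?_⟩
    · rw [mk_mem_curve (isHomogeneous_quad _), eval_quad]
      simp [hz]
    · rw [hconj, Set.mem_insert_iff, Set.mem_singleton_iff, mk_eq_mk, mk_eq_mk]
      rintro (⟨c, hc, h⟩ | ⟨c, hc, h⟩)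
      · have := congrFun h 1
        simp [hc] at this
      · have := congrFun h 1
        simp [hc] at this
  · rintro p ⟨hi, hj⟩
    rw [hconj]
    induction p using Projectivization.ind with
    | h v hv =>
    rw [mk_mem_curve (isHomogeneous_quad _)] at hi hj
    obtain ⟨hD, hz⟩ := eq_zero_of_eval_quad (fun h => hij (hσ.injective h)) hi hj
    exact mk_eq_base hv hD hz
  · ext p
    rw [mem_curve_nf, Set.mem_iUnion]

/-- The parametrization `w ↦ [w² + 1 : -i (w² - 1) : 2 κ w]` of the conic `z² = κ² (x² + y²)`
without a point. -/
noncomputable def conicPoint (κ w : ℂ) : Fin 3 → ℂ :=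
  ![w ^ 2 + 1, -Complex.I * (w ^ 2 - 1), 2 * κ * w]

/-- The same parametrization in the coordinate `1 / w`. -/
noncomputable def conicPointInv (κ w : ℂ) : Fin 3 → ℂ :=
  ![1 + w ^ 2, -Complex.I * (1 - w ^ 2), 2 * κ * w]

theorem conicPoint_ne_zero (κ w : ℂ) : conicPoint κ w ≠ 0 := by
  intro h
  have h0 : w ^ 2 + 1 = 0 := congrFun h 0
  have h1 : -Complex.I * (w ^ 2 - 1) = 0 := congrFun h 1
  have : (2 : ℂ) = 0 := by
    linear_combination h0 - Complex.I * h1 - (w ^ 2 - 1) * Complex.I_sq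
  norm_num at this

theorem conicPointInv_ne_zero (κ w : ℂ) : conicPointInv κ w ≠ 0 := by
  intro h
  have h0 : 1 + w ^ 2 = 0 := congrFun h 0
  have h1 : -Complex.I * (1 - w ^ 2) = 0 := congrFun h 1
  have : (2 : ℂ) = 0 := by
    linear_combination h0 + Complex.I * h1 + (1 - w ^ 2) * Complex.I_sq
  norm_num at this

theorem mk_conicPoint_mem (κ w : ℂ) :
    Projectivization.mk ℂ _ (conicPoint_ne_zero κ w) ∈ curve (quad (κ ^ 2)) := by
  rw [mk_mem_curve (isHomogeneous_quad _), eval_quad]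
  simp only [conicPoint, Matrix.cons_val]
  linear_combination (-κ ^ 2 * (w ^ 2 - 1) ^ 2) * Complex.I_sq

theorem mk_conicPoint_injective {κ : ℂ} (hκ : κ ≠ 0) : Function.Injective fun w =>
    Projectivization.mk ℂ _ (conicPoint_ne_zero κ w) := by
  intro w w' h
  obtain ⟨c, -, h⟩ := (mk_eq_mk _ _).1 h
  have h0 : w ^ 2 + 1 = c * (w' ^ 2 + 1) := congrFun h 0
  have h1 : -Complex.I * (w ^ 2 - 1) = c * (-Complex.I * (w' ^ 2 - 1)) := congrFun h 1
  have h2 : 2 * κ * w = c * (2 * κ * w') := congrFun h 2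
  have hc : c = 1 := by
    linear_combination (-1 / 2 : ℂ) * h0 + Complex.I / 2 * h1
      + ((w ^ 2 - 1) / 2 - c * (w' ^ 2 - 1) / 2) * Complex.I_sq
  rw [hc, one_mul] at h2
  exact mul_left_cancel₀ (mul_ne_zero two_ne_zero hκ) h2

theorem mk_conicPointInv {κ w : ℂ} (hw : w ≠ 0) :
    Projectivization.mk ℂ _ (conicPointInv_ne_zero κ w)
      = Projectivization.mk ℂ _ (conicPoint_ne_zero κ w⁻¹) := by
  refine (mk_eq_mk _ _).2 ⟨w ^ 2, pow_ne_zero 2 hw, funext fun i => ?_⟩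
  fin_cases i
  · change 1 + w ^ 2 = w ^ 2 * ((w⁻¹) ^ 2 + 1)
    field_simp
  · change -Complex.I * (1 - w ^ 2) = w ^ 2 * (-Complex.I * ((w⁻¹) ^ 2 - 1))
    field_simp
  · change 2 * κ * w = w ^ 2 * (2 * κ * w⁻¹)
    field_simp

theorem eq_mk_conicPoint_or {κ : ℂ} (hκ : κ ≠ 0) {p : CP2} (hp : p ∈ curve (quad (κ ^ 2))) :
    (∃ w, p = Projectivization.mk ℂ _ (conicPoint_ne_zero κ w)) ∨
      p = Projectivization.mk ℂ _ (conicPointInv_ne_zero κ 0) := by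
  induction p using Projectivization.ind with
  | h v hv =>
  rw [mk_mem_curve (isHomogeneous_quad _), eval_quad, sub_eq_zero] at hp
  obtain ⟨b, hb⟩ : ∃ b, b = v 0 - Complex.I * v 1 := ⟨_, rfl⟩
  obtain ⟨a, ha⟩ : ∃ a, a = v 0 + Complex.I * v 1 := ⟨_, rfl⟩
  have hab : v 2 ^ 2 = κ ^ 2 * (a * b) := by
    rw [hp, ha, hb]
    linear_combination (κ ^ 2 * v 1 ^ 2) * Complex.I_sq
  have h0 : v 0 = (a + b) / 2 := by rw [ha, hb]; ring
  have h1 : v 1 = -Complex.I * (a - b) / 2 := by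
    rw [ha, hb]
    linear_combination (v 1) * Complex.I_sq
  by_cases hb0 : b = 0
  · right
    rw [hb0, mul_zero, mul_zero] at hab
    have h2 : v 2 = 0 := (pow_eq_zero_iff two_ne_zero).1 hab
    rw [hb0] at h0 h1
    have ha0 : a ≠ 0 := by
      intro ha0
      rw [ha0] at h0 h1
      refine hv (funext fun i => ?_)
      fin_cases i
      · simpa using h0
      · simpa using h1
      · exact h2
    refine (mk_eq_mk _ _).2 ⟨a / 2, div_ne_zero ha0 two_ne_zero, funext fun i => ?_⟩
    fin_cases i
    · change v 0 = a / 2 * (1 + 0 ^ 2)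
      rw [h0]
      ring
    · change v 1 = a / 2 * (-Complex.I * (1 - 0 ^ 2))
      rw [h1]
      ring
    · change v 2 = a / 2 * (2 * κ * 0)
      rw [h2]
      ring
  · left
    refine ⟨v 2 / (κ * b), (mk_eq_mk _ _).2 ⟨b / 2, div_ne_zero hb0 two_ne_zero,
      funext fun i => ?_⟩⟩
    have hw : (v 2 / (κ * b)) ^ 2 = a / b := by
      rw [div_pow, hab]
      field_simp
    fin_cases i
    · change v 0 = b / 2 * ((v 2 / (κ * b)) ^ 2 + 1)
      rw [hw, h0]
      field_simp
    · change v 1 = b / 2 * (-Complex.I * ((v 2 / (κ * b)) ^ 2 - 1))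
      rw [hw, h1]
      field_simp
    · change v 2 = b / 2 * (2 * κ * (v 2 / (κ * b)))
      field_simp

/-- A conic remains connected when finitely many of its points are removed. -/
theorem isPreconnected_conic_diff {s : ℂ} (hs : s ≠ 0) {S : Set CP2} (hS : S.Finite) :
    IsPreconnected (curve (quad s) \ S) := by
  obtain ⟨κ, rfl⟩ := IsAlgClosed.exists_pow_nat_eq s (n := 2) (by norm_num)
  have hκ : κ ≠ 0 := by
    rintro rfl
    exact hs (by norm_num)
  obtain ⟨f, hf⟩ : ∃ f : ℂ → CP2, f = fun w => Projectivization.mk ℂ _ (conicPoint_ne_zero κ w) :=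
    ⟨_, rfl⟩
  obtain ⟨g, hg⟩ : ∃ g : ℂ → CP2, g = fun w =>
    Projectivization.mk ℂ _ (conicPointInv_ne_zero κ w) := ⟨_, rfl⟩
  have hfc : Continuous f := by
    rw [hf]
    refine isOpenQuotientMap_proj.continuous.comp
      (f := fun w => (⟨conicPoint κ w, conicPoint_ne_zero κ w⟩ : {v : Fin 3 → ℂ // v ≠ 0}))
      (Continuous.subtype_mk (continuous_pi fun i => ?_) _)
    fin_cases i
    · change Continuous fun w : ℂ => w ^ 2 + 1
      fun_prop
    · change Continuous fun w : ℂ => -Complex.I * (w ^ 2 - 1)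
      fun_prop
    · change Continuous fun w : ℂ => 2 * κ * w
      fun_prop
  have hgc : Continuous g := by
    rw [hg]
    refine isOpenQuotientMap_proj.continuous.comp
      (f := fun w => (⟨conicPointInv κ w, conicPointInv_ne_zero κ w⟩ : {v : Fin 3 → ℂ // v ≠ 0}))
      (Continuous.subtype_mk (continuous_pi fun i => ?_) _)
    fin_cases i
    · change Continuous fun w : ℂ => 1 + w ^ 2
      fun_prop
    · change Continuous fun w : ℂ => -Complex.I * (1 - w ^ 2)
      fun_prop
    · change Continuous fun w : ℂ => 2 * κ * w
      fun_prop
  have hfg : ∀ w, w ≠ 0 → g w = f w⁻¹ := fun w hw => by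
    rw [hf, hg]
    exact mk_conicPointInv hw
  have hfinj : Function.Injective f := by
    rw [hf]
    exact mk_conicPoint_injective hκ
  have hfin : (f ⁻¹' S).Finite := hS.preimage hfinj.injOn
  have hconn : IsPreconnected (f '' (f ⁻¹' S)ᶜ) :=
    (hfin.countable.isConnected_compl_of_one_lt_rank
      (by rw [Complex.rank_real_complex]; norm_num)).isPreconnected.image f hfc.continuousOn
  refine hconn.subset_closure ?_ ?_
  · rintro _ ⟨w, hw, rfl⟩
    refine ⟨?_, hw⟩
    rw [hf]
    exact mk_conicPoint_mem κ w
  · rintro p ⟨hp, hpS⟩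
    rcases eq_mk_conicPoint_or hκ hp with ⟨w, rfl⟩ | rfl
    · refine subset_closure ⟨w, ?_, by rw [hf]⟩
      rw [Set.mem_compl_iff, Set.mem_preimage, hf]
      exact hpS
    · -- the missing point is the limit of `f w` as `w` tends to infinity
      have hcount : ((fun w : ℂ => w⁻¹) ⁻¹' (f ⁻¹' S) ∪ {0}).Countable :=
        ((hfin.preimage inv_injective.injOn).union (Set.finite_singleton 0)).countable
      have hdense := hcount.dense_compl ℂ
      have h1 : g 0 ∈ closure (g '' ((fun w : ℂ => w⁻¹) ⁻¹' (f ⁻¹' S) ∪ {0})ᶜ) :=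
        image_closure_subset_closure_image hgc ⟨0, hdense 0, rfl⟩
      have h2 : g '' ((fun w : ℂ => w⁻¹) ⁻¹' (f ⁻¹' S) ∪ {0})ᶜ ⊆ f '' (f ⁻¹' S)ᶜ := by
        rintro _ ⟨w, hw, rfl⟩
        rw [Set.mem_compl_iff, Set.mem_union, not_or] at hw
        exact ⟨w⁻¹, hw.1, (hfg w hw.2).symm⟩
      have h3 := closure_mono h2 h1
      rwa [hg] at h3

/-- A connected set covered by three closed sets that are disjoint on it lies in one of them. -/
theorem exists_subset_of_isPreconnected {B S : Set CP2} (hB : IsPreconnected B)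
    (hBS : Disjoint B S) {A : Fin 3 → Set CP2} (hA : ∀ i, IsClosed (A i))
    (hdisj : ∀ i j, i ≠ j → A i ∩ A j ⊆ S) (hcov : B ⊆ ⋃ i, A i) : ∃ i, B ⊆ A i := by
  have hB' := isPreconnected_iff_subset_of_disjoint_closed.1 hB
  have hcov' : ∀ p ∈ B, p ∈ A 0 ∨ p ∈ A 1 ∨ p ∈ A 2 := by
    intro p hp
    obtain ⟨i, hi⟩ := Set.mem_iUnion.1 (hcov hp)
    fin_cases i
    · exact Or.inl hi
    · exact Or.inr (Or.inl hi)
    · exact Or.inr (Or.inr hi)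
  have hno : ∀ i j, i ≠ j → ∀ p ∈ B, p ∈ A i → p ∉ A j := fun i j hij p hp hi hj =>
    Set.disjoint_left.1 hBS hp (hdisj i j hij ⟨hi, hj⟩)
  have e0 : B ∩ (A 0 ∩ (A 1 ∪ A 2)) = ∅ := Set.eq_empty_of_forall_notMem fun p hp =>
    hp.2.2.elim (hno 0 1 (by decide) p hp.1 hp.2.1) (hno 0 2 (by decide) p hp.1 hp.2.1)
  have e1 : B ∩ (A 1 ∩ A 2) = ∅ := Set.eq_empty_of_forall_notMem fun p hp =>
    hno 1 2 (by decide) p hp.1 hp.2.1 hp.2.2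
  rcases hB' (A 0) (A 1 ∪ A 2) (hA 0) ((hA 1).union (hA 2)) hcov' e0 with h | h
  · exact ⟨0, h⟩
  · rcases hB' (A 1) (A 2) (hA 1) (hA 2) h e1 with h' | h'
    · exact ⟨1, h'⟩
    · exact ⟨2, h'⟩

/-- Two conjugate conics without finitely many points lie in the same part, so that one of three
parts is empty. -/
theorem not_splitsIntoRealParts_nf {σ : Fin 3 → ℂ} (hσ : Adm σ) (h12 : star (σ 1) = σ 2) :
    ¬ SplitsIntoRealParts (curve (nf σ)) := by
  rintro ⟨P, A, hcl, hconj, hne, hdisj, hcov⟩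
  obtain ⟨S, hS⟩ : ∃ S : Set CP2, S = {P, conjPoint P} := ⟨_, rfl⟩
  rw [← hS] at hdisj
  simp only [← hS] at hne
  have hSfin : S.Finite := by
    rw [hS]
    exact (Set.finite_singleton _).insert _
  have hSconj : ∀ p, p ∉ S → conjPoint p ∉ S := by
    intro p hp h
    apply hp
    rw [hS] at h ⊢
    rcases h with h | h
    · right
      rw [Set.mem_singleton_iff, ← h, conjPoint_conjPoint]
    · left
      have := congrArg conjPoint h
      rwa [conjPoint_conjPoint, conjPoint_conjPoint] at this
  have hpart : ∀ i, ∃ j, curve (quad (σ i)) \ S ⊆ A j := fun i =>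
    exists_subset_of_isPreconnected (isPreconnected_conic_diff (hσ.ne_zero i) hSfin)
      Set.disjoint_sdiff_left hcl hdisj fun p hp => by
        rw [← hcov, mem_curve_nf]
        exact ⟨i, hp.1⟩
  obtain ⟨j₀, h₀⟩ := hpart 0
  obtain ⟨j₁, h₁⟩ := hpart 1
  have h₂ : curve (quad (σ 2)) \ S ⊆ A j₁ := by
    rintro p ⟨hp, hpS⟩
    have h1 := conjPoint_mem_curve_quad hp
    rw [← h12, star_star] at h1
    have h2 := hconj _ _ (h₁ ⟨h1, hSconj p hpS⟩)
    rwa [conjPoint_conjPoint] at h2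
  have hthird : ∀ a b : Fin 3, ∃ k, k ≠ a ∧ k ≠ b := by decide
  obtain ⟨k, hk₀, hk₁⟩ := hthird j₀ j₁
  obtain ⟨p, hp, hpS⟩ := hne k
  have hpC : p ∈ curve (nf σ) := by
    rw [hcov]
    exact Set.mem_iUnion.2 ⟨k, hp⟩
  obtain ⟨i, hi⟩ := (mem_curve_nf p).1 hpC
  fin_cases i
  · exact hpS (hdisj k j₀ hk₀ ⟨hp, h₀ ⟨hi, hpS⟩⟩)
  · exact hpS (hdisj k j₁ hk₁ ⟨hp, h₁ ⟨hi, hpS⟩⟩)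
  · exact hpS (hdisj k j₁ hk₁ ⟨hp, h₂ ⟨hi, hpS⟩⟩)

/-! ### The two deformation families -/

theorem normalFamily_comp {σ : Fin 3 → ℂ} (hσ : Adm σ) (e : Equiv.Perm (Fin 3)) :
    normalFamily (adm_comp hσ e) = normalFamily hσ := by
  simp only [normalFamily, nf_comp]

/-- The parameters `-x₀`, `-x₁`, `-x₂`. -/
noncomputable def negParam (x : Fin 3 → ℝ) (i : Fin 3) : ℂ := -(x i : ℂ)

theorem exists_normalFamily_negParam {s₀ m : ℝ} (hs : 0 ≤ s₀) (hm : 0 < m) {x y : Fin 3 → ℝ}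
    (hx : ∀ i, 0 < x i) (hσ : Adm (negParam x))
    (hy : ∀ i, y i = x i + (m - 1) * max (x i - s₀) 0) :
    ∃ hτ : Adm (negParam y), normalFamily hσ = normalFamily hτ := by
  refine exists_normalFamily_radial hs hm hσ fun i => ?_
  have hn : ‖negParam x i‖ = x i := by
    rw [negParam, norm_neg, Complex.norm_real, Real.norm_eq_abs, abs_of_pos (hx i)]
  rw [hn, negParam, negParam, hy, neg_mul, ← Complex.ofReal_mul, mul_add, mul_one, mul_left_comm,
    mul_div_cancel₀ _ (hx i).ne']

/-- The normal form with three real conics. -/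
theorem adm_three : Adm (negParam ![1, 2, 3]) where
  injective := by
    intro i j h
    rw [negParam, negParam, neg_inj, Complex.ofReal_inj] at h
    fin_cases i <;> fin_cases j <;> first | rfl | (simp at h)
  conj := fun i => ⟨i, by simp [negParam]⟩
  ne_ofReal := by
    intro i r hr h
    rw [negParam, ← Complex.ofReal_neg, Complex.ofReal_inj] at h
    fin_cases i <;> simp at h <;> linarith

theorem normalFamily_negParam {a b c : ℝ} (ha : 0 < a) (hab : a < b) (hbc : b < c)
    (hσ : Adm (negParam ![a, b, c])) : normalFamily hσ = normalFamily adm_three := by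
  have h1 : ∃ h : Adm (negParam ![1, b / a, c / a]), normalFamily hσ = normalFamily h := by
    refine exists_normalFamily_negParam le_rfl (inv_pos.2 ha) (fun i => ?_) hσ fun i => ?_
    · fin_cases i
      · exact ha
      · exact ha.trans hab
      · exact ha.trans (hab.trans hbc)
    · have e : ∀ z : ℝ, 0 < z → z / a = z + (a⁻¹ - 1) * max (z - 0) 0 := fun z hz => by
        rw [sub_zero, max_eq_left hz.le]
        ring
      fin_cases i
      · exact (div_self ha.ne').symm.trans (e a ha)
      · exact e b (ha.trans hab)
      · exact e c (ha.trans (hab.trans hbc))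
  obtain ⟨hσ₁, e₁⟩ := h1
  have hb1 : 1 < b / a := (one_lt_div ha).2 hab
  have hc1 : b / a < c / a := div_lt_div_of_pos_right hbc ha
  obtain ⟨b', hb'⟩ : ∃ b', b' = b / a := ⟨_, rfl⟩
  obtain ⟨c', hc'⟩ : ∃ c', c' = c / a := ⟨_, rfl⟩
  rw [e₁]
  clear e₁
  revert hσ₁
  rw [← hb', ← hc']
  rw [← hb'] at hb1 hc1
  rw [← hc'] at hc1
  intro hσ₁
  clear hb' hc' hσ hab hbc ha
  have hb0 : 0 < b' - 1 := by linarith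
  have h2 : ∃ h : Adm (negParam ![1, 2, 1 + (c' - 1) / (b' - 1)]),
      normalFamily hσ₁ = normalFamily h := by
    refine exists_normalFamily_negParam zero_le_one (inv_pos.2 hb0) (fun i => ?_) hσ₁ fun i => ?_
    · fin_cases i
      · exact one_pos
      · exact one_pos.trans hb1
      · exact one_pos.trans (hb1.trans hc1)
    · fin_cases i
      · simp
      · change 2 = b' + ((b' - 1)⁻¹ - 1) * max (b' - 1) 0
        rw [max_eq_left hb0.le]
        field_simp
        ring
      · change 1 + (c' - 1) / (b' - 1) = c' + ((b' - 1)⁻¹ - 1) * max (c' - 1) 0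
        rw [max_eq_left (by linarith)]
        field_simp
        ring
  obtain ⟨hσ₂, e₂⟩ := h2
  have hd : 1 < (c' - 1) / (b' - 1) := (one_lt_div hb0).2 (by linarith)
  obtain ⟨d, hd'⟩ : ∃ d, d = 1 + (c' - 1) / (b' - 1) := ⟨_, rfl⟩
  rw [e₂]
  clear e₂
  revert hσ₂
  rw [← hd']
  intro hσ₂
  have hd2 : 0 < d - 2 := by linarith
  have h3 : ∃ h : Adm (negParam ![1, 2, 3]), normalFamily hσ₂ = normalFamily h := by
    refine exists_normalFamily_negParam zero_le_two (inv_pos.2 hd2) (fun i => ?_) hσ₂ fun i => ?_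
    · fin_cases i
      · exact one_pos
      · exact two_pos
      · change 0 < d
        linarith
    · fin_cases i
      · change 1 = 1 + ((d - 2)⁻¹ - 1) * max (1 - 2) (0 : ℝ)
        rw [max_eq_right (by norm_num)]
        ring
      · change 2 = 2 + ((d - 2)⁻¹ - 1) * max (2 - 2) (0 : ℝ)
        rw [max_eq_right (by norm_num)]
        ring
      · change 3 = d + ((d - 2)⁻¹ - 1) * max (d - 2) 0
        rw [max_eq_left hd2.le]
        field_simp
        ring
  obtain ⟨_, e₃⟩ := h3
  exact e₃

theorem exists_sorting_perm {x : Fin 3 → ℝ} (hx : Function.Injective x) :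
    ∃ e : Equiv.Perm (Fin 3), x (e 0) < x (e 1) ∧ x (e 1) < x (e 2) := by
  have hm := Tuple.monotone_sort x
  have hs := hm.strictMono_of_injective (hx.comp (Tuple.sort x).injective)
  exact ⟨Tuple.sort x, hs (by decide), hs (by decide)⟩

theorem Adm.normalFamily_eq_three {σ : Fin 3 → ℂ} (hσ : Adm σ) (hr : ∀ i, star (σ i) = σ i) :
    normalFamily hσ = normalFamily adm_three := by
  obtain ⟨x, rfl⟩ : ∃ x : Fin 3 → ℝ, σ = negParam x := by
    refine ⟨fun i => -(σ i).re, funext fun i => ?_⟩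
    rw [negParam, Complex.ofReal_neg, neg_neg]
    exact (Complex.conj_eq_iff_re.1 (hr i)).symm
  have hpos : ∀ i, 0 < x i := fun i => by
    by_contra! h
    exact hσ.ne_ofReal i (-x i) (by linarith) (by simp [negParam])
  obtain ⟨e, h01, h12⟩ := exists_sorting_perm (x := x) fun i j h =>
    hσ.injective (by rw [negParam, negParam, h])
  have hcomp : negParam x ∘ e = negParam ![x (e 0), x (e 1), x (e 2)] := by
    funext i
    fin_cases i <;> rfl
  have h1 := adm_comp hσ e
  have h2 := normalFamily_comp hσ e
  rw [← h2]
  revert h1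
  simp only [hcomp]
  exact fun h1 => normalFamily_negParam (hpos _) h01 h12 h1

/-- The parameters `-1`, `w` and the conjugate of `w`. -/
noncomputable def pairParam (w : ℂ) : Fin 3 → ℂ := ![-1, w, star w]

/-- The normal form with one real conic. -/
theorem adm_one : Adm (pairParam (2 * Complex.I)) where
  injective := by
    intro i j h
    have h1 := congrArg Complex.im h
    fin_cases i <;> fin_cases j <;>
      first | rfl | (simp [pairParam] at h1; done) | (simp [pairParam] at h1; norm_num at h1)
  conj := by
    intro i
    fin_cases i
    · exact ⟨0, by simp [pairParam]⟩
    · exact ⟨2, rfl⟩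
    · exact ⟨1, star_star _⟩
  ne_ofReal := by
    intro i r hr h
    have h1 := congrArg Complex.im h
    have h2 := congrArg Complex.re h
    fin_cases i
    · simp [pairParam] at h2
      linarith
    · simp [pairParam] at h1
    · simp [pairParam] at h1

theorem exists_normalFamily_pair_shear {w w' : ℂ} (a : ℝ) (hσ : Adm (pairParam w))
    (hw : w' = w + ((a * min |w.im| 1 : ℝ) : ℂ)) :
    ∃ h : Adm (pairParam w'), normalFamily hσ = normalFamily h := by
  refine exists_normalFamily_shear a hσ fun i => ?_
  fin_cases i
  · simp [pairParam]
  · exact hw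
  · change star w' = star w + ((a * min |(star w).im| 1 : ℝ) : ℂ)
    have h1 : (star w).im = -w.im := Complex.conj_im w
    rw [h1, abs_neg, hw, star_add]
    congr 1
    exact Complex.conj_ofReal _

theorem exists_normalFamily_pair_radial {w w' : ℂ} {m : ℝ} (hm : 0 < m) (hσ : Adm (pairParam w))
    (hw : w' = w * ((1 + (m - 1) * (max (‖w‖ - 1) 0 / ‖w‖) : ℝ) : ℂ)) :
    ∃ h : Adm (pairParam w'), normalFamily hσ = normalFamily h := by
  refine exists_normalFamily_radial zero_le_one hm hσ fun i => ?_
  fin_cases i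
  · simp [pairParam]
  · exact hw
  · change star w' = star w * ((1 + (m - 1) * (max (‖star w‖ - 1) 0 / ‖star w‖) : ℝ) : ℂ)
    rw [norm_star, hw, star_mul']
    congr 1
    exact Complex.conj_ofReal _

theorem normalFamily_pairParam {w : ℂ} (hw : 0 < w.im) (hσ : Adm (pairParam w)) :
    normalFamily hσ = normalFamily adm_one := by
  obtain ⟨b, hb⟩ : ∃ b, b = w.im := ⟨_, rfl⟩
  have hb0 : 0 < b := by rw [hb]; exact hw
  have hmin : 0 < min |w.im| 1 := lt_min (abs_pos.2 hw.ne') one_pos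
  -- a shear makes the real part equal to one, so that the norm is greater than one
  obtain ⟨h₁, e₁⟩ := exists_normalFamily_pair_shear (w' := 1 + b * Complex.I)
    ((1 - w.re) / min |w.im| 1) hσ (by
      rw [div_mul_cancel₀ _ hmin.ne', hb]
      apply Complex.ext <;> simp)
  obtain ⟨ρ, hρ⟩ : ∃ ρ, ρ = ‖(1 + b * Complex.I : ℂ)‖ := ⟨_, rfl⟩
  have hρ2 : ρ ^ 2 = 1 + b ^ 2 := by
    rw [hρ, ← Complex.normSq_eq_norm_sq, Complex.normSq_apply]
    simp
    ring
  have hρ0 : 0 ≤ ρ := by rw [hρ]; exact norm_nonneg _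
  have hρ1 : 1 < ρ := by nlinarith [pow_pos hb0 2]
  have hρb : b < ρ := by nlinarith
  have hm : 0 < (2 * ρ / b - 1) / (ρ - 1) := by
    refine div_pos ?_ (by linarith)
    rw [sub_pos, one_lt_div hb0]
    linarith
  -- a radial stretch makes the imaginary part equal to two
  obtain ⟨h₂, e₂⟩ := exists_normalFamily_pair_radial (w' := 2 / b + 2 * Complex.I) hm h₁ (by
    rw [← hρ, max_eq_left (by linarith)]
    have e : 1 + ((2 * ρ / b - 1) / (ρ - 1) - 1) * ((ρ - 1) / ρ) = 2 / b := by
      have h1 : ρ - 1 ≠ 0 := by linarith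
      have h2 : ρ ≠ 0 := by linarith
      field_simp
      ring
    rw [e]
    have hbC : (b : ℂ) ≠ 0 := Complex.ofReal_ne_zero.2 hb0.ne'
    push_cast
    field_simp)
  obtain ⟨h₃, e₃⟩ := exists_normalFamily_pair_shear (w' := 2 * Complex.I) (-(2 / b)) h₂ (by
    have e : (2 / b + 2 * Complex.I : ℂ).im = 2 := by
      have : (2 / b : ℂ) = ((2 / b : ℝ) : ℂ) := by push_cast; rfl
      rw [this]
      simp
    rw [e, abs_two, min_eq_right one_le_two]
    push_cast
    ring)
  rw [e₁, e₂, e₃]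

theorem Adm.normalFamily_eq_one {σ : Fin 3 → ℂ} (hσ : Adm σ) (h0 : star (σ 0) = σ 0)
    (h12 : star (σ 1) = σ 2) (hne : star (σ 1) ≠ σ 1) :
    normalFamily hσ = normalFamily adm_one := by
  obtain ⟨a, ha⟩ : ∃ a : ℝ, σ 0 = -(a : ℂ) := ⟨-(σ 0).re, by
    rw [Complex.ofReal_neg, neg_neg]
    exact (Complex.conj_eq_iff_re.1 h0).symm⟩
  have ha0 : 0 < a := by
    by_contra! h
    exact hσ.ne_ofReal 0 (-a) (by linarith) (by rw [ha, Complex.ofReal_neg])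
  have h1 : ∃ h : Adm (pairParam (σ 1 * ((a⁻¹ : ℝ) : ℂ))), normalFamily hσ = normalFamily h := by
    refine exists_normalFamily_radial le_rfl (inv_pos.2 ha0) hσ fun i => ?_
    have hi : 1 + (a⁻¹ - 1) * (max (‖σ i‖ - 0) 0 / ‖σ i‖) = a⁻¹ := by
      rw [sub_zero, max_eq_left (norm_nonneg _), div_self (norm_ne_zero_iff.2 (hσ.ne_zero i))]
      ring
    rw [hi]
    fin_cases i
    · change -1 = σ 0 * ((a⁻¹ : ℝ) : ℂ)
      have haC : (a : ℂ) ≠ 0 := Complex.ofReal_ne_zero.2 ha0.ne'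
      rw [ha, Complex.ofReal_inv, neg_mul, mul_inv_cancel₀ haC]
    · rfl
    · change star (σ 1 * ((a⁻¹ : ℝ) : ℂ)) = σ 2 * ((a⁻¹ : ℝ) : ℂ)
      rw [star_mul', h12]
      congr 1
      exact Complex.conj_ofReal _
  obtain ⟨h, e⟩ := h1
  obtain ⟨w, hw⟩ : ∃ w, w = σ 1 * ((a⁻¹ : ℝ) : ℂ) := ⟨_, rfl⟩
  rw [e]
  clear e
  revert h
  rw [← hw]
  intro h
  have him : w.im ≠ 0 := by
    intro h0
    have h1 : w.im = (σ 1).im * a⁻¹ := by rw [hw, Complex.im_mul_ofReal]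
    rw [h1, mul_eq_zero, or_iff_left (inv_ne_zero ha0.ne')] at h0
    exact hne (Complex.conj_eq_iff_im.2 h0)
  rcases him.lt_or_gt with hlt | hgt
  · -- the two nonreal parameters are interchanged
    have hcomp : pairParam w ∘ Equiv.swap (1 : Fin 3) 2 = pairParam (star w) := by
      funext i
      fin_cases i
      · rfl
      · rfl
      · exact (star_star w).symm
    have h1 := adm_comp h (Equiv.swap 1 2)
    rw [← normalFamily_comp h (Equiv.swap 1 2)]
    revert h1
    simp only [hcomp]
    refine fun h1 => normalFamily_pairParam ?_ h1
    have : (star w).im = -w.im := Complex.conj_im w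
    rw [this]
    linarith
  · exact normalFamily_pairParam hgt h

theorem HasNormalForm.family_cases {F : NonSimpleEmptySextic} {σ : Fin 3 → ℂ}
    (h : HasNormalForm F.1 σ) :
    (HasThreeRealConics F.1 ∧ family F = normalFamily adm_three) ∨
      (¬ HasThreeRealConics F.1 ∧ family F = normalFamily adm_one) := by
  rcases h.adm.all_real_or_one_real with hr | ⟨e, h0, h1, h2⟩
  · refine Or.inl ⟨h.hasThreeRealConics_iff.2 hr, ?_⟩
    rw [← h.adm.normalFamily_eq_three hr, ← h.family_eq F.2]
    rfl
  · refine Or.inr ⟨fun h3 => h2 (h.hasThreeRealConics_iff.1 h3 (e 1)), ?_⟩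
    have h' := h.comp e
    rw [← h'.adm.normalFamily_eq_one h0 h1 h2, ← h'.family_eq F.2]
    rfl

theorem normalFamily_three_ne_one : normalFamily adm_three ≠ normalFamily adm_one := by
  intro h
  have h1 := splitsIntoRealParts_iff_of_family_eq h
  simp only [complexify_realForm_nf adm_three, complexify_realForm_nf adm_one] at h1
  refine not_splitsIntoRealParts_nf adm_one rfl (h1.1 (splitsIntoRealParts_nf adm_three fun i => ?_))
  simp [negParam]

theorem family_cases (F : NonSimpleEmptySextic) :
    (HasThreeRealConics F.1 ∧ family F = normalFamily adm_three) ∨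
      (¬ HasThreeRealConics F.1 ∧ family F = normalFamily adm_one) := by
  obtain ⟨σ, h⟩ := exists_hasNormalForm F.2
  exact h.family_cases

theorem card_deformationFamily : Nat.card DeformationFamily = 2 := by
  rw [Nat.card_eq_two_iff]
  refine ⟨_, _, normalFamily_three_ne_one, Set.eq_univ_of_forall fun x => ?_⟩
  induction x using Quot.ind with
  | mk F =>
    rcases family_cases F with ⟨-, h⟩ | ⟨-, h⟩
    · exact Or.inl h
    · exact Or.inr h

theorem family_eq_iff (F G : NonSimpleEmptySextic) :
    family F = family G ↔ (HasThreeRealConics F.1 ↔ HasThreeRealConics G.1) := by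
  have h0 := normalFamily_three_ne_one
  rcases family_cases F with ⟨hF, eF⟩ | ⟨hF, eF⟩ <;>
    rcases family_cases G with ⟨hG, eG⟩ | ⟨hG, eG⟩ <;> simp [eF, eG, hF, hG, h0, h0.symm]

end EmptySextics

theorem mainTheorem5 :
    Nat.card DeformationFamily = 2 ∧
    (∀ F : MvPolynomial (Fin 3) ℝ, IsNonSimpleEmptySextic F →
      ∃ Q O, SplitsIntoTangentConics F Q O ∧ (AllConicsReal Q ∨ OneConicReal Q)) ∧
    (∀ F G : NonSimpleEmptySextic,
      family F = family G ↔ (HasThreeRealConics F.1 ↔ HasThreeRealConics G.1)) :=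
  ⟨card_deformationFamily, fun _ hF => exists_splitting hF, family_eq_iff⟩
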